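/- **Setting.** There are $K<\infty$ cluster types. A cluster of type $k$ has $M_k$ units, outcome vector $Y\in\mathbb R^{M_k}$, treatment vector $A\in\mathcal A(M_k)=\{0,1\}^{M_k}$, finite-dimensional covariates $X$, and potential outcomes $Y(a)\in\mathbb R^{M_k}$, $a\in\mathcal A(M_k)$; $O=(Y,A,X)$ is the observed data and $L\in\{1,\dots,K\}$ the cluster type. Clusters $i=1,2,\dots$ are independent with common law $P(L=k)=p_k^*>0$, $\sum_k p_k^*=1$, and an arbitrary conditional law of the data given $L=k$. Let $P_k$ be the law of $X$ given $L=k$, and let $e^*(a\mid x,k)=\mathrm{pr}(A=a\mid X=x,L=k)$, $g^*(a,x,k)=E(Y\mid A=a,X=x,L=k)$, $\Sigma^*(a,x,k)=\mathrm{var}(Y\mid A=a,X=x,L=k)$. Assume for all $k$, all $a\in\mathcal A(M_k)$ and ($P_k$-almost) all $x$: (A1) $Y=Y(A)$; (A2) $Y(a)$ is independent of $A$ given $(X,L=k)$; (A3) $c<e^*(a\mid x,k)<1-c$ for a constant $c>0$; (A4) $E\{g^*(a,X,k)\mid L=k\}$ and $E\{\Sigma^*(a,X,k)\mid L=k\}$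 exist and are finite, and $\Sigma^*(a,x,k)$ is positive definite. **Estimand.** Let $w_k(a,x)\in\mathbb R^{M_k}$ be bounded measurable weights and $v_k$ continuously differentiable functions of the type probability. Put $\theta_k^*=\sum_{a}E\{w_k(a,X)^{\mathsf T}Y(a)\mid L=k\}$ and $\tau^*=\sum_k v_k(p_k^*)\theta_k^*$. **Estimator.** For functions $e,g$ let $$\phi_k(O,e,g)=\mathbb 1(L=k)\Big[\frac{w_k(A,X)^{\mathsf T}\{Y-g(A,X,k)\}}{e(A\mid X,k)}+\sum_{a\in\mathcal A(M_k)}w_k(a,X)^{\mathsf T}g(a,X,k)\Big].$$ From $N$ clusters, let $N_k$ be the number of type $k$ and $\hat p_k=N_k/N$. Split the index set into disjoint $\mathcal I_1,\mathcal I_2$ using only the cluster types and auxiliary randomness independent of the sample (for instance a random halving within each type), and let $\tilde g_{(-\ell)}$ be an outcome regression fitted on the observed data of the subsample $\mathcal I_\ell^c$ (possibly with auxiliary randomness). With the true propensity score $e^*$ in place of an estimated one, put $$\tilde\theta_k=\frac1{N_k}\sum_{\ell=1}^2\sum_{i\in\mathcal I_\ell}\phi_k(O_i,e^*,\tilde g_{(-\ell)}),\qquad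 \tilde\tau=\sum_k v_k(\hat p_k)\tilde\theta_k,$$ $$\tilde\sigma^2=\frac1N\sum_{\ell=1}^2\sum_{i\in\mathcal I_\ell}\Big[\sum_{k}\Big(\frac{\mathbb 1(L_i=k)v_k(\hat p_k)}{\hat p_k}\{\phi_k(O_i,e^*,\tilde g_{(-\ell)})-\tilde\theta_k\}+\{\mathbb 1(L_i=k)-\hat p_k\}v_k'(\hat p_k)\tilde\theta_k\Big)\Big]^2.$$ **Corollary.** Suppose there are a constant $\tilde C\in(0,\infty)$ and a measurable function $g'$, possibly different from $g^*$, such that for all $\ell$, $k$, $a\in\mathcal A(M_k)$ and ($P_k$-almost) all $x$ the quantities $\|g^*(a,x,k)\|_2$, $\|\Sigma^*(a,x,k)\|_2$, $\|g'(a,x,k)\|_2$ and (almost surely) $\|\tilde g_{(-\ell)}(a,x,k)\|_2$ are at most $\tilde C$, and such that, for some $r_{g,N}=o(1)$, $$\int\|g'(a,x,k)-\tilde g_{(-\ell)}(a,x,k)\|_2^2\,dP_k(x)=O_P(r_{g,N}^2)\quad\text{as }N\to\infty .$$ Let $$\delta'=\sum_{k}\Big[v_k(p_k^*)\frac{\mathbb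 1(L=k)\{\phi_k(O,e^*,g')-\theta_k^*\}}{p_k^*}+\{\mathbb 1(L=k)-p_k^*\}v_k'(p_k^*)\theta_k^*\Big]+\tau^* .$$ Then $\sigma^2=\mathrm{var}(\delta')$ is finite, $N^{1/2}(\tilde\tau-\tau^*)$ converges weakly to $N(0,\sigma^2)$, and $\tilde\sigma^2\to\sigma^2$ in probability as $N\to\infty$. -/

import Mathlib

open MeasureTheory ProbabilityTheory Filter Topology

noncomputable section

namespace PartialInterference

/-! ### Data of one cluster -/

/-- Treatment vectors of a cluster with `m` units, the set of `m`-dimensional binary vectors. -/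
abbrev Treat (m : ℕ) := Fin m → Bool

/-- Outcome vectors of a cluster with `m` units, with the Euclidean norm. -/
abbrev Outcome (m : ℕ) := EuclideanSpace ℝ (Fin m)

/-- Covariates of a cluster with `m` units, one vector in `ℝ^d` for each unit. -/
abbrev Covar (m d : ℕ) := Fin m → EuclideanSpace ℝ (Fin d)

/-- Observed data `(Y, A, X)` of a cluster of known type. -/
abbrev ObsData (m d : ℕ) := Outcome m × Treat m × Covar m d

/-- Potential outcomes `a ↦ Y(a)` together with the observed data `(Y, A, X)`. -/
abbrev FullData (m d : ℕ) := (Treat m → Outcome m) × ObsData m d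

instance instStandardBorelSpaceFullData (m d : ℕ) : StandardBorelSpace (FullData m d) :=
  @StandardBorelSpace.prod (Treat m → Outcome m) _ (ObsData m d) _ inferInstance inferInstance

/-- A cluster type `L` together with the full data of a cluster of that type. The cluster size
`M k` and the number of covariates `d k` depend on the type. -/
abbrev Cluster {K : ℕ} (M d : Fin K → ℕ) := Σ k : Fin K, FullData (M k) (d k)

/-- A cluster type `L` together with the observed data `O = (Y, A, X)`. -/
abbrev ObsCluster {K : ℕ} (M d : Fin K → ℕ) := Σ k : Fin K, ObsData (M k) (d k)

/-- Forget the potential outcomes. -/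
def obs {K : ℕ} {M d : Fin K → ℕ} (z : Cluster M d) : ObsCluster M d := ⟨z.1, z.2.2⟩

/-- The observed outcome vector. -/
def outcomeOf {m d : ℕ} (z : FullData m d) : Outcome m := z.2.1

/-- The observed treatment vector. -/
def treatOf {m d : ℕ} (z : FullData m d) : Treat m := z.2.2.1

/-- The covariates. -/
def covarOf {m d : ℕ} (z : FullData m d) : Covar m d := z.2.2.2

theorem measurable_covarOf {m d : ℕ} :
    Measurable (covarOf : FullData m d → Covar m d) :=
  measurable_snd.snd.snd

/-- Vector-valued functions of `(a, x, k)` with values in `ℝ^{M_k}`: outcome regressions `g` and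
weights `w_k(a, x)`. -/
abbrev VecFun {K : ℕ} (M d : Fin K → ℕ) :=
  (k : Fin K) → Treat (M k) → Covar (M k) (d k) → Outcome (M k)

/-- Scalar functions of `(a, x, k)`, such as propensity scores `e(a | x, k)`. -/
abbrev ScalarFun {K : ℕ} (M d : Fin K → ℕ) :=
  (k : Fin K) → Treat (M k) → Covar (M k) (d k) → ℝ

/-! ### The model -/

/-- The law of a cluster: type probabilities `p_k = P(L = k) > 0` and, for each type, an
arbitrary conditional law of the cluster's data given `L = k`. -/
structure Model {K : ℕ} (M d : Fin K → ℕ) where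
  p : Fin K → ℝ
  p_pos : ∀ k, 0 < p k
  p_sum : ∑ k, p k = 1
  law : (k : Fin K) → Measure (FullData (M k) (d k))
  isProb : ∀ k, IsProbabilityMeasure (law k)

namespace Model

variable {K : ℕ} {M d : Fin K → ℕ}

instance (𝓜 : Model M d) (k : Fin K) : IsProbabilityMeasure (𝓜.law k) := 𝓜.isProb k

/-- The joint law of type and data, `P(L = k) P(data | L = k)` on the type-`k` part. -/
def clusterLaw (𝓜 : Model M d) : Measure (Cluster M d) :=
  ∑ k, ENNReal.ofReal (𝓜.p k) • (𝓜.law k).map (Sigma.mk k)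

/-- `P_k`, the law of the covariates `X` given `L = k`. -/
def covLaw (𝓜 : Model M d) (k : Fin K) : Measure (Covar (M k) (d k)) :=
  (𝓜.law k).map covarOf

/-- `e*(a | x, k) = pr(A = a | X = x, L = k)`. -/
def propensity (𝓜 : Model M d) : ScalarFun M d := fun k a x =>
  (condDistrib treatOf covarOf (𝓜.law k) x).real {a}

/-- The conditional law of `Y` given `A = a`, `X = x`, `L = k`. -/
def outcomeLaw (𝓜 : Model M d) (k : Fin K) (a : Treat (M k)) (x : Covar (M k) (d k)) :
    Measure (Outcome (M k)) :=
  condDistrib outcomeOf (fun z => (treatOf z, covarOf z)) (𝓜.law k) (a, x)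

/-- `g*(a, x, k) = E(Y | A = a, X = x, L = k)`. -/
def outcomeReg (𝓜 : Model M d) : VecFun M d := fun k a x =>
  ∫ y, y ∂(𝓜.outcomeLaw k a x)

/-- `Σ*(a, x, k) = var(Y | A = a, X = x, L = k)`, the conditional covariance matrix. -/
def outcomeCov (𝓜 : Model M d) (k : Fin K) (a : Treat (M k)) (x : Covar (M k) (d k)) :
    Matrix (Fin (M k)) (Fin (M k)) ℝ :=
  Matrix.of fun i j => covariance (fun y : Outcome (M k) => y i) (fun y => y j)
    (𝓜.outcomeLaw k a x)

/-- Consistency, conditional ignorability, positivity, and existence of moments. Since the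
conditional objects are determined up to null sets of covariates, statements for all `x` in the
support of the covariates are read almost everywhere with respect to `P_k`. -/
structure CausalAssumptions (𝓜 : Model M d) : Prop where
  consistency : ∀ k, ∀ᵐ z ∂(𝓜.law k), outcomeOf z = z.1 (treatOf z)
  ignorability : ∀ (k : Fin K) (a : Treat (M k)),
    CondIndepFun (MeasurableSpace.comap covarOf inferInstance) measurable_covarOf.comap_le
      (fun z : FullData (M k) (d k) => z.1 a) treatOf (𝓜.law k)
  positivity : ∃ c : ℝ, 0 < c ∧ ∀ (k : Fin K) (a : Treat (M k)), ∀ᵐ x ∂(𝓜.covLaw k),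
    c < 𝓜.propensity k a x ∧ 𝓜.propensity k a x < 1 - c
  second_moment : ∀ (k : Fin K) (a : Treat (M k)), ∀ᵐ x ∂(𝓜.covLaw k),
    MemLp (fun y : Outcome (M k) => y) 2 (𝓜.outcomeLaw k a x)
  mean_integrable : ∀ (k : Fin K) (a : Treat (M k)),
    Integrable (𝓜.outcomeReg k a) (𝓜.covLaw k)
  cov_integrable : ∀ (k : Fin K) (a : Treat (M k)) (i j : Fin (M k)),
    Integrable (fun x => 𝓜.outcomeCov k a x i j) (𝓜.covLaw k)
  cov_posDef : ∀ (k : Fin K) (a : Treat (M k)), ∀ᵐ x ∂(𝓜.covLaw k),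
    (𝓜.outcomeCov k a x).PosDef

/-- `θ_k* = ∑_a E{w_k(a, X)ᵀ Y(a) | L = k}`, in terms of the potential outcomes. -/
def theta (𝓜 : Model M d) (w : VecFun M d) (k : Fin K) : ℝ :=
  ∑ a : Treat (M k), ∫ z, inner ℝ (w k a (covarOf z)) (z.1 a) ∂(𝓜.law k)

/-- `τ* = ∑_k v_k(p_k*) θ_k*`. -/
def tau (𝓜 : Model M d) (w : VecFun M d) (v : Fin K → ℝ → ℝ) : ℝ :=
  ∑ k, v k (𝓜.p k) * 𝓜.theta w k

end Model

/-! ### The augmented inverse-probability-weighted score -/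

section Score

variable {K : ℕ} {M d : Fin K → ℕ}

/-- The indicator `1(L = k)`. -/
def typeInd (k : Fin K) (o : ObsCluster M d) : ℝ := if o.1 = k then 1 else 0

/-- The bracket of the score for a cluster of type `k` with observed data `(Y, A, X)`. -/
def scoreCore (w : VecFun M d) (e : ScalarFun M d) (g : VecFun M d) (k : Fin K)
    (o : ObsData (M k) (d k)) : ℝ :=
  inner ℝ (w k o.2.1 o.2.2) (o.1 - g k o.2.1 o.2.2) / e k o.2.1 o.2.2
    + ∑ a : Treat (M k), inner ℝ (w k a o.2.2) (g k a o.2.2)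

/-- `φ_k(O, e, g)`, which vanishes unless `L = k`. -/
def score (w : VecFun M d) (e : ScalarFun M d) (g : VecFun M d) (k : Fin K)
    (o : ObsCluster M d) : ℝ :=
  if o.1 = k then scoreCore w e g o.1 o.2 else 0

/-- The variable `δ'` with outcome function `g` and the true propensity score:
`∑_k [v_k(p_k*) 1(L = k) {φ_k(O, e*, g) - θ_k*} / p_k* + {1(L = k) - p_k*} v_k'(p_k*) θ_k*] + τ*`. -/
def Model.delta (𝓜 : Model M d) (w : VecFun M d) (v : Fin K → ℝ → ℝ) (g : VecFun M d)
    (o : ObsCluster M d) : ℝ :=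
  (∑ k, (v k (𝓜.p k) *
      (typeInd k o * (score w 𝓜.propensity g k o - 𝓜.theta w k) / 𝓜.p k)
    + (typeInd k o - 𝓜.p k) * deriv (v k) (𝓜.p k) * 𝓜.theta w k))
  + 𝓜.tau w v

end Score

/-! ### Cross-fitting -/

/-- A cross-fitting procedure with auxiliary randomness in `𝒰`.
* `split N u l i` is the fold of the `i`-th of `N` clusters; the split is within cluster types, so
  it may depend on the cluster types `l` and on the auxiliary randomness `u`, but not on the data.
* `learner N ℓ u s D` is the outcome regression fitted for fold `ℓ` from the subsample with index
  set `s` and observed data `D`. -/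
structure CrossFit {K : ℕ} (M d : Fin K → ℕ) (𝒰 : Type*) [MeasurableSpace 𝒰] where
  split : (N : ℕ) → 𝒰 → (Fin N → Fin K) → Fin N → Fin 2
  measurable_split : ∀ N, Measurable fun z : 𝒰 × (Fin N → Fin K) => split N z.1 z.2
  learner : (N : ℕ) → Fin 2 → 𝒰 → (s : Finset (Fin N)) → (s → ObsCluster M d) → VecFun M d
  measurable_learner : ∀ (N : ℕ) (ℓ : Fin 2) (s : Finset (Fin N)) (k : Fin K) (a : Treat (M k)),
    Measurable fun z : (𝒰 × (s → ObsCluster M d)) × Covar (M k) (d k) =>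
      learner N ℓ z.1.1 s z.1.2 k a z.2

section Estimators

variable {K : ℕ} {M d : Fin K → ℕ}

/-- `N_k`, the number of clusters of type `k` in a sample of size `N`. -/
def typeCount {N : ℕ} (o : Fin N → ObsCluster M d) (k : Fin K) : ℕ :=
  (Finset.univ.filter fun i => (o i).1 = k).card

/-- The empirical type probability `N_k / N`. -/
def pHat {N : ℕ} (o : Fin N → ObsCluster M d) (k : Fin K) : ℝ := (typeCount o k : ℝ) / N

namespace CrossFit

variable {𝒰 : Type*} [MeasurableSpace 𝒰]

/-- The index set of fold `ℓ`. -/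
def fold (S : CrossFit M d 𝒰) {N : ℕ} (u : 𝒰) (o : Fin N → ObsCluster M d) (ℓ : Fin 2) :
    Finset (Fin N) :=
  Finset.univ.filter fun i => S.split N u (fun j => (o j).1) i = ℓ

/-- The outcome regression used on fold `ℓ`, fitted on the complement of fold `ℓ`. -/
def gTilde (S : CrossFit M d 𝒰) {N : ℕ} (u : 𝒰) (o : Fin N → ObsCluster M d) (ℓ : Fin 2) :
    VecFun M d :=
  S.learner N ℓ u (S.fold u o ℓ)ᶜ fun i => o i

/-- The cross-fitting estimator of `θ_k*`, with propensity score `e` in both folds. -/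
def thetaTilde (S : CrossFit M d 𝒰) (w : VecFun M d) (e : ScalarFun M d) {N : ℕ} (u : 𝒰)
    (o : Fin N → ObsCluster M d) (k : Fin K) : ℝ :=
  (∑ ℓ : Fin 2, ∑ i ∈ S.fold u o ℓ, score w e (S.gTilde u o ℓ) k (o i)) / typeCount o k

/-- The cross-fitting estimator of `τ*`. -/
def tauTilde (S : CrossFit M d 𝒰) (w : VecFun M d) (v : Fin K → ℝ → ℝ) (e : ScalarFun M d)
    {N : ℕ} (u : 𝒰) (o : Fin N → ObsCluster M d) : ℝ :=
  ∑ k, v k (pHat o k) * S.thetaTilde w e u o k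

/-- The variance estimator of the cross-fitting estimator of `τ*`. -/
def sigmaSqTilde (S : CrossFit M d 𝒰) (w : VecFun M d) (v : Fin K → ℝ → ℝ) (e : ScalarFun M d)
    {N : ℕ} (u : 𝒰) (o : Fin N → ObsCluster M d) : ℝ :=
  1 / (N : ℝ) * ∑ ℓ : Fin 2, ∑ i ∈ S.fold u o ℓ,
    (∑ k, (typeInd k (o i) * v k (pHat o k) / pHat o k *
        (score w e (S.gTilde u o ℓ) k (o i) - S.thetaTilde w e u o k)
      + (typeInd k (o i) - pHat o k) * deriv (v k) (pHat o k) * S.thetaTilde w e u o k)) ^ 2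

end CrossFit

end Estimators

/-! ### Stochastic order -/

/-- `X_N = O_P(r_N)` as `N → ∞`. -/
def IsBigOP {Ω : Type*} [MeasurableSpace Ω] (P : Measure Ω) (X : ℕ → Ω → ℝ) (r : ℕ → ℝ) : Prop :=
  ∀ ε : ℝ, 0 < ε → ∃ B : ℝ, ∀ᶠ N in atTop,
    P {ω | B * |r N| < |X N ω|} ≤ ENNReal.ofReal ε

end PartialInterference

end

/-! With the true propensity score, the score is unbiased for `θ_k*` whatever outcome regression is
plugged in. By ignorability, weighting the clusters with `A = a` by the inverse propensity recovers
the joint law of `(X, Y(a))` (`map_withDensity_ipw`). By consistency, the subtracted and the added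
`g` then cancel in the mean (`integral_scoreCore`). A limit `g'` different from `g*` therefore
changes the variance but causes no bias.

Write each cross-fitted score as the score at `g'` plus an error. Given everything outside cluster
`i`, the fitted regression is frozen and the error on `i` is a difference of two unbiased scores, so
it has mean zero. Errors on two clusters of one fold are hence uncorrelated, and their sum divided
by `√N` has second moment at most a constant times the expected squared distance of the fit to `g'`.
That expectation tends to zero because the distance is bounded and tends to zero in probability; no
rate is needed (`isSmallOP_sum_sampleDiff`).

Conditioning is replaced by Fubini. The folds depend only on the types, and the fit for a fold
ignores the data in it. So cluster `i` can be replaced in the sample by a fixed reference cluster of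
type `k` without changing its error: if `i` is not of type `k`, the error is zero anyway. The
modified sample is independent of cluster `i` (`foldDiff_update`, `indepFun_update_sample`). Errors
are set to zero when the fit violates its bound, so that the moment computations hold for every
frozen sample and not just almost every one.

Expanding `v_k(p̂_k) θ̃_k` to first order turns `√N (τ̃ - τ*)` into a normalised sum of independent
centred influence values plus `o_P(1)`, and the central limit theorem and Slutsky's lemma finish
(`isSmallOP_linearization`, `tendstoInDistribution_tauTilde`). The variance estimator is the mean
square of estimated influence values. These are close in mean square to the true ones, to which the
law of large numbers applies (`isSmallOP_meanSq_influence_sub`, `isSmallOP_meanSq_sub`). -/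

noncomputable section

namespace PartialInterference

/-! ### Calculus of `o_P(1)` and `O_P(1)` -/

section StochasticOrder

variable {Ω : Type*} [MeasurableSpace Ω] {P : Measure Ω} {X Y : ℕ → Ω → ℝ}

/-- `X_N = o_P(1)`. -/
def IsSmallOP (P : Measure Ω) (X : ℕ → Ω → ℝ) : Prop :=
  ∀ δ : ℝ, 0 < δ → Tendsto (fun N => P {ω | δ ≤ |X N ω|}) atTop (𝓝 0)

/-- `X_N = O_P(1)`. -/
def IsBddOP (P : Measure Ω) (X : ℕ → Ω → ℝ) : Prop :=
  ∀ ε : ENNReal, 0 < ε → ∃ B : ℝ, ∀ᶠ N in atTop, P {ω | B < |X N ω|} ≤ ε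

theorem tendstoInMeasure_iff_isSmallOP {c : ℝ} :
    TendstoInMeasure P X atTop (fun _ => c) ↔ IsSmallOP P (fun N ω => X N ω - c) := by
  simp [tendstoInMeasure_iff_norm, IsSmallOP]

theorem tendstoInMeasure_zero_iff_isSmallOP :
    TendstoInMeasure P X atTop 0 ↔ IsSmallOP P X := by
  simp [tendstoInMeasure_iff_norm, IsSmallOP]

theorem IsSmallOP.of_le (hX : IsSmallOP P X) (h : ∀ᶠ N in atTop, ∀ᵐ ω ∂P, |Y N ω| ≤ |X N ω|) :
    IsSmallOP P Y := by
  intro δ hδ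
  refine tendsto_of_tendsto_of_tendsto_of_le_of_le' tendsto_const_nhds (hX δ hδ)
    (Eventually.of_forall fun _ => zero_le) ?_
  filter_upwards [h] with N hN
  refine measure_mono_ae ?_
  filter_upwards [hN] with ω hω h1
  exact le_trans (show δ ≤ |Y N ω| from h1) hω

theorem IsSmallOP.congr (hX : IsSmallOP P X) (h : ∀ᶠ N in atTop, ∀ᵐ ω ∂P, Y N ω = X N ω) :
    IsSmallOP P Y :=
  hX.of_le (h.mono fun _ hN => hN.mono fun _ hω => by rw [hω])

/-- Identities that need a nonzero empirical frequency hold only off an event of vanishing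
probability; such an event may be ignored. -/
theorem IsSmallOP.of_ne_tendsto (hX : IsSmallOP P X)
    (h : Tendsto (fun N => P {ω | Y N ω ≠ X N ω}) atTop (𝓝 0)) : IsSmallOP P Y := by
  intro δ hδ
  refine tendsto_of_tendsto_of_tendsto_of_le_of_le tendsto_const_nhds
    (by simpa using (hX δ hδ).add h) (fun _ => zero_le) fun N => ?_
  refine (measure_mono fun ω hω => ?_).trans (measure_union_le _ _)
  by_cases he : Y N ω = X N ω
  · left
    show δ ≤ |X N ω|
    rw [← he]; exact hω
  · exact Or.inr he

theorem isSmallOP_zero : IsSmallOP P (fun _ _ => 0) := by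
  intro δ hδ
  simp [not_le.2 hδ]

theorem IsSmallOP.add (hX : IsSmallOP P X) (hY : IsSmallOP P Y) :
    IsSmallOP P (fun N ω => X N ω + Y N ω) := by
  intro δ hδ
  refine tendsto_of_tendsto_of_tendsto_of_le_of_le tendsto_const_nhds
    (by simpa using (hX (δ / 2) (by positivity)).add (hY (δ / 2) (by positivity)))
    (fun _ => zero_le) fun N => ?_
  refine (measure_mono fun ω hω => ?_).trans (measure_union_le _ _)
  by_contra hc
  simp only [Set.mem_union, Set.mem_ofPred_eq, not_or, not_le] at hc hω
  have := abs_add_le (X N ω) (Y N ω)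
  linarith

theorem IsSmallOP.sum {ι : Type*} {s : Finset ι} {Z : ι → ℕ → Ω → ℝ}
    (h : ∀ i ∈ s, IsSmallOP P (Z i)) : IsSmallOP P (fun N ω => ∑ i ∈ s, Z i N ω) := by
  classical
  induction s using Finset.induction_on with
  | empty => simpa using isSmallOP_zero
  | insert a s ha ih =>
    simp only [Finset.sum_insert ha]
    exact (h a (Finset.mem_insert_self a s)).add
      (ih fun i hi => h i (Finset.mem_insert_of_mem hi))

theorem IsSmallOP.mul_isBddOP (hX : IsSmallOP P X) (hY : IsBddOP P Y) :
    IsSmallOP P (fun N ω => X N ω * Y N ω) := by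
  intro δ hδ
  rw [ENNReal.tendsto_nhds_zero]
  intro ε hε
  obtain ⟨B, hB⟩ := hY (ε / 2) (ENNReal.half_pos hε.ne')
  -- `B` may be zero or negative, while the threshold for `X` is obtained by dividing by the bound.
  have hB1 : 0 < |B| + 1 := by positivity
  have hX' := ENNReal.tendsto_nhds_zero.1 (hX (δ / (|B| + 1)) (by positivity)) (ε / 2)
    (ENNReal.half_pos hε.ne')
  filter_upwards [hB, hX'] with N h1 h2
  refine (measure_mono fun ω hω => ?_).trans ((measure_union_le _ _).trans
    ((add_le_add h1 h2).trans (ENNReal.add_halves ε).le))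
  by_contra hc
  simp only [Set.mem_union, Set.mem_ofPred_eq, not_or, not_le, not_lt, abs_mul] at hc hω
  obtain ⟨h3, h4⟩ := hc
  rw [lt_div_iff₀ hB1] at h4
  have : |X N ω| * |Y N ω| ≤ |X N ω| * (|B| + 1) :=
    mul_le_mul_of_nonneg_left (by linarith [le_abs_self B]) (abs_nonneg _)
  linarith

theorem IsBddOP.congr (hX : IsBddOP P X) (h : ∀ᶠ N in atTop, ∀ ω, Y N ω = X N ω) :
    IsBddOP P Y := by
  intro ε hε
  obtain ⟨B, hB⟩ := hX ε hε
  refine ⟨B, ?_⟩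
  filter_upwards [hB, h] with N h1 h2
  simpa only [h2] using h1

theorem isBddOP_const (c : ℝ) : IsBddOP P (fun _ _ => c) := by
  intro ε hε
  refine ⟨|c|, Eventually.of_forall fun N => ?_⟩
  simp

theorem IsSmallOP.const_mul (hX : IsSmallOP P X) (c : ℝ) :
    IsSmallOP P (fun N ω => c * X N ω) := by
  simpa [mul_comm] using hX.mul_isBddOP (isBddOP_const c)

theorem IsSmallOP.sub (hX : IsSmallOP P X) (hY : IsSmallOP P Y) :
    IsSmallOP P (fun N ω => X N ω - Y N ω) := by
  simpa [sub_eq_add_neg] using hX.add (hY.const_mul (-1))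

theorem IsSmallOP.isBddOP (hX : IsSmallOP P X) : IsBddOP P X := by
  intro ε hε
  refine ⟨1, ?_⟩
  filter_upwards [ENNReal.tendsto_nhds_zero.1 (hX 1 one_pos) ε hε] with N hN
  exact (measure_mono fun ω (hω : 1 < |X N ω|) => le_of_lt hω).trans hN

theorem IsBddOP.add (hX : IsBddOP P X) (hY : IsBddOP P Y) :
    IsBddOP P (fun N ω => X N ω + Y N ω) := by
  intro ε hε
  obtain ⟨B, hB⟩ := hX (ε / 2) (ENNReal.half_pos hε.ne')
  obtain ⟨B', hB'⟩ := hY (ε / 2) (ENNReal.half_pos hε.ne')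
  refine ⟨B + B', ?_⟩
  filter_upwards [hB, hB'] with N h1 h2
  refine (measure_mono fun ω hω => ?_).trans ((measure_union_le _ _).trans
    ((add_le_add h1 h2).trans (ENNReal.add_halves ε).le))
  by_contra hc
  simp only [Set.mem_union, Set.mem_ofPred_eq, not_or, not_lt] at hc hω
  have := abs_add_le (X N ω) (Y N ω)
  linarith [hc.1, hc.2]

theorem isBddOP_of_tendsto {c : ℝ} (hX : IsSmallOP P (fun N ω => X N ω - c)) : IsBddOP P X := by
  simpa using hX.isBddOP.add (isBddOP_const c)

theorem IsSmallOP.mul (hX : IsSmallOP P X) (hY : IsSmallOP P Y) :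
    IsSmallOP P (fun N ω => X N ω * Y N ω) :=
  hX.mul_isBddOP hY.isBddOP

/-- `XY - ab = (X - a) Y + a (Y - b)`, and `Y` is bounded in probability. -/
theorem IsSmallOP.mul_tendsto {a b : ℝ} (hX : IsSmallOP P (fun N ω => X N ω - a))
    (hY : IsSmallOP P (fun N ω => Y N ω - b)) :
    IsSmallOP P (fun N ω => X N ω * Y N ω - a * b) := by
  have h := (hX.mul_isBddOP (isBddOP_of_tendsto hY)).add (hY.const_mul a)
  refine h.congr (Eventually.of_forall fun N => ae_of_all _ fun ω => ?_)
  ring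

/-- Only continuity at the limit point matters, so `φ` may be an inverse, a derivative or a
difference quotient that is irregular elsewhere. -/
theorem IsSmallOP.comp_continuousAt {c : ℝ} (hX : IsSmallOP P (fun N ω => X N ω - c)) {φ : ℝ → ℝ}
    (hφ : ContinuousAt φ c) : IsSmallOP P (fun N ω => φ (X N ω) - φ c) := by
  intro δ hδ
  obtain ⟨η, hη, h⟩ := Metric.continuousAt_iff.1 hφ δ hδ
  refine tendsto_of_tendsto_of_tendsto_of_le_of_le tendsto_const_nhds (hX η hη)
    (fun _ => zero_le) fun N => measure_mono fun ω hω => ?_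
  by_contra hc
  simp only [Set.mem_ofPred_eq, not_le] at hc hω
  have := h (x := X N ω) (by simpa [Real.dist_eq] using hc)
  rw [Real.dist_eq] at this
  linarith

theorem IsSmallOP.eventually_lt {c b : ℝ} (hX : IsSmallOP P (fun N ω => X N ω - c)) (hb : b < c) :
    Tendsto (fun N => P {ω | X N ω ≤ b}) atTop (𝓝 0) := by
  refine tendsto_of_tendsto_of_tendsto_of_le_of_le tendsto_const_nhds (hX (c - b) (by linarith))
    (fun _ => zero_le) fun N => measure_mono fun ω hω => ?_
  simp only [Set.mem_ofPred_eq] at hω ⊢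
  rw [abs_sub_comm]
  exact le_trans (by linarith) (le_abs_self _)

theorem isSmallOP_of_sq (hX : IsSmallOP P (fun N ω => X N ω ^ 2)) : IsSmallOP P X := by
  intro δ hδ
  refine tendsto_of_tendsto_of_tendsto_of_le_of_le tendsto_const_nhds (hX (δ ^ 2) (by positivity))
    (fun _ => zero_le) fun N => measure_mono fun ω hω => ?_
  simp only [Set.mem_ofPred_eq] at hω ⊢
  rw [abs_pow]
  gcongr

theorem isBddOP_of_sq (hX : IsBddOP P (fun N ω => X N ω ^ 2)) : IsBddOP P X := by
  intro ε hε
  obtain ⟨B, hB⟩ := hX ε hε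
  refine ⟨√|B|, hB.mono fun N hN => (measure_mono fun ω hω => ?_).trans hN⟩
  simp only [Set.mem_ofPred_eq] at hω ⊢
  rw [abs_pow]
  have : √|B| ^ 2 < |X N ω| ^ 2 := by gcongr
  rw [Real.sq_sqrt (abs_nonneg _)] at this
  exact (le_abs_self B).trans_lt this

/-- Markov's inequality, applied to a measurable majorant so that `X` itself need not be measurable.
-/
theorem isSmallOP_of_lintegral {Z : ℕ → Ω → ENNReal} (hZ : ∀ N, AEMeasurable (Z N) P)
    (hX : ∀ᶠ N in atTop, ∀ᵐ ω ∂P, ENNReal.ofReal |X N ω| ≤ Z N ω)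
    (h : Tendsto (fun N => ∫⁻ ω, Z N ω ∂P) atTop (𝓝 0)) : IsSmallOP P X := by
  intro δ hδ
  have hδ' : ENNReal.ofReal δ ≠ 0 := by simpa using hδ
  have h' : Tendsto (fun N => (∫⁻ ω, Z N ω ∂P) / ENNReal.ofReal δ) atTop (𝓝 0) := by
    simpa using ENNReal.Tendsto.div_const h (Or.inr hδ')
  refine tendsto_of_tendsto_of_tendsto_of_le_of_le' tendsto_const_nhds h'
    (Eventually.of_forall fun _ => zero_le) ?_
  filter_upwards [hX] with N hN
  refine le_trans (measure_mono_ae ?_) (meas_ge_le_lintegral_div (hZ N) hδ' ENNReal.ofReal_ne_top)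
  filter_upwards [hN] with ω hω h1
  exact (ENNReal.ofReal_le_ofReal (show δ ≤ |X N ω| from h1)).trans hω

theorem isBddOP_of_integral_le {B : ℝ} (hX : ∀ᶠ N in atTop, Integrable (X N) P)
    (h : ∀ᶠ N in atTop, ∫ ω, |X N ω| ∂P ≤ B) : IsBddOP P X := by
  intro ε hε
  by_cases hε' : ε = ⊤
  · exact ⟨0, by simp [hε']⟩
  have hB : 0 ≤ B := by
    obtain ⟨N, hN⟩ := h.exists
    exact (integral_nonneg fun ω => abs_nonneg _).trans hN
  have he : 0 < ε.toReal := ENNReal.toReal_pos hε.ne' hε'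
  -- Markov's threshold is `B / ε`; adding `1` keeps it positive when `B = 0`.
  refine ⟨(B + 1) / ε.toReal, ?_⟩
  filter_upwards [hX, h] with N hN h1
  have hpos : 0 < (B + 1) / ε.toReal := by positivity
  have h2 := meas_ge_le_lintegral_div (μ := P) (f := fun ω => ENNReal.ofReal |X N ω|)
    hN.abs.aestronglyMeasurable.aemeasurable.ennreal_ofReal
    (ε := ENNReal.ofReal ((B + 1) / ε.toReal)) (by simpa using hpos) ENNReal.ofReal_ne_top
  refine (measure_mono fun ω hω => ?_).trans (h2.trans ?_)
  · exact ENNReal.ofReal_le_ofReal (le_of_lt hω)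
  · rw [← ofReal_integral_eq_lintegral_ofReal hN.abs (ae_of_all _ fun ω => abs_nonneg _),
      ← ENNReal.ofReal_div_of_pos hpos, ← ENNReal.ofReal_toReal hε']
    refine ENNReal.ofReal_le_ofReal ?_
    rw [ENNReal.ofReal_toReal hε', div_le_iff₀ hpos, mul_div_cancel₀ _ he.ne']
    linarith

/-- Bounded convergence in probability. -/
theorem IsSmallOP.tendsto_lintegral [IsProbabilityMeasure P] (hX : IsSmallOP P X) {B : ℝ}
    (hB : ∀ N, ∀ᵐ ω ∂P, |X N ω| ≤ B) :
    Tendsto (fun N => ∫⁻ ω, ENNReal.ofReal |X N ω| ∂P) atTop (𝓝 0) := by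
  rw [ENNReal.tendsto_nhds_zero]
  intro ε hε
  by_cases hε' : ε = ⊤
  · simp [hε']
  have he : 0 < ε.toReal := ENNReal.toReal_pos hε.ne' hε'
  have h1 : Tendsto (fun N => ENNReal.ofReal B * P {ω | ε.toReal / 2 ≤ |X N ω|}) atTop (𝓝 0) := by
    simpa using ENNReal.Tendsto.const_mul (hX (ε.toReal / 2) (by positivity))
      (Or.inr ENNReal.ofReal_ne_top)
  filter_upwards [ENNReal.tendsto_nhds_zero.1 h1 (ε / 2) (ENNReal.half_pos hε.ne')] with N hN
  have hh : ENNReal.ofReal (ε.toReal / 2) = ε / 2 := by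
    rw [ENNReal.ofReal_div_of_pos two_pos, ENNReal.ofReal_toReal hε']; simp
  -- `X N` is not assumed measurable, so a measurable hull of the exceptional event, of the same
  -- measure, carries the indicator.
  set T := toMeasurable P {ω | ε.toReal / 2 ≤ |X N ω|} with hT
  calc ∫⁻ ω, ENNReal.ofReal |X N ω| ∂P
      ≤ ∫⁻ ω, ENNReal.ofReal (ε.toReal / 2) +
          T.indicator (fun _ => ENNReal.ofReal B) ω ∂P := by
        refine lintegral_mono_ae ?_
        filter_upwards [hB N] with ω hω
        by_cases h : ω ∈ T
        · rw [Set.indicator_of_mem h]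
          exact (ENNReal.ofReal_le_ofReal hω).trans le_add_self
        · rw [Set.indicator_of_notMem h, add_zero]
          refine ENNReal.ofReal_le_ofReal (le_of_not_ge fun hc => h ?_)
          exact subset_toMeasurable _ _ hc
    _ = ε / 2 + ENNReal.ofReal B * P {ω | ε.toReal / 2 ≤ |X N ω|} := by
        rw [lintegral_add_left measurable_const, lintegral_indicator_const
          (measurableSet_toMeasurable _ _), measure_toMeasurable, hh]
        simp
    _ ≤ ε := (add_le_add le_rfl hN).trans (ENNReal.add_halves ε).le

/-- `O_P(r_N)` with `r_N → 0` implies `o_P(1)`. -/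
theorem IsBigOP.isSmallOP {r : ℕ → ℝ} (h : IsBigOP P X r) (hr : Tendsto r atTop (𝓝 0)) :
    IsSmallOP P X := by
  intro δ hδ
  rw [ENNReal.tendsto_nhds_zero]
  intro ε hε
  by_cases hε' : ε = ⊤
  · simp [hε']
  obtain ⟨B, hB⟩ := h ε.toReal (ENNReal.toReal_pos hε.ne' hε')
  have h1 : Tendsto (fun N => B * |r N|) atTop (𝓝 0) := by
    simpa using (hr.abs).const_mul B
  filter_upwards [hB, h1.eventually_lt_const hδ] with N h2 h3
  rw [ENNReal.ofReal_toReal hε'] at h2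
  exact (measure_mono fun ω hω => lt_of_lt_of_le h3 hω).trans h2

end StochasticOrder

/-! ### Fubini for two independent variables, in place of conditioning -/

section Independence

variable {Ω : Type*} [MeasurableSpace Ω] {P : Measure Ω} [IsProbabilityMeasure P]

/-- The law of `(X, (Y, Z))` is a product of three laws, and product measures reassociate. In use,
`X` is the auxiliary randomness, `Y` the other clusters and `Z` one cluster. -/
theorem indepFun_prodMk_left {α β γ : Type*} [MeasurableSpace α] [MeasurableSpace β]
    [MeasurableSpace γ] {X : Ω → α} {Y : Ω → β} {Z : Ω → γ} (hX : Measurable X)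
    (hY : Measurable Y) (hZ : Measurable Z) (h1 : IndepFun X (fun ω => (Y ω, Z ω)) P)
    (h2 : IndepFun Y Z P) : IndepFun (fun ω => (X ω, Y ω)) Z P := by
  have hXY : IndepFun X Y P := h1.comp measurable_id measurable_fst
  have := Measure.isProbabilityMeasure_map (μ := P) hX.aemeasurable
  have := Measure.isProbabilityMeasure_map (μ := P) hY.aemeasurable
  have := Measure.isProbabilityMeasure_map (μ := P) hZ.aemeasurable
  rw [indepFun_iff_map_prod_eq_prod_map_map (by fun_prop) (by fun_prop)] at h1 h2 hXY ⊢
  rw [hXY]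
  apply (MeasurableEquiv.prodAssoc (α := α) (β := β) (γ := γ)).map_measurableEquiv_injective
  rw [Measure.prodAssoc_prod, ← h2, ← h1, Measure.map_map (by fun_prop) (by fun_prop)]
  rfl

/-- Under independence the joint law is a product, so what is proved for `Z` with `V` frozen at each
value transfers to the pair. The next two lemmas do the same for moments. -/
theorem indepFun_ae_of_forall_ae {α β : Type*} [MeasurableSpace α] [MeasurableSpace β]
    {V : Ω → α} {Z : Ω → β} (h : IndepFun V Z P) (hV : Measurable V) (hZ : Measurable Z)
    {p : α × β → Prop} (hp : MeasurableSet {x | p x}) (H : ∀ v, ∀ᵐ z ∂(P.map Z), p (v, z)) :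
    ∀ᵐ ω ∂P, p (V ω, Z ω) := by
  have := Measure.isProbabilityMeasure_map (μ := P) hZ.aemeasurable
  rw [indepFun_iff_map_prod_eq_prod_map_map hV.aemeasurable hZ.aemeasurable] at h
  have h1 : ∀ᵐ x ∂(P.map fun ω => (V ω, Z ω)), p x := by
    rw [h]
    exact (Measure.ae_prod_iff_ae_ae hp).2 (ae_of_all _ H)
  exact ae_of_ae_map (hV.prodMk hZ).aemeasurable h1

/-- The majorant may depend on `z` as well: in use it carries the indicator of the type of the
cluster. -/
theorem indepFun_lintegral_le_lintegral {α β : Type*} [MeasurableSpace α] [MeasurableSpace β]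
    {V : Ω → α} {Z : Ω → β} (h : IndepFun V Z P) (hV : Measurable V) (hZ : Measurable Z)
    {F G : α × β → ENNReal} (hF : Measurable F) (hG : Measurable G)
    (H : ∀ v, ∫⁻ z, F (v, z) ∂(P.map Z) ≤ ∫⁻ z, G (v, z) ∂(P.map Z)) :
    ∫⁻ ω, F (V ω, Z ω) ∂P ≤ ∫⁻ ω, G (V ω, Z ω) ∂P := by
  have := Measure.isProbabilityMeasure_map (μ := P) hZ.aemeasurable
  rw [indepFun_iff_map_prod_eq_prod_map_map hV.aemeasurable hZ.aemeasurable] at h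
  rw [← lintegral_map (f := F) hF (hV.prodMk hZ), ← lintegral_map (f := G) hG (hV.prodMk hZ), h,
    lintegral_prod _ hF.aemeasurable, lintegral_prod _ hG.aemeasurable]
  exact lintegral_mono H

theorem indepFun_integral_eq_zero {α β : Type*} [MeasurableSpace α] [MeasurableSpace β]
    {V : Ω → α} {Z : Ω → β} (h : IndepFun V Z P) (hV : Measurable V) (hZ : Measurable Z)
    {F : α × β → ℝ} (hF : Measurable F) (hint : Integrable (fun ω => F (V ω, Z ω)) P)
    (H : ∀ v, ∫ z, F (v, z) ∂(P.map Z) = 0) : ∫ ω, F (V ω, Z ω) ∂P = 0 := by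
  have := Measure.isProbabilityMeasure_map (μ := P) hZ.aemeasurable
  rw [indepFun_iff_map_prod_eq_prod_map_map hV.aemeasurable hZ.aemeasurable] at h
  have h1 : Integrable F (P.map fun ω => (V ω, Z ω)) :=
    (integrable_map_measure hF.aestronglyMeasurable (hV.prodMk hZ).aemeasurable).2 hint
  rw [← integral_map (f := F) (hV.prodMk hZ).aemeasurable hF.aestronglyMeasurable, h,
    integral_prod _ (h ▸ h1)]
  simp [H]

end Independence

/-! ### Measurability on the disjoint union over types, and the law of an observed cluster -/

section SigmaMeasurable

variable {ι : Type*} {β : ι → Type*} [∀ i, MeasurableSpace (β i)]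

theorem measurable_sigmaMk (i : ι) : Measurable (Sigma.mk i : β i → Sigma β) := fun _ hs =>
  (MeasurableSpace.measurableSet_iInf.1 hs) i

theorem measurable_of_sigma {γ : Type*} [MeasurableSpace γ] {f : Sigma β → γ}
    (hf : ∀ i, Measurable fun z => f ⟨i, z⟩) : Measurable f := fun _ hs =>
  MeasurableSpace.measurableSet_iInf.2 fun i => hf i hs

theorem measurable_sigmaFst [MeasurableSpace ι] : Measurable (Sigma.fst : Sigma β → ι) :=
  measurable_of_sigma fun _ => measurable_const

end SigmaMeasurable

section ClusterLaw

variable {K : ℕ} {M d : Fin K → ℕ}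

theorem measurable_outcomeOf {m d : ℕ} : Measurable (outcomeOf : FullData m d → Outcome m) :=
  measurable_snd.fst

theorem measurable_treatOf {m d : ℕ} : Measurable (treatOf : FullData m d → Treat m) :=
  measurable_snd.snd.fst

theorem measurable_potential {m d : ℕ} (a : Treat m) :
    Measurable (fun z : FullData m d => z.1 a) :=
  (measurable_pi_apply a).comp measurable_fst

theorem measurable_obs : Measurable (obs : Cluster M d → ObsCluster M d) :=
  measurable_of_sigma fun k => (measurable_sigmaMk k).comp measurable_snd

variable (𝓜 : Model M d)

/-- The law of the observed data of a cluster, together with its type. -/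
def Model.obsLaw : Measure (ObsCluster M d) := 𝓜.clusterLaw.map obs

theorem Model.obsLaw_eq : 𝓜.obsLaw = ∑ k, ENNReal.ofReal (𝓜.p k) •
    (𝓜.law k).map (fun z => (⟨k, z.2⟩ : ObsCluster M d)) := by
  unfold Model.obsLaw Model.clusterLaw
  rw [← Measure.mapₗ_apply_of_measurable measurable_obs, map_sum]
  refine Finset.sum_congr rfl fun k _ => ?_
  rw [map_smul, Measure.mapₗ_apply_of_measurable measurable_obs,
    Measure.map_map measurable_obs (measurable_sigmaMk k)]
  rfl

theorem measurable_obsMk (k : Fin K) :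
    Measurable (fun z : FullData (M k) (d k) => (⟨k, z.2⟩ : ObsCluster M d)) :=
  (measurable_sigmaMk k).comp measurable_snd

theorem lintegral_obsLaw {f : ObsCluster M d → ENNReal} (hf : Measurable f) :
    ∫⁻ o, f o ∂𝓜.obsLaw = ∑ k, ENNReal.ofReal (𝓜.p k) * ∫⁻ z, f ⟨k, z.2⟩ ∂(𝓜.law k) := by
  rw [Model.obsLaw_eq, lintegral_finsetSum_measure]
  refine Finset.sum_congr rfl fun k _ => ?_
  rw [lintegral_smul_measure, lintegral_map hf (measurable_obsMk k)]
  rfl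

theorem ae_obsLaw {p : ObsCluster M d → Prop} (hp : MeasurableSet {o | p o})
    (h : ∀ k, ∀ᵐ z ∂(𝓜.law k), p ⟨k, z.2⟩) : ∀ᵐ o ∂𝓜.obsLaw, p o := by
  rw [ae_iff, ← Set.compl_ofPred, ← lintegral_indicator_one hp.compl,
    lintegral_obsLaw _ (measurable_one.indicator hp.compl)]
  refine Finset.sum_eq_zero fun k _ => ?_
  rw [lintegral_eq_zero_of_ae_eq_zero, mul_zero]
  filter_upwards [h k] with z hz
  simp [hz]

theorem integrable_obsLaw {f : ObsCluster M d → ℝ} (hf : Measurable f)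
    (h : ∀ k, Integrable (fun z => f ⟨k, z.2⟩) (𝓜.law k)) : Integrable f 𝓜.obsLaw := by
  rw [Model.obsLaw_eq, integrable_finsetSum_measure]
  refine fun k _ => Integrable.smul_measure ?_ ENNReal.ofReal_ne_top
  exact (integrable_map_measure hf.aestronglyMeasurable (measurable_obsMk k).aemeasurable).2 (h k)

theorem integral_obsLaw {f : ObsCluster M d → ℝ} (hf : Measurable f)
    (h : ∀ k, Integrable (fun z => f ⟨k, z.2⟩) (𝓜.law k)) :
    ∫ o, f o ∂𝓜.obsLaw = ∑ k, 𝓜.p k * ∫ z, f ⟨k, z.2⟩ ∂(𝓜.law k) := by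
  have hi : ∀ k, Integrable f ((𝓜.law k).map (fun z => (⟨k, z.2⟩ : ObsCluster M d))) := fun k =>
    (integrable_map_measure hf.aestronglyMeasurable (measurable_obsMk k).aemeasurable).2 (h k)
  rw [Model.obsLaw_eq, integral_finsetSum_measure
    fun k _ => (hi k).smul_measure ENNReal.ofReal_ne_top]
  refine Finset.sum_congr rfl fun k _ => ?_
  rw [integral_smul_measure, integral_map (measurable_obsMk k).aemeasurable
    hf.aestronglyMeasurable, ENNReal.toReal_ofReal (𝓜.p_pos k).le, smul_eq_mul]

instance : IsProbabilityMeasure 𝓜.obsLaw := by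
  constructor
  have := lintegral_obsLaw 𝓜 (f := fun _ => 1) measurable_const
  simp only [lintegral_const, measure_univ, mul_one, one_mul] at this
  rw [this, ← ENNReal.ofReal_sum_of_nonneg fun k _ => (𝓜.p_pos k).le, 𝓜.p_sum,
    ENNReal.ofReal_one]

theorem ae_covLaw {k : Fin K} {p : Covar (M k) (d k) → Prop} (h : ∀ᵐ x ∂(𝓜.covLaw k), p x) :
    ∀ᵐ z ∂(𝓜.law k), p (covarOf z) :=
  ae_of_ae_map measurable_covarOf.aemeasurable h

end ClusterLaw

/-! ### Inverse-probability weighting -/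

section InverseWeighting

variable {K : ℕ} {M d : Fin K → ℕ} {𝓜 : Model M d}

theorem measurable_propensity (k : Fin K) (a : Treat (M k)) : Measurable (𝓜.propensity k a) :=
  (Kernel.measurable_coe _ (measurableSet_singleton a)).ennreal_toReal

/-- The inverse-probability weight of the clusters with treatment vector `a`. -/
def Model.ipw (𝓜 : Model M d) (k : Fin K) (a : Treat (M k)) (z : FullData (M k) (d k)) : NNReal :=
  if treatOf z = a then (𝓜.propensity k a (covarOf z))⁻¹.toNNReal else 0

theorem measurable_ipw (k : Fin K) (a : Treat (M k)) : Measurable (𝓜.ipw k a) :=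
  Measurable.ite (measurable_treatOf (measurableSet_singleton a))
    ((measurable_propensity k a).comp measurable_covarOf).inv.real_toNNReal measurable_const

/-- Under conditional ignorability, weighting the clusters with treatment vector `a` by the inverse
of the propensity score recovers the joint law of `X` and `Y(a)`. -/
theorem map_withDensity_ipw (hA : 𝓜.CausalAssumptions) (k : Fin K) (a : Treat (M k)) :
    ((𝓜.law k).withDensity fun z => (𝓜.ipw k a z : ENNReal)).map
      (fun z => (covarOf z, z.1 a)) = (𝓜.law k).map (fun z => (covarOf z, z.1 a)) := by
  have hXY : Measurable fun z : FullData (M k) (d k) => (covarOf z, z.1 a) :=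
    measurable_covarOf.prodMk (measurable_potential a)
  obtain ⟨c, hc, hpos⟩ := hA.positivity
  -- Ignorability in kernel form: the conditional law of `A` given `(X, Y(a))` is its conditional
  -- law given `X`. The joint law of `((X, Y(a)), A)` is then that of `(X, Y(a))` followed by the
  -- propensity kernel.
  have hind := (condIndepFun_iff_condDistrib_prod_ae_eq_prodMkRight (μ := 𝓜.law k)
    (f := treatOf) (g := fun z => z.1 a) measurable_treatOf (measurable_potential a)
    measurable_covarOf).1 (hA.ignorability k a)
  have hjoint := compProd_map_condDistrib (mβ := inferInstance) (μ := 𝓜.law k) (X := fun z => (covarOf z, z.1 a))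
    (Y := treatOf) measurable_treatOf.aemeasurable
  rw [Measure.compProd_congr hind] at hjoint
  ext s hs
  have hms := hXY hs
  rw [Measure.map_apply hXY hs, Measure.map_apply hXY hs, withDensity_apply _ hms,
    ← lintegral_indicator hms]
  set G : (Covar (M k) (d k) × Outcome (M k)) × Treat (M k) → ENNReal := fun q =>
    s.indicator (fun _ => 1) q.1 * ({a} : Set (Treat (M k))).indicator
      (fun _ => 1) q.2 * ((𝓜.propensity k a q.1.1)⁻¹.toNNReal : ENNReal) with hG
  have hGm : Measurable G := by
    refine Measurable.mul (Measurable.mul ?_ ?_) ?_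
    · exact (measurable_const.indicator hs).comp measurable_fst
    · exact (measurable_const.indicator (measurableSet_singleton a)).comp measurable_snd
    · exact ((measurable_propensity k a).comp measurable_fst.fst).inv.real_toNNReal.coe_nnreal_ennreal
  have h1 : ∀ z : FullData (M k) (d k),
      ((fun z => (covarOf z, z.1 a)) ⁻¹' s).indicator (fun z => (𝓜.ipw k a z : ENNReal)) z
        = G ((covarOf z, z.1 a), treatOf z) := by
    intro z
    by_cases h : (covarOf z, z.1 a) ∈ s
    · rw [Set.indicator_of_mem (show z ∈ (fun z => (covarOf z, z.1 a)) ⁻¹' s from h)]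
      by_cases ht : treatOf z = a
      · simp [hG, h, ht, Model.ipw]
      · simp [hG, h, ht, Model.ipw]
    · rw [Set.indicator_of_notMem (show z ∉ (fun z => (covarOf z, z.1 a)) ⁻¹' s from h)]
      simp [hG, h]
  simp_rw [h1]
  rw [← lintegral_map (f := G) hGm (hXY.prodMk measurable_treatOf), ← hjoint,
    Measure.lintegral_compProd hGm, lintegral_map hGm.lintegral_kernel_prod_right' hXY,
    ← lintegral_indicator_one hms]
  refine lintegral_congr_ae ?_
  filter_upwards [ae_covLaw 𝓜 (hpos k a)] with z hz
  have he : 0 < 𝓜.propensity k a (covarOf z) := hc.trans hz.1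
  have h2 : (condDistrib treatOf covarOf (𝓜.law k) (covarOf z)) {a}
      = ENNReal.ofReal (𝓜.propensity k a (covarOf z)) := by
    rw [Model.propensity, Measure.real, ENNReal.ofReal_toReal (measure_ne_top _ _)]
  simp only [hG, Kernel.prodMkRight_apply]
  rw [lintegral_mul_const _ (by fun_prop (disch := measurability)), lintegral_const_mul _
    (measurable_const.indicator (measurableSet_singleton a)),
    lintegral_indicator_const (measurableSet_singleton a), one_mul, h2, mul_assoc]
  -- Integrating out `A` leaves the probability of `{a}` times its inverse.
  have h3 : ENNReal.ofReal (𝓜.propensity k a (covarOf z)) *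
      ((𝓜.propensity k a (covarOf z))⁻¹.toNNReal : ENNReal) = 1 := by
    rw [← ENNReal.ofReal, ← ENNReal.ofReal_mul he.le, mul_inv_cancel₀ he.ne', ENNReal.ofReal_one]
  rw [h3, mul_one]
  rfl

/-- Both sides are integrals of `F` against equal measures, so no integrability is needed. -/
theorem integral_ipw (hA : 𝓜.CausalAssumptions) (k : Fin K) (a : Treat (M k))
    {F : Covar (M k) (d k) × Outcome (M k) → ℝ} (hF : Measurable F) :
    ∫ z, (𝓜.ipw k a z : ℝ) * F (covarOf z, z.1 a) ∂(𝓜.law k)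
      = ∫ z, F (covarOf z, z.1 a) ∂(𝓜.law k) := by
  have hXY : Measurable fun z : FullData (M k) (d k) => (covarOf z, z.1 a) :=
    measurable_covarOf.prodMk (measurable_potential a)
  have h := congrArg (fun μ => ∫ q, F q ∂μ) (map_withDensity_ipw hA k a)
  simp only [integral_map hXY.aemeasurable hF.aestronglyMeasurable] at h
  rw [← h, integral_withDensity_eq_integral_smul (measurable_ipw k a)]
  rfl

/-- No moment of the potential outcomes is assumed; integrability in `Y(a)` is inherited from the
weighted observed data. -/
theorem integrable_of_integrable_ipw (hA : 𝓜.CausalAssumptions) (k : Fin K) (a : Treat (M k))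
    {F : Covar (M k) (d k) × Outcome (M k) → ℝ} (hF : Measurable F)
    (h : Integrable (fun z => (𝓜.ipw k a z : ℝ) * F (covarOf z, z.1 a)) (𝓜.law k)) :
    Integrable (fun z => F (covarOf z, z.1 a)) (𝓜.law k) := by
  have hXY : Measurable fun z : FullData (M k) (d k) => (covarOf z, z.1 a) :=
    measurable_covarOf.prodMk (measurable_potential a)
  have h1 := (integrable_withDensity_iff_integrable_smul (measurable_ipw (𝓜 := 𝓜) k a)).2 h
  have h2 := (integrable_map_measure (f := fun z : FullData (M k) (d k) => (covarOf z, z.1 a))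
    hF.aestronglyMeasurable hXY.aemeasurable).2 h1
  rw [map_withDensity_ipw hA k a] at h2
  exact (integrable_map_measure hF.aestronglyMeasurable hXY.aemeasurable).1 h2

end InverseWeighting

/-! ### Square integrability of the observed outcome -/

section OutcomeMoments

/-- `A i i` is the `i`-th coordinate of the image of the `i`-th unit vector. It turns the bound on
the operator norm of a covariance matrix into bounds on the variances. -/
theorem diag_le_norm_toEuclideanCLM {m : ℕ} (A : Matrix (Fin m) (Fin m) ℝ) (i : Fin m) :
    A i i ≤ ‖Matrix.toEuclideanCLM (𝕜 := ℝ) A‖ := by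
  set e : EuclideanSpace ℝ (Fin m) := EuclideanSpace.single i 1 with he
  have h1 : A i i = Matrix.toEuclideanCLM (𝕜 := ℝ) A e i := by
    simp [he]
  have hn : ‖e‖ = 1 := by simp [he]
  have h2 := PiLp.norm_apply_le (Matrix.toEuclideanCLM (𝕜 := ℝ) A e) i
  have h3 := (Matrix.toEuclideanCLM (𝕜 := ℝ) A).le_opNorm e
  rw [hn, mul_one] at h3
  rw [h1]
  exact (le_abs_self _).trans (h2.trans h3)

/-- The second moment is controlled by the mean and the covariance matrix. -/
theorem lintegral_enorm_sq_le {m : ℕ} (μ : Measure (Outcome m)) [IsProbabilityMeasure μ]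
    (hμ : MemLp (fun y : Outcome m => y) 2 μ) {C : ℝ} (hmean : ‖∫ y, y ∂μ‖ ≤ C)
    (hcov : ‖Matrix.toEuclideanCLM (𝕜 := ℝ) (Matrix.of fun i j : Fin m =>
      covariance (fun y : Outcome m => y i) (fun y => y j) μ)‖ ≤ C) :
    ∫⁻ y, ‖y‖ₑ ^ 2 ∂μ ≤ ENNReal.ofReal (m * C + C ^ 2) := by
  have hint : Integrable (fun y : Outcome m => y) μ := hμ.integrable one_le_two
  have hi : ∀ i : Fin m, MemLp (fun y : Outcome m => y i) 2 μ := fun i =>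
    (EuclideanSpace.proj (𝕜 := ℝ) i).comp_memLp' hμ
  have hsq : Integrable (fun y : Outcome m => ‖y‖ ^ 2) μ := hμ.integrable_norm_pow (by norm_num)
  have h1 : ∫⁻ y, ‖y‖ₑ ^ 2 ∂μ = ENNReal.ofReal (∫ y, ‖y‖ ^ 2 ∂μ) := by
    rw [ofReal_integral_eq_lintegral_ofReal hsq (ae_of_all _ fun y => by positivity)]
    refine lintegral_congr fun y => ?_
    rw [ENNReal.ofReal_pow (norm_nonneg _), ofReal_norm]
  rw [h1]
  refine ENNReal.ofReal_le_ofReal ?_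
  have h2 : ∀ y : Outcome m, ‖y‖ ^ 2 = ∑ i, y i ^ 2 := fun y => by
    rw [EuclideanSpace.norm_sq_eq]; simp
  have hmi : ∀ i, ∫ y : Outcome m, y i ∂μ = (∫ y, y ∂μ) i := fun i =>
    (EuclideanSpace.proj (𝕜 := ℝ) i).integral_comp_comm hint
  have h3 : ∀ i, ∫ y : Outcome m, y i ^ 2 ∂μ ≤ C + ((∫ y, y ∂μ) i) ^ 2 := by
    intro i
    have hv := variance_eq_sub (hi i)
    have hc := (diag_le_norm_toEuclideanCLM (Matrix.of fun i j : Fin m =>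
      covariance (fun y : Outcome m => y i) (fun y => y j) μ) i).trans hcov
    rw [Matrix.of_apply, covariance_self (hi i).aemeasurable, hv, hmi i] at hc
    simp only [Pi.pow_apply] at hc
    linarith
  simp_rw [h2]
  rw [integral_finsetSum _ fun i _ => (hi i).integrable_sq]
  -- There are `m` variances, each at most `C`, plus the squared norm of the mean.
  calc ∑ i, ∫ y : Outcome m, y i ^ 2 ∂μ ≤ ∑ i, (C + ((∫ y, y ∂μ) i) ^ 2) :=
        Finset.sum_le_sum fun i _ => h3 i
    _ = m * C + ‖∫ y, y ∂μ‖ ^ 2 := by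
        rw [Finset.sum_add_distrib, ← h2]; simp
    _ ≤ m * C + C ^ 2 := by gcongr

variable {K : ℕ} {M d : Fin K → ℕ} {𝓜 : Model M d}

/-- The conditional second moments given `(A, X)` are uniformly bounded; disintegrating the law over
`(A, X)` averages them. -/
theorem memLp_outcomeOf (hA : 𝓜.CausalAssumptions) {C : ℝ} (k : Fin K)
    (hg : ∀ a, ∀ᵐ x ∂(𝓜.covLaw k), ‖𝓜.outcomeReg k a x‖ ≤ C)
    (hcov : ∀ a, ∀ᵐ x ∂(𝓜.covLaw k),
      ‖Matrix.toEuclideanCLM (𝕜 := ℝ) (𝓜.outcomeCov k a x)‖ ≤ C) :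
    MemLp outcomeOf 2 (𝓜.law k) := by
  have hm : Measurable fun z : FullData (M k) (d k) => (treatOf z, covarOf z) :=
    measurable_treatOf.prodMk measurable_covarOf
  have hjoint := compProd_map_condDistrib (mβ := inferInstance) (μ := 𝓜.law k)
    (X := fun z : FullData (M k) (d k) => (treatOf z, covarOf z))
    (Y := outcomeOf) measurable_outcomeOf.aemeasurable
  have hG : Measurable fun q : (Treat (M k) × Covar (M k) (d k)) × Outcome (M k) => ‖q.2‖ₑ ^ 2 :=
    measurable_snd.enorm.pow_const 2
  have h : ∫⁻ z, ‖outcomeOf z‖ₑ ^ 2 ∂(𝓜.law k) ≤ ENNReal.ofReal (M k * C + C ^ 2) := by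
    rw [← lintegral_map (f := fun q : (Treat (M k) × Covar (M k) (d k)) × Outcome (M k) =>
      ‖q.2‖ₑ ^ 2) hG (hm.prodMk measurable_outcomeOf), ← hjoint, Measure.lintegral_compProd hG,
      lintegral_map hG.lintegral_kernel_prod_right' hm]
    have hae : ∀ᵐ z ∂(𝓜.law k), ∫⁻ y, ‖y‖ₑ ^ 2 ∂(𝓜.outcomeLaw k (treatOf z) (covarOf z)) ≤
        ENNReal.ofReal (M k * C + C ^ 2) := by
      -- There are finitely many treatments, so one null set of covariates serves all of them and
      -- `a` can be set to the observed treatment.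
      have := ae_covLaw 𝓜 (ae_all_iff.2 fun a =>
        ((hA.second_moment k a).and (hg a)).and (hcov a))
      filter_upwards [this] with z hz
      obtain ⟨⟨h1, h2⟩, h3⟩ := hz (treatOf z)
      have : IsProbabilityMeasure (𝓜.outcomeLaw k (treatOf z) (covarOf z)) := by
        unfold Model.outcomeLaw; infer_instance
      exact lintegral_enorm_sq_le _ h1 h2 h3
    refine (lintegral_mono_ae hae).trans ?_
    simp
  refine ⟨measurable_outcomeOf.aestronglyMeasurable, ?_⟩
  rw [eLpNorm_lt_top_iff_lintegral_rpow_enorm_lt_top (by norm_num) (by norm_num)]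
  refine lt_of_le_of_lt (le_of_eq ?_) (h.trans_lt ENNReal.ofReal_lt_top)
  simp

end OutcomeMoments

/-! ### Joint measurability of the score -/

section ScoreMeasurable

variable {K : ℕ} {M d : Fin K → ℕ} {V : Type*} [MeasurableSpace V]

/-- The parameter in `V` will be the sample on which the regression was fitted; Fubini needs
measurability jointly in it and in the scored data. The treatment is discrete, so it can be frozen.
-/
theorem measurable_scoreCore {w : VecFun M d} {e : ScalarFun M d} {G : V → VecFun M d} {k : Fin K}
    (hw : ∀ a, Measurable (w k a)) (he : ∀ a, Measurable (e k a))
    (hG : ∀ a, Measurable fun q : V × Covar (M k) (d k) => G q.1 k a q.2) :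
    Measurable fun q : V × ObsData (M k) (d k) => scoreCore w e (G q.1) k q.2 := by
  have hx : Measurable fun q : V × ObsData (M k) (d k) => q.2.2.2 := by fun_prop
  have hvx : Measurable fun q : V × ObsData (M k) (d k) => (q.1, q.2.2.2) := by fun_prop
  have hy : Measurable fun q : V × ObsData (M k) (d k) => q.2.1 := by fun_prop
  have h1 : Measurable fun r : Treat (M k) × (V × ObsData (M k) (d k)) =>
      inner ℝ (w k r.1 r.2.2.2.2) (r.2.2.1 - G r.2.1 k r.1 r.2.2.2.2) / e k r.1 r.2.2.2.2 :=
    measurable_from_prod_countable_right fun a =>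
      (((hw a).comp hx).inner (hy.sub ((hG a).comp hvx))).div ((he a).comp hx)
  have h2 : Measurable fun q : V × ObsData (M k) (d k) =>
      ∑ a : Treat (M k), (inner ℝ (w k a q.2.2.2) (G q.1 k a q.2.2.2) : ℝ) :=
    Finset.measurable_sum _ fun a _ => ((hw a).comp hx).inner ((hG a).comp hvx)
  have h3 : Measurable fun q : V × ObsData (M k) (d k) => (q.2.2.1, q) := by fun_prop
  exact (h1.comp h3).add h2

/-- The data of a cluster of type `k`, and a default value for clusters of another type. -/
def dataOfType (k : Fin K) (o : ObsCluster M d) : ObsData (M k) (d k) :=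
  if h : o.1 = k then h ▸ o.2 else (0, fun _ => false, 0)

theorem measurable_dataOfType (k : Fin K) :
    Measurable (dataOfType k : ObsCluster M d → ObsData (M k) (d k)) := by
  refine measurable_of_sigma fun j => ?_
  by_cases h : j = k
  · subst h
    have : (fun z : ObsData (M j) (d j) => dataOfType j (⟨j, z⟩ : ObsCluster M d)) = id := by
      funext z
      simp [dataOfType]
    rw [this]
    exact measurable_id
  · simp [dataOfType, h]

theorem score_eq (w : VecFun M d) (e : ScalarFun M d) (g : VecFun M d) (k : Fin K)
    (o : ObsCluster M d) :
    score w e g k o = if o.1 = k then scoreCore w e g k (dataOfType k o) else 0 := by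
  obtain ⟨j, o⟩ := o
  by_cases h : j = k
  · subst h
    simp [score, dataOfType]
  · simp [score, h]

theorem measurableSet_type (k : Fin K) : MeasurableSet {o : ObsCluster M d | o.1 = k} :=
  measurable_sigmaFst (measurableSet_singleton k)

theorem measurable_score {w : VecFun M d} {e : ScalarFun M d} {G : V → VecFun M d} {k : Fin K}
    (hw : ∀ a, Measurable (w k a)) (he : ∀ a, Measurable (e k a))
    (hG : ∀ a, Measurable fun q : V × Covar (M k) (d k) => G q.1 k a q.2) :
    Measurable fun q : V × ObsCluster M d => score w e (G q.1) k q.2 := by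
  simp_rw [score_eq]
  refine Measurable.ite (measurable_snd (measurableSet_type k)) ?_ measurable_const
  have h : Measurable fun q : V × ObsData (M k) (d k) => scoreCore w e (G q.1) k q.2 :=
    measurable_scoreCore hw he hG
  have h' : Measurable fun q : V × ObsCluster M d => (q.1, dataOfType k q.2) :=
    measurable_fst.prodMk ((measurable_dataOfType k).comp measurable_snd)
  have h2 := h.comp h'
  simp only [Function.comp_def] at h2
  exact h2

theorem measurable_score_const {w : VecFun M d} {e : ScalarFun M d} {g : VecFun M d} {k : Fin K}
    (hw : ∀ a, Measurable (w k a)) (he : ∀ a, Measurable (e k a)) (hg : ∀ a, Measurable (g k a)) :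
    Measurable (score w e g k) := by
  have hG : ∀ a, Measurable fun q : Unit × Covar (M k) (d k) => g k a q.2 := fun a =>
    (hg a).comp measurable_snd
  have h : Measurable fun q : Unit × ObsCluster M d => score w e g k q.2 :=
    measurable_score (G := fun _ : Unit => g) hw he hG
  have h' : Measurable fun o : ObsCluster M d => (((), o) : Unit × ObsCluster M d) :=
    measurable_prodMk_left
  have h2 := h.comp h'
  simp only [Function.comp_def] at h2
  exact h2

theorem measurable_scoreCore_const {w : VecFun M d} {e : ScalarFun M d} {g : VecFun M d}
    {k : Fin K} (hw : ∀ a, Measurable (w k a)) (he : ∀ a, Measurable (e k a))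
    (hg : ∀ a, Measurable (g k a)) : Measurable (scoreCore w e g k) := by
  have hG : ∀ a, Measurable fun q : Unit × Covar (M k) (d k) => g k a q.2 := fun a =>
    (hg a).comp measurable_snd
  have h : Measurable fun q : Unit × ObsData (M k) (d k) => scoreCore w e g k q.2 :=
    measurable_scoreCore (G := fun _ : Unit => g) hw he hG
  have h' : Measurable fun o : ObsData (M k) (d k) => (((), o) : Unit × ObsData (M k) (d k)) := measurable_prodMk_left
  have h2 := h.comp h'
  simp only [Function.comp_def] at h2
  exact h2

theorem measurable_typeInd (k : Fin K) :
    Measurable (typeInd k : ObsCluster M d → ℝ) :=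
  Measurable.ite (measurableSet_type k) measurable_const measurable_const

end ScoreMeasurable

/-! ### Bounds and moments of the score -/

section ScoreBounds

variable {K : ℕ} {M d : Fin K → ℕ} {w : VecFun M d} {e : ScalarFun M d} {g g' : VecFun M d}
  {k : Fin K}

theorem abs_scoreCore_le {o : ObsData (M k) (d k)} {Cw c C : ℝ} (hc : 0 < c)
    (hw : ∀ a, ‖w k a o.2.2‖ ≤ Cw) (he : ∀ a, c < e k a o.2.2) (hg : ∀ a, ‖g k a o.2.2‖ ≤ C) :
    |scoreCore w e g k o| ≤ Cw * (‖o.1‖ + C) / c + Fintype.card (Treat (M k)) * (Cw * C) := by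
  have hCw : 0 ≤ Cw := (norm_nonneg _).trans (hw o.2.1)
  have hC : 0 ≤ C := (norm_nonneg _).trans (hg o.2.1)
  unfold scoreCore
  refine (abs_add_le _ _).trans (add_le_add ?_ ?_)
  · rw [abs_div, abs_of_pos (hc.trans (he _))]
    refine div_le_div₀ (by positivity) ?_ hc (he _).le
    refine (abs_real_inner_le_norm _ _).trans ?_
    exact mul_le_mul (hw _) ((norm_sub_le _ _).trans (add_le_add le_rfl (hg _)))
      (norm_nonneg _) hCw
  · refine (Finset.abs_sum_le_sum_abs _ _).trans ?_
    rw [← nsmul_eq_mul]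
    refine Finset.sum_le_card_nsmul _ _ _ fun a _ => ?_
    exact (abs_real_inner_le_norm _ _).trans (mul_le_mul (hw _) (hg _) (norm_nonneg _) hCw)

/-- The outcome cancels, and the difference is linear in `g' - g`: `1 / c` comes from the weighted
residual and `1` from the sum over treatments. Score errors are thus bounded although outcomes are
not. -/
theorem abs_scoreCore_sub_le {o : ObsData (M k) (d k)} {Cw c : ℝ} (hc : 0 < c)
    (hw : ∀ a, ‖w k a o.2.2‖ ≤ Cw) (he : ∀ a, c < e k a o.2.2) :
    |scoreCore w e g k o - scoreCore w e g' k o| ≤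
      Cw * (1 / c + 1) * ∑ a, ‖g' k a o.2.2 - g k a o.2.2‖ := by
  have hCw : 0 ≤ Cw := (norm_nonneg _).trans (hw o.2.1)
  have h : scoreCore w e g k o - scoreCore w e g' k o =
      inner ℝ (w k o.2.1 o.2.2) (g' k o.2.1 o.2.2 - g k o.2.1 o.2.2) / e k o.2.1 o.2.2
        - ∑ a : Treat (M k), inner ℝ (w k a o.2.2) (g' k a o.2.2 - g k a o.2.2) := by
    unfold scoreCore
    simp only [inner_sub_right, Finset.sum_sub_distrib]
    ring
  have hsum : ∀ a, |inner ℝ (w k a o.2.2) (g' k a o.2.2 - g k a o.2.2)| ≤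
      Cw * ‖g' k a o.2.2 - g k a o.2.2‖ := fun a =>
    (abs_real_inner_le_norm _ _).trans (mul_le_mul_of_nonneg_right (hw a) (norm_nonneg _))
  have h1 : ‖g' k o.2.1 o.2.2 - g k o.2.1 o.2.2‖ ≤ ∑ a, ‖g' k a o.2.2 - g k a o.2.2‖ :=
    Finset.single_le_sum (f := fun a => ‖g' k a o.2.2 - g k a o.2.2‖)
      (fun a _ => norm_nonneg _) (Finset.mem_univ o.2.1)
  rw [h]
  refine (abs_sub _ _).trans ?_
  have h2 : |inner ℝ (w k o.2.1 o.2.2) (g' k o.2.1 o.2.2 - g k o.2.1 o.2.2) / e k o.2.1 o.2.2| ≤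
      Cw * (∑ a, ‖g' k a o.2.2 - g k a o.2.2‖) / c := by
    rw [abs_div, abs_of_pos (hc.trans (he _))]
    exact div_le_div₀ (by positivity) ((hsum _).trans (mul_le_mul_of_nonneg_left h1 hCw)) hc
      (he _).le
  have h3 : |∑ a : Treat (M k), inner ℝ (w k a o.2.2) (g' k a o.2.2 - g k a o.2.2)| ≤
      Cw * ∑ a, ‖g' k a o.2.2 - g k a o.2.2‖ := by
    rw [Finset.mul_sum]
    exact (Finset.abs_sum_le_sum_abs _ _).trans (Finset.sum_le_sum fun a _ => hsum a)
  refine (add_le_add h2 h3).trans (le_of_eq ?_)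
  ring

end ScoreBounds

section ScoreMoments

variable {K : ℕ} {M d : Fin K → ℕ} {𝓜 : Model M d} {w : VecFun M d} {g g' : VecFun M d}
  {k : Fin K} {Cw c C : ℝ}

theorem memLp_scoreCore (hw_meas : ∀ a, Measurable (w k a)) (hc : 0 < c)
    (hw : ∀ a, ∀ᵐ x ∂(𝓜.covLaw k), ‖w k a x‖ ≤ Cw)
    (he : ∀ a, ∀ᵐ x ∂(𝓜.covLaw k), c < 𝓜.propensity k a x)
    (hY : MemLp outcomeOf 2 (𝓜.law k))
    (hg_meas : ∀ a, Measurable (g k a)) (hg : ∀ a, ∀ᵐ x ∂(𝓜.covLaw k), ‖g k a x‖ ≤ C) :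
    MemLp (fun z => scoreCore w 𝓜.propensity g k z.2) 2 (𝓜.law k) := by
  have hm : Measurable fun z : FullData (M k) (d k) => scoreCore w 𝓜.propensity g k z.2 :=
    (measurable_scoreCore_const hw_meas (measurable_propensity k) hg_meas).comp measurable_snd
  have hb : MemLp (fun z : FullData (M k) (d k) => Cw * (‖outcomeOf z‖ + C) / c +
      Fintype.card (Treat (M k)) * (Cw * C)) 2 (𝓜.law k) := by
    refine MemLp.add ?_ (memLp_const _)
    simp_rw [div_eq_inv_mul]
    exact ((hY.norm.add (memLp_const C)).const_mul Cw).const_mul _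
  refine hb.mono hm.aestronglyMeasurable ?_
  filter_upwards [ae_covLaw 𝓜 (ae_all_iff.2 hw), ae_covLaw 𝓜 (ae_all_iff.2 he),
    ae_covLaw 𝓜 (ae_all_iff.2 hg)] with z h1 h2 h3
  exact (abs_scoreCore_le hc h1 h2 h3).trans (le_abs_self _)

/-- With the true propensity score, the score is unbiased whatever the outcome regression. -/
theorem integral_scoreCore (hA : 𝓜.CausalAssumptions) (hw_meas : ∀ a, Measurable (w k a))
    (hc : 0 < c) (hw : ∀ a, ∀ᵐ x ∂(𝓜.covLaw k), ‖w k a x‖ ≤ Cw)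
    (he : ∀ a, ∀ᵐ x ∂(𝓜.covLaw k), c < 𝓜.propensity k a x)
    (hY : MemLp outcomeOf 2 (𝓜.law k))
    (hg_meas : ∀ a, Measurable (g k a)) (hg : ∀ a, ∀ᵐ x ∂(𝓜.covLaw k), ‖g k a x‖ ≤ C) :
    ∫ z, scoreCore w 𝓜.propensity g k z.2 ∂(𝓜.law k) = 𝓜.theta w k := by
  have hw' := ae_covLaw 𝓜 (ae_all_iff.2 hw)
  have he' := ae_covLaw 𝓜 (ae_all_iff.2 he)
  have hg' := ae_covLaw 𝓜 (ae_all_iff.2 hg)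
  have hYint : Integrable (fun z : FullData (M k) (d k) => ‖outcomeOf z‖) (𝓜.law k) :=
    (hY.integrable one_le_two).norm
  set F : Treat (M k) → Covar (M k) (d k) × Outcome (M k) → ℝ := fun a q =>
    inner ℝ (w k a q.1) (q.2 - g k a q.1) with hF
  have hFm : ∀ a, Measurable (F a) := fun a =>
    ((hw_meas a).comp measurable_fst).inner
      (measurable_snd.sub ((hg_meas a).comp measurable_fst))
  have hXY : ∀ a, Measurable fun z : FullData (M k) (d k) => (covarOf z, z.1 a) := fun a =>
    measurable_covarOf.prodMk (measurable_potential a)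
  -- Where the weight is nonzero, consistency gives `Y(a) = Y`, so a multiple of `‖Y‖ + C`
  -- dominates.
  have hFint : ∀ a, Integrable (fun z => (𝓜.ipw k a z : ℝ) * F a (covarOf z, z.1 a))
      (𝓜.law k) := by
    intro a
    refine ((hYint.add (integrable_const C)).const_mul (Cw * c⁻¹)).mono'
      (((measurable_ipw k a).coe_nnreal_real.mul
        ((hFm a).comp (hXY a))).aestronglyMeasurable) ?_
    filter_upwards [hw', he', hg', hA.consistency k] with z h1 h2 h3 h4
    have hCw : 0 ≤ Cw := (norm_nonneg _).trans (h1 a)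
    have hC : 0 ≤ C := (norm_nonneg _).trans (h3 a)
    by_cases ht : treatOf z = a
    · have hi : (𝓜.ipw k a z : ℝ) ≤ c⁻¹ := by
        rw [Model.ipw, if_pos ht, Real.coe_toNNReal _ (inv_nonneg.2 (hc.trans (h2 a)).le)]
        exact inv_anti₀ hc (h2 a).le
      have hFz : |F a (covarOf z, z.1 a)| ≤ Cw * (‖outcomeOf z‖ + C) := by
        rw [ht] at h4
        rw [hF, h4]
        exact (abs_real_inner_le_norm _ _).trans (mul_le_mul (h1 a)
          ((norm_sub_le _ _).trans (add_le_add le_rfl (h3 a))) (norm_nonneg _) hCw)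
      rw [Real.norm_eq_abs, abs_mul, NNReal.abs_eq]
      calc (𝓜.ipw k a z : ℝ) * |F a (covarOf z, z.1 a)|
          ≤ c⁻¹ * (Cw * (‖outcomeOf z‖ + C)) :=
            mul_le_mul hi hFz (abs_nonneg _) (by positivity)
        _ = Cw * c⁻¹ * (‖outcomeOf z‖ + C) := by ring
    · simp only [Model.ipw, if_neg ht, NNReal.coe_zero, zero_mul, norm_zero]
      have : (0:ℝ) ≤ Cw * c⁻¹ * (‖outcomeOf z‖ + C) := by positivity
      exact this
  have hG : ∀ a, Integrable (fun z => (inner ℝ (w k a (covarOf z)) (g k a (covarOf z)) : ℝ))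
      (𝓜.law k) := by
    intro a
    refine (integrable_const (Cw * C)).mono' ((((hw_meas a).comp measurable_covarOf).inner
      ((hg_meas a).comp measurable_covarOf)).aestronglyMeasurable) ?_
    filter_upwards [hw', hg'] with z h1 h3
    exact (abs_real_inner_le_norm _ _).trans (mul_le_mul (h1 a) (h3 a) (norm_nonneg _)
      ((norm_nonneg _).trans (h1 a)))
  -- Only the term with `a = A` has a nonzero weight, and there `Y(a) = Y`.
  have hdecomp : ∀ᵐ z ∂(𝓜.law k), scoreCore w 𝓜.propensity g k z.2 =
      ∑ a, ((𝓜.ipw k a z : ℝ) * F a (covarOf z, z.1 a) +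
        inner ℝ (w k a (covarOf z)) (g k a (covarOf z))) := by
    filter_upwards [he', hA.consistency k] with z h2 h4
    rw [Finset.sum_add_distrib, Finset.sum_eq_single (treatOf z)]
    · rw [Model.ipw, if_pos rfl, Real.coe_toNNReal _ (inv_nonneg.2 (hc.trans (h2 _)).le), hF]
      simp only [← h4, scoreCore]
      rw [div_eq_inv_mul]
      rfl
    · intro a _ hne
      simp [Model.ipw, hne.symm]
    · simp
  have hsum : ∀ a, Integrable (fun z => (𝓜.ipw k a z : ℝ) * F a (covarOf z, z.1 a) +
      inner ℝ (w k a (covarOf z)) (g k a (covarOf z))) (𝓜.law k) := fun a =>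
    (hFint a).add (hG a)
  rw [integral_congr_ae hdecomp, integral_finsetSum _ fun a _ => hsum a, Model.theta]
  refine Finset.sum_congr rfl fun a _ => ?_
  -- Once the weight is removed, the `-g` inside `F` cancels the added `g` and leaves `w_k(a, X)ᵀ
  -- Y(a)`.
  rw [integral_add (hFint a) (hG a), integral_ipw hA k a (hFm a),
    ← integral_add (integrable_of_integrable_ipw hA k a (hFm a) (hFint a)) (hG a)]
  refine integral_congr_ae (ae_of_all _ fun z => ?_)
  simp [hF, inner_sub_right]

theorem integral_scoreCore_sub (hA : 𝓜.CausalAssumptions) (hw_meas : ∀ a, Measurable (w k a))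
    (hc : 0 < c) (hw : ∀ a, ∀ᵐ x ∂(𝓜.covLaw k), ‖w k a x‖ ≤ Cw)
    (he : ∀ a, ∀ᵐ x ∂(𝓜.covLaw k), c < 𝓜.propensity k a x)
    (hY : MemLp outcomeOf 2 (𝓜.law k))
    (hg_meas : ∀ a, Measurable (g k a)) (hg : ∀ a, ∀ᵐ x ∂(𝓜.covLaw k), ‖g k a x‖ ≤ C)
    (hg_meas' : ∀ a, Measurable (g' k a)) (hg' : ∀ a, ∀ᵐ x ∂(𝓜.covLaw k), ‖g' k a x‖ ≤ C) :
    ∫ z, (scoreCore w 𝓜.propensity g k z.2 - scoreCore w 𝓜.propensity g' k z.2) ∂(𝓜.law k)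
      = 0 := by
  rw [integral_sub ((memLp_scoreCore hw_meas hc hw he hY hg_meas hg).integrable one_le_two)
    ((memLp_scoreCore hw_meas hc hw he hY hg_meas' hg').integrable one_le_two),
    integral_scoreCore hA hw_meas hc hw he hY hg_meas hg,
    integral_scoreCore hA hw_meas hc hw he hY hg_meas' hg', sub_self]

/-- The bound on the difference of two scores. -/
def scoreDiffBound (M : Fin K → ℕ) (k : Fin K) (Cw c C : ℝ) : ℝ :=
  Cw * (1 / c + 1) * (Fintype.card (Treat (M k)) * (2 * C))

theorem ae_abs_scoreCore_sub_le
    (hc : 0 < c) (hw : ∀ a, ∀ᵐ x ∂(𝓜.covLaw k), ‖w k a x‖ ≤ Cw)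
    (he : ∀ a, ∀ᵐ x ∂(𝓜.covLaw k), c < 𝓜.propensity k a x)
    (hg : ∀ a, ∀ᵐ x ∂(𝓜.covLaw k), ‖g k a x‖ ≤ C)
    (hg' : ∀ a, ∀ᵐ x ∂(𝓜.covLaw k), ‖g' k a x‖ ≤ C) :
    ∀ᵐ z ∂(𝓜.law k), |scoreCore w 𝓜.propensity g k z.2 - scoreCore w 𝓜.propensity g' k z.2| ≤
      scoreDiffBound M k Cw c C := by
  filter_upwards [ae_covLaw 𝓜 (ae_all_iff.2 hw), ae_covLaw 𝓜 (ae_all_iff.2 he),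
    ae_covLaw 𝓜 (ae_all_iff.2 hg), ae_covLaw 𝓜 (ae_all_iff.2 hg')] with z h1 h2 h3 h4
  have hCw : 0 ≤ Cw := (norm_nonneg _).trans (h1 (treatOf z))
  refine (abs_scoreCore_sub_le hc h1 h2).trans
    (mul_le_mul_of_nonneg_left ?_ (by positivity))
  rw [← nsmul_eq_mul]
  refine Finset.sum_le_card_nsmul _ _ _ fun a _ => ?_
  exact (norm_sub_le _ _).trans ((add_le_add (h4 a) (h3 a)).trans (two_mul C).ge)

theorem lintegral_scoreCore_sub_sq_le
    (hc : 0 < c) (hw : ∀ a, ∀ᵐ x ∂(𝓜.covLaw k), ‖w k a x‖ ≤ Cw)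
    (he : ∀ a, ∀ᵐ x ∂(𝓜.covLaw k), c < 𝓜.propensity k a x)
    (hg_meas : ∀ a, Measurable (g k a)) (hg_meas' : ∀ a, Measurable (g' k a)) :
    ∫⁻ z, ENNReal.ofReal ((scoreCore w 𝓜.propensity g k z.2 -
        scoreCore w 𝓜.propensity g' k z.2) ^ 2) ∂(𝓜.law k) ≤
      ENNReal.ofReal ((Cw * (1 / c + 1)) ^ 2 * Fintype.card (Treat (M k))) *
        ∑ a, ∫⁻ x, ENNReal.ofReal (‖g' k a x - g k a x‖ ^ 2) ∂(𝓜.covLaw k) := by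
  have hm : ∀ a, Measurable fun x => ENNReal.ofReal (‖g' k a x - g k a x‖ ^ 2) := fun a =>
    (((hg_meas' a).sub (hg_meas a)).norm.pow_const 2).ennreal_ofReal
  rw [← lintegral_finsetSum _ fun a _ => hm a, ← lintegral_const_mul _
    (Finset.measurable_sum _ fun a _ => hm a), Model.covLaw, lintegral_map
    ((Finset.measurable_sum _ fun a _ => hm a).const_mul _) measurable_covarOf]
  refine lintegral_mono_ae ?_
  filter_upwards [ae_covLaw 𝓜 (ae_all_iff.2 hw), ae_covLaw 𝓜 (ae_all_iff.2 he)] with z h1 h2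
  rw [← ENNReal.ofReal_sum_of_nonneg fun a _ => by positivity,
    ← ENNReal.ofReal_mul (by positivity)]
  refine ENNReal.ofReal_le_ofReal ?_
  rw [← sq_abs]
  calc |scoreCore w 𝓜.propensity g k z.2 - scoreCore w 𝓜.propensity g' k z.2| ^ 2
      ≤ (Cw * (1 / c + 1) * ∑ a, ‖g' k a (covarOf z) - g k a (covarOf z)‖) ^ 2 :=
        pow_le_pow_left₀ (abs_nonneg _) (abs_scoreCore_sub_le hc h1 h2) 2
    -- Cauchy–Schwarz over the treatments.
    _ ≤ (Cw * (1 / c + 1)) ^ 2 * (Fintype.card (Treat (M k)) *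
          ∑ a, ‖g' k a (covarOf z) - g k a (covarOf z)‖ ^ 2) := by
        rw [mul_pow]
        exact mul_le_mul_of_nonneg_left sq_sum_le_card_mul_sum_sq (by positivity)
    _ = _ := by ring

end ScoreMoments

/-! ### Score errors with a frozen fitting sample -/

section CrossFitting

variable {K : ℕ} {M d : Fin K → ℕ} {𝒰 : Type*} [MeasurableSpace 𝒰]

namespace CrossFit

variable (S : CrossFit M d 𝒰)

theorem mem_fold {N : ℕ} {u : 𝒰} {o : Fin N → ObsCluster M d} {ℓ : Fin 2} {i : Fin N} :
    i ∈ S.fold u o ℓ ↔ S.split N u (fun j => (o j).1) i = ℓ := by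
  simp [fold]

theorem sum_fold {N : ℕ} (u : 𝒰) (o : Fin N → ObsCluster M d) (F : Fin 2 → Fin N → ℝ) :
    ∑ ℓ, ∑ i ∈ S.fold u o ℓ, F ℓ i = ∑ i, F (S.split N u (fun j => (o j).1) i) i := by
  rw [← Finset.sum_fiberwise Finset.univ (S.split N u (fun j => (o j).1))]
  refine Finset.sum_congr rfl fun ℓ _ => Finset.sum_congr rfl fun i hi => ?_
  rw [(S.mem_fold).1 hi]

theorem fold_congr {N : ℕ} {u : 𝒰} {o o' : Fin N → ObsCluster M d} {ℓ : Fin 2}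
    (h : ∀ j, (o j).1 = (o' j).1) : S.fold u o ℓ = S.fold u o' ℓ := by
  unfold fold
  rw [funext h]

theorem learner_congr {N : ℕ} {u : 𝒰} {o o' : Fin N → ObsCluster M d} {ℓ : Fin 2}
    {s s' : Finset (Fin N)} (hs : s = s') (h : ∀ i ∈ s, o i = o' i) :
    S.learner N ℓ u s (fun i => o i) = S.learner N ℓ u s' (fun i => o' i) := by
  subst hs
  congr 1
  funext i
  exact h i i.2

/-- The outcome regression used on a fold does not depend on the data of that fold beyond the
cluster types. -/
theorem gTilde_congr {N : ℕ} {u : 𝒰} {o o' : Fin N → ObsCluster M d} {ℓ : Fin 2}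
    (h : ∀ j, (o j).1 = (o' j).1) (h' : ∀ i, i ∉ S.fold u o ℓ → o i = o' i) :
    S.gTilde u o ℓ = S.gTilde u o' ℓ :=
  S.learner_congr (congrArg _ (S.fold_congr h)) fun i hi => h' i (Finset.mem_compl.1 hi)

theorem measurable_split_types (N : ℕ) :
    Measurable fun q : 𝒰 × (Fin N → ObsCluster M d) => S.split N q.1 (fun j => (q.2 j).1) := by
  refine (S.measurable_split N).comp (measurable_fst.prodMk (measurable_pi_lambda _ fun j => ?_))
  exact measurable_sigmaFst.comp ((measurable_pi_apply j).comp measurable_snd)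

/-- The learner is indexed by a random set, on which even the type of its data depends. The fold
assignment takes finitely many values; with it frozen the index set is constant. -/
theorem measurable_gTilde (N : ℕ) (ℓ : Fin 2) (k : Fin K) (a : Treat (M k)) :
    Measurable fun q : (𝒰 × (Fin N → ObsCluster M d)) × Covar (M k) (d k) =>
      S.gTilde q.1.1 q.1.2 ℓ k a q.2 := by
  have h1 : Measurable fun r : (Fin N → Fin 2) ×
      ((𝒰 × (Fin N → ObsCluster M d)) × Covar (M k) (d k)) =>
      S.learner N ℓ r.2.1.1 (Finset.univ.filter fun i => r.1 i = ℓ)ᶜ (fun i => r.2.1.2 i) k a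
        r.2.2 := by
    refine measurable_from_prod_countable_right fun c => ?_
    have h2 : Measurable fun q : (𝒰 × (Fin N → ObsCluster M d)) × Covar (M k) (d k) =>
        ((q.1.1, fun i : ((Finset.univ.filter fun i => c i = ℓ)ᶜ : Finset (Fin N)) =>
          q.1.2 i), q.2) := by
      refine (measurable_fst.fst.prodMk (measurable_pi_lambda _ fun i => ?_)).prodMk measurable_snd
      exact (measurable_pi_apply _).comp measurable_fst.snd
    exact (S.measurable_learner N ℓ _ k a).comp h2
  exact h1.comp (((S.measurable_split_types N).comp measurable_fst).prodMk measurable_id)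

variable (𝓜 : Model M d)

/-- The samples for which the outcome regression fitted for fold `ℓ` is bounded by `C` on the
clusters of type `k`. -/
def boundedFit (C : ℝ) (N : ℕ) (ℓ : Fin 2) (k : Fin K) : Set (𝒰 × (Fin N → ObsCluster M d)) :=
  {v | ∀ a, ∀ᵐ x ∂(𝓜.covLaw k), ‖S.gTilde v.1 v.2 ℓ k a x‖ ≤ C}

instance (k : Fin K) : IsProbabilityMeasure (𝓜.covLaw k) :=
  Measure.isProbabilityMeasure_map measurable_covarOf.aemeasurable

/-- The bound holds almost everywhere when a section of a measurable set is null, and the measure of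
a section is measurable in the base point. -/
theorem measurableSet_boundedFit (C : ℝ) (N : ℕ) (ℓ : Fin 2) (k : Fin K) :
    MeasurableSet (S.boundedFit 𝓜 C N ℓ k) := by
  have : S.boundedFit 𝓜 C N ℓ k = ⋂ a, {v | 𝓜.covLaw k (Prod.mk v ⁻¹'
      {q : (𝒰 × (Fin N → ObsCluster M d)) × Covar (M k) (d k) |
        ‖S.gTilde q.1.1 q.1.2 ℓ k a q.2‖ ≤ C}ᶜ) = 0} := by
    ext v
    simp only [boundedFit, Set.mem_iInter, Set.mem_ofPred_eq]
    rfl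
  rw [this]
  refine MeasurableSet.iInter fun a => ?_
  refine measurable_measure_prodMk_left ?_ (measurableSet_singleton 0)
  exact (measurableSet_le (S.measurable_gTilde N ℓ k a).norm measurable_const).compl

/-- The error, on a cluster `z` put at position `j` of fold `ℓ`, of the score with the fitted
outcome regression; it is set to `0` when the fit is not bounded by `C`. -/
def foldDiff (w gLim : VecFun M d) (C : ℝ) {N : ℕ} (ℓ : Fin 2) (k : Fin K) (j : Fin N)
    (v : 𝒰 × (Fin N → ObsCluster M d)) (z : ObsCluster M d) : ℝ :=
  open Classical in
  if j ∈ S.fold v.1 v.2 ℓ ∧ v ∈ S.boundedFit 𝓜 C N ℓ k then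
    score w 𝓜.propensity (S.gTilde v.1 v.2 ℓ) k z - score w 𝓜.propensity gLim k z else 0

/-- The squared distance of the outcome regression fitted for fold `ℓ` to `gLim`. -/
def fitError (gLim : VecFun M d) (C : ℝ) {N : ℕ} (ℓ : Fin 2) (k : Fin K)
    (v : 𝒰 × (Fin N → ObsCluster M d)) : ENNReal :=
  open Classical in
  if v ∈ S.boundedFit 𝓜 C N ℓ k then
    ∑ a, ∫⁻ x, ENNReal.ofReal (‖gLim k a x - S.gTilde v.1 v.2 ℓ k a x‖ ^ 2) ∂(𝓜.covLaw k) else 0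

variable {𝓜} {w gLim : VecFun M d} {C Cw c : ℝ} {N : ℕ} {ℓ : Fin 2} {k : Fin K}

theorem measurableSet_mem_fold (j : Fin N) :
    MeasurableSet {v : 𝒰 × (Fin N → ObsCluster M d) | j ∈ S.fold v.1 v.2 ℓ} := by
  simp only [mem_fold]
  exact ((measurable_pi_apply j).comp (S.measurable_split_types N)) (measurableSet_singleton ℓ)

theorem measurable_foldDiff (hw : ∀ a, Measurable (w k a)) (hg : ∀ a, Measurable (gLim k a))
    (j : Fin N) :
    Measurable fun q : (𝒰 × (Fin N → ObsCluster M d)) × ObsCluster M d =>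
      S.foldDiff 𝓜 w gLim C ℓ k j q.1 q.2 := by
  classical
  unfold foldDiff
  have h1 : Measurable fun q : (𝒰 × (Fin N → ObsCluster M d)) × ObsCluster M d =>
      score w 𝓜.propensity (S.gTilde q.1.1 q.1.2 ℓ) k q.2 :=
    measurable_score (G := fun v : 𝒰 × (Fin N → ObsCluster M d) => S.gTilde v.1 v.2 ℓ) hw
      (measurable_propensity k) (S.measurable_gTilde N ℓ k)
  have h2 : Measurable fun q : (𝒰 × (Fin N → ObsCluster M d)) × ObsCluster M d =>
      score w 𝓜.propensity gLim k q.2 :=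
    (measurable_score_const hw (measurable_propensity k) hg).comp measurable_snd
  refine Measurable.ite ?_ (h1.sub h2) measurable_const
  exact measurable_fst ((S.measurableSet_mem_fold j).inter (S.measurableSet_boundedFit 𝓜 C N ℓ k))

theorem measurable_fitError (hg : ∀ a, Measurable (gLim k a)) :
    Measurable fun v : 𝒰 × (Fin N → ObsCluster M d) => S.fitError 𝓜 gLim C ℓ k v := by
  classical
  unfold fitError
  refine Measurable.ite (S.measurableSet_boundedFit 𝓜 C N ℓ k) ?_ measurable_const
  refine Finset.measurable_sum _ fun a _ => ?_
  have h : Measurable fun q : (𝒰 × (Fin N → ObsCluster M d)) × Covar (M k) (d k) =>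
      ENNReal.ofReal (‖gLim k a q.2 - S.gTilde q.1.1 q.1.2 ℓ k a q.2‖ ^ 2) :=
    ((((hg a).comp measurable_snd).sub (S.measurable_gTilde N ℓ k a)).norm.pow_const
      2).ennreal_ofReal
  exact h.lintegral_prod_right'

/-- Folds are cut from the types alone, and the regression for a fold is fitted off that fold.
Replacing a cluster by one of the same type thus keeps the folds, and also the fit for the fold
containing it. -/
theorem gTilde_update {v : 𝒰 × (Fin N → ObsCluster M d)} {i : Fin N} {z₀ : ObsCluster M d}
    (ht : (v.2 i).1 = z₀.1) :
    S.fold v.1 (Function.update v.2 i z₀) ℓ = S.fold v.1 v.2 ℓ ∧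
      (i ∈ S.fold v.1 v.2 ℓ →
        S.gTilde v.1 (Function.update v.2 i z₀) ℓ = S.gTilde v.1 v.2 ℓ) := by
  have h : ∀ j, (v.2 j).1 = (Function.update v.2 i z₀ j).1 := by
    intro j
    by_cases hj : j = i
    · subst hj; simpa using ht
    · simp [hj]
  refine ⟨(S.fold_congr h).symm, fun hi => (S.gTilde_congr h fun j hj => ?_).symm⟩
  have : j ≠ i := fun hji => hj (hji ▸ hi)
  simp [this]

theorem foldDiff_update_of_mem {v : 𝒰 × (Fin N → ObsCluster M d)} {i : Fin N}
    {z₀ : ObsCluster M d} (ht : (v.2 i).1 = z₀.1) (hi : i ∈ S.fold v.1 v.2 ℓ) (j : Fin N)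
    (z : ObsCluster M d) :
    S.foldDiff 𝓜 w gLim C ℓ k j (v.1, Function.update v.2 i z₀) z =
      S.foldDiff 𝓜 w gLim C ℓ k j v z := by
  obtain ⟨h1, h2⟩ := S.gTilde_update (ℓ := ℓ) ht
  have h3 : (v.1, Function.update v.2 i z₀) ∈ S.boundedFit 𝓜 C N ℓ k ↔
      v ∈ S.boundedFit 𝓜 C N ℓ k := by
    simp only [boundedFit, Set.mem_ofPred_eq, h2 hi]
  simp only [foldDiff, h2 hi]
  classical exact if_congr (by rw [h1, h3]) rfl rfl

theorem fitError_update_of_mem {v : 𝒰 × (Fin N → ObsCluster M d)} {i : Fin N}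
    {z₀ : ObsCluster M d} (ht : (v.2 i).1 = z₀.1) (hi : i ∈ S.fold v.1 v.2 ℓ) :
    S.fitError 𝓜 gLim C ℓ k (v.1, Function.update v.2 i z₀) = S.fitError 𝓜 gLim C ℓ k v := by
  obtain ⟨h1, h2⟩ := S.gTilde_update (ℓ := ℓ) ht
  have h3 : (v.1, Function.update v.2 i z₀) ∈ S.boundedFit 𝓜 C N ℓ k ↔
      v ∈ S.boundedFit 𝓜 C N ℓ k := by
    simp only [boundedFit, Set.mem_ofPred_eq, h2 hi]
  simp only [fitError, h2 hi]
  classical exact if_congr h3 rfl rfl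

theorem foldDiff_of_type_ne {v : 𝒰 × (Fin N → ObsCluster M d)} {j : Fin N} {z : ObsCluster M d}
    (hz : z.1 ≠ k) : S.foldDiff 𝓜 w gLim C ℓ k j v z = 0 := by
  simp [foldDiff, score, hz]

theorem foldDiff_of_notMem {v : 𝒰 × (Fin N → ObsCluster M d)} {j : Fin N} {z : ObsCluster M d}
    (hj : j ∉ S.fold v.1 v.2 ℓ) : S.foldDiff 𝓜 w gLim C ℓ k j v z = 0 := by
  simp [foldDiff, hj]

/-- The error on cluster `i` does not depend on the data of cluster `i` in the fitting sample. -/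
theorem foldDiff_update (v : 𝒰 × (Fin N → ObsCluster M d)) (i : Fin N) {z₀ : ObsCluster M d}
    (hz : z₀.1 = k) :
    S.foldDiff 𝓜 w gLim C ℓ k i (v.1, Function.update v.2 i z₀) (v.2 i) =
      S.foldDiff 𝓜 w gLim C ℓ k i v (v.2 i) := by
  -- If cluster `i` is not of type `k` the replacement may change the folds, but both errors vanish.
  by_cases ht : (v.2 i).1 = k
  · by_cases hi : i ∈ S.fold v.1 v.2 ℓ
    · exact S.foldDiff_update_of_mem (ht.trans hz.symm) hi i _
    · rw [S.foldDiff_of_notMem hi, S.foldDiff_of_notMem]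
      rwa [(S.gTilde_update (ht.trans hz.symm)).1]
  · rw [S.foldDiff_of_type_ne ht, S.foldDiff_of_type_ne ht]

/-- The error on `j` can react to the data of `i` only when `i` is outside the fold, and then the
factor of `i` is zero. The product is therefore a function of the sample without `i` and of cluster
`i`, which is what uncorrelatedness rests on. -/
theorem foldDiff_mul_update (v : 𝒰 × (Fin N → ObsCluster M d)) {i j : Fin N} (hij : j ≠ i)
    {z₀ : ObsCluster M d} (hz : z₀.1 = k) :
    S.foldDiff 𝓜 w gLim C ℓ k i (v.1, Function.update v.2 i z₀) (v.2 i) *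
      S.foldDiff 𝓜 w gLim C ℓ k j (v.1, Function.update v.2 i z₀) (Function.update v.2 i z₀ j) =
      S.foldDiff 𝓜 w gLim C ℓ k i v (v.2 i) * S.foldDiff 𝓜 w gLim C ℓ k j v (v.2 j) := by
  rw [S.foldDiff_update v i hz, Function.update_of_ne hij]
  by_cases ht : (v.2 i).1 = k
  · by_cases hi : i ∈ S.fold v.1 v.2 ℓ
    · rw [S.foldDiff_update_of_mem (ht.trans hz.symm) hi j]
    · rw [S.foldDiff_of_notMem hi, zero_mul, zero_mul]
  · rw [S.foldDiff_of_type_ne ht, zero_mul, zero_mul]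

theorem gTilde_measurable (v : 𝒰 × (Fin N → ObsCluster M d)) (a : Treat (M k)) :
    Measurable (S.gTilde v.1 v.2 ℓ k a) := by
  have h : Measurable fun x : Covar (M k) (d k) => (v, x) := measurable_prodMk_left
  exact (S.measurable_gTilde N ℓ k a).comp h

theorem measurable_foldDiff_right (hw : ∀ a, Measurable (w k a))
    (hg : ∀ a, Measurable (gLim k a)) (v : 𝒰 × (Fin N → ObsCluster M d)) (j : Fin N) :
    Measurable (S.foldDiff 𝓜 w gLim C ℓ k j v) := by
  have h : Measurable fun z : ObsCluster M d => (v, z) := measurable_prodMk_left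
  have h2 := (S.measurable_foldDiff (𝓜 := 𝓜) (C := C) (ℓ := ℓ) hw hg j).comp h
  simp only [Function.comp_def] at h2
  exact h2

section Moments

variable (hw_meas : ∀ a, Measurable (w k a)) (hc : 0 < c)
    (hw : ∀ a, ∀ᵐ x ∂(𝓜.covLaw k), ‖w k a x‖ ≤ Cw)
    (he : ∀ a, ∀ᵐ x ∂(𝓜.covLaw k), c < 𝓜.propensity k a x)
    (hg_meas : ∀ a, Measurable (gLim k a))
    (hg : ∀ a, ∀ᵐ x ∂(𝓜.covLaw k), ‖gLim k a x‖ ≤ C)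

include hw_meas hc hw he hg_meas hg

theorem ae_abs_foldDiff_le (v : 𝒰 × (Fin N → ObsCluster M d)) (i : Fin N) :
    ∀ᵐ z ∂𝓜.obsLaw, |S.foldDiff 𝓜 w gLim C ℓ k i v z| ≤ |scoreDiffBound M k Cw c C| := by
  have hm : Measurable (S.foldDiff 𝓜 w gLim C ℓ k i v) :=
    S.measurable_foldDiff_right hw_meas hg_meas v i
  refine ae_obsLaw 𝓜 (measurableSet_le hm.abs measurable_const) fun j => ?_
  by_cases hj : j = k
  · subst hj
    by_cases hv : i ∈ S.fold v.1 v.2 ℓ ∧ v ∈ S.boundedFit 𝓜 C N ℓ j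
    · filter_upwards [ae_abs_scoreCore_sub_le hc hw he hv.2 hg] with z hz
      simp only [foldDiff, if_pos hv, score, if_true]
      exact hz.trans (le_abs_self _)
    · simp [foldDiff, hv]
  · refine ae_of_all _ fun z => ?_
    rw [S.foldDiff_of_type_ne hj, abs_zero]
    exact abs_nonneg _

/-- With the fit frozen, both scores have the same mean `θ_k*`. The truncation at unbounded fits
makes this true for every `v`. -/
theorem integral_foldDiff (hA : 𝓜.CausalAssumptions) (hY : MemLp outcomeOf 2 (𝓜.law k))
    (v : 𝒰 × (Fin N → ObsCluster M d)) (i : Fin N) :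
    ∫ z, S.foldDiff 𝓜 w gLim C ℓ k i v z ∂𝓜.obsLaw = 0 := by
  have hm : Measurable (S.foldDiff 𝓜 w gLim C ℓ k i v) :=
    S.measurable_foldDiff_right hw_meas hg_meas v i
  by_cases hv : i ∈ S.fold v.1 v.2 ℓ ∧ v ∈ S.boundedFit 𝓜 C N ℓ k
  · have hkey : ∀ j, Integrable (fun z => S.foldDiff 𝓜 w gLim C ℓ k i v ⟨j, z.2⟩) (𝓜.law j) ∧
        ∫ z, S.foldDiff 𝓜 w gLim C ℓ k i v ⟨j, z.2⟩ ∂(𝓜.law j) = 0 := by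
      intro j
      by_cases hj : j = k
      · subst hj
        simp only [foldDiff, if_pos hv, score, if_true]
        exact ⟨((memLp_scoreCore hw_meas hc hw he hY (S.gTilde_measurable v) hv.2).integrable
          one_le_two).sub ((memLp_scoreCore hw_meas hc hw he hY hg_meas hg).integrable
          one_le_two), integral_scoreCore_sub hA hw_meas hc hw he hY (S.gTilde_measurable v) hv.2
          hg_meas hg⟩
      · have : ∀ z : FullData (M j) (d j), S.foldDiff 𝓜 w gLim C ℓ k i v ⟨j, z.2⟩ = 0 := fun z =>
          S.foldDiff_of_type_ne hj
        simp [this]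
    rw [integral_obsLaw 𝓜 hm fun j => (hkey j).1]
    exact Finset.sum_eq_zero fun j _ => by rw [(hkey j).2, mul_zero]
  · simp [foldDiff, hv]

/-- The constant relating the second moment of a score error to the fit error. -/
def _root_.PartialInterference.scoreSqBound (M : Fin K → ℕ) (k : Fin K) (Cw c : ℝ) : ENNReal :=
  ENNReal.ofReal ((Cw * (1 / c + 1)) ^ 2 * Fintype.card (Treat (M k)))

/-- Both indicators are kept in the bound because `v` will be a sample with the reference cluster at
position `i`. They single out the case in which its fit error equals that of the original sample. -/
theorem lintegral_foldDiff_sq_le (v : 𝒰 × (Fin N → ObsCluster M d)) (i : Fin N) :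
    ∫⁻ z, ENNReal.ofReal (S.foldDiff 𝓜 w gLim C ℓ k i v z ^ 2) ∂𝓜.obsLaw ≤
      ∫⁻ z : ObsCluster M d, {v : 𝒰 × (Fin N → ObsCluster M d) | i ∈ S.fold v.1 v.2 ℓ}.indicator
        (fun v => scoreSqBound M k Cw c * S.fitError 𝓜 gLim C ℓ k v) v *
        {o : ObsCluster M d | o.1 = k}.indicator 1 z ∂𝓜.obsLaw := by
  have hm : Measurable (S.foldDiff 𝓜 w gLim C ℓ k i v) :=
    S.measurable_foldDiff_right hw_meas hg_meas v i
  by_cases hv : i ∈ S.fold v.1 v.2 ℓ ∧ v ∈ S.boundedFit 𝓜 C N ℓ k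
  · rw [lintegral_obsLaw 𝓜 (hm.pow_const 2).ennreal_ofReal, lintegral_obsLaw 𝓜
      ((measurable_one.indicator (measurableSet_type k)).const_mul _)]
    refine Finset.sum_le_sum fun j _ => mul_le_mul_right ?_ _
    by_cases hj : j = k
    · subst hj
      rw [Set.indicator_of_mem (show v ∈ {v : 𝒰 × (Fin N → ObsCluster M d) |
        i ∈ S.fold v.1 v.2 ℓ} from hv.1)]
      have h1 : ∀ z : FullData (M j) (d j), S.foldDiff 𝓜 w gLim C ℓ j i v ⟨j, z.2⟩ =
          scoreCore w 𝓜.propensity (S.gTilde v.1 v.2 ℓ) j z.2 -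
            scoreCore w 𝓜.propensity gLim j z.2 := fun z => by
        simp only [foldDiff, if_pos hv, score, if_true]
      have h2 : ∀ z : FullData (M j) (d j), scoreSqBound M j Cw c * S.fitError 𝓜 gLim C ℓ j v *
          {o : ObsCluster M d | o.1 = j}.indicator 1 (⟨j, z.2⟩ : ObsCluster M d) =
            scoreSqBound M j Cw c * S.fitError 𝓜 gLim C ℓ j v := fun z => by
        rw [Set.indicator_of_mem (show (⟨j, z.2⟩ : ObsCluster M d) ∈ {o : ObsCluster M d | o.1 = j}
          from rfl), Pi.one_apply, mul_one]
      rw [lintegral_congr h2, lintegral_const, measure_univ, mul_one]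
      simp only [h1, fitError, if_pos hv.2]
      exact lintegral_scoreCore_sub_sq_le hc hw he (S.gTilde_measurable v) hg_meas
    · have h1 : ∀ z : FullData (M j) (d j), ENNReal.ofReal
          (S.foldDiff 𝓜 w gLim C ℓ k i v ⟨j, z.2⟩ ^ 2) = 0 := fun z => by
        rw [S.foldDiff_of_type_ne hj, zero_pow two_ne_zero, ENNReal.ofReal_zero]
      rw [lintegral_congr h1, lintegral_zero]
      exact zero_le
  · have h1 : ∀ z, ENNReal.ofReal (S.foldDiff 𝓜 w gLim C ℓ k i v z ^ 2) = 0 := fun z => by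
      rw [foldDiff, if_neg hv, zero_pow two_ne_zero, ENNReal.ofReal_zero]
    rw [lintegral_congr h1, lintegral_zero]
    exact zero_le

end Moments

end CrossFit

end CrossFitting

/-! ### Negligibility of the cross-fitting errors -/

section Remainder

variable {K : ℕ} {M d : Fin K → ℕ} {𝓜 : Model M d} {Ω : Type*} [MeasurableSpace Ω]
  {P : Measure Ω} {W : ℕ → Ω → Cluster M d}
  {𝒰 : Type*} [MeasurableSpace 𝒰] {U : Ω → 𝒰}

/-- The observed data of the first `N` clusters. -/
abbrev sample (W : ℕ → Ω → Cluster M d) (N : ℕ) (ω : Ω) : Fin N → ObsCluster M d :=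
  fun i => obs (W i ω)

theorem measurable_sample (hW_meas : ∀ i, Measurable (W i)) (N : ℕ) :
    Measurable (sample W N) :=
  measurable_pi_lambda _ fun i => measurable_obs.comp (hW_meas i)

theorem map_obs (hW_meas : ∀ i, Measurable (W i)) (hW_law : ∀ i, P.map (W i) = 𝓜.clusterLaw)
    (i : ℕ) : P.map (fun ω => obs (W i ω)) = 𝓜.obsLaw := by
  rw [Model.obsLaw, ← hW_law i, Measure.map_map measurable_obs (hW_meas i)]
  rfl

theorem measurable_update_sample (hW_meas : ∀ i, Measurable (W i)) (hU_meas : Measurable U)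
    {N : ℕ} (i : Fin N) (z₀ : ObsCluster M d) :
    Measurable fun ω => (U ω, Function.update (sample W N ω) i z₀) := by
  refine hU_meas.prodMk (measurable_pi_lambda _ fun j => ?_)
  by_cases h : j = i
  · subst h; simp
  · simp only [Function.update_of_ne h]
    exact measurable_obs.comp (hW_meas j)

/-- A cluster is independent of the auxiliary randomness and the other clusters. -/
theorem indepFun_update_sample [IsProbabilityMeasure P] (hW_meas : ∀ i, Measurable (W i))
    (hW_indep : iIndepFun W P) (hU_meas : Measurable U)
    (hU_indep : IndepFun U (fun ω i => W i ω) P) {N : ℕ} (i : Fin N) (z₀ : ObsCluster M d) :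
    IndepFun (fun ω => (U ω, Function.update (sample W N ω) i z₀)) (fun ω => obs (W i ω)) P := by
  have hYm : Measurable fun ω => Function.update (sample W N ω) i z₀ :=
    (measurable_update_sample hW_meas hU_meas i z₀).snd
  refine indepFun_prodMk_left hU_meas hYm (measurable_obs.comp (hW_meas i)) ?_ ?_
  · have hψ : Measurable fun s : ℕ → Cluster M d =>
        (Function.update (fun j : Fin N => obs (s j)) i z₀, obs (s i)) := by
      refine (measurable_pi_lambda _ fun j => ?_).prodMk
        (measurable_obs.comp (measurable_pi_apply _))
      by_cases h : j = i
      · subst h; simp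
      · simp only [Function.update_of_ne h]
        exact measurable_obs.comp (measurable_pi_apply (j : ℕ))
    exact hU_indep.comp measurable_id hψ
  · have h := hW_indep.indepFun_finset ((Finset.range N).erase i) {(i : ℕ)}
      (by simp) hW_meas
    have hmem : ∀ j : Fin N, j ≠ i → (j : ℕ) ∈ (Finset.range N).erase i := fun j hj =>
      Finset.mem_erase.2 ⟨fun h => hj (Fin.ext h), Finset.mem_range.2 j.2⟩
    have hφ : Measurable fun (f : ((Finset.range N).erase (i : ℕ)) → Cluster M d) (j : Fin N) =>
        if h : j = i then z₀ else obs (f ⟨j, hmem j h⟩) := by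
      refine measurable_pi_lambda _ fun j => ?_
      by_cases h : j = i
      · simp [h]
      · simp only [dif_neg h]
        exact measurable_obs.comp (measurable_pi_apply (⟨j, hmem j h⟩ : ((Finset.range N).erase (i : ℕ))))
    have hψ : Measurable fun f : (({(i : ℕ)} : Finset ℕ)) → Cluster M d =>
        obs (f ⟨i, Finset.mem_singleton_self _⟩) := measurable_obs.comp (measurable_pi_apply _)
    have h2 := h.comp hφ hψ
    have h3 : (fun ω => Function.update (sample W N ω) i z₀) =
        (fun (f : ((Finset.range N).erase (i : ℕ)) → Cluster M d) (j : Fin N) =>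
          if h : j = i then z₀ else obs (f ⟨j, hmem j h⟩)) ∘ fun ω j => W j ω := by
      funext ω j
      by_cases h : j = i
      · subst h; simp
      · simp [h]
    rw [h3]
    exact h2

namespace CrossFit

variable [IsProbabilityMeasure P] (S : CrossFit M d 𝒰) {w gLim : VecFun M d} {C Cw c : ℝ}
  {k : Fin K}
  (hW_meas : ∀ i, Measurable (W i)) (hW_law : ∀ i, P.map (W i) = 𝓜.clusterLaw)
  (hW_indep : iIndepFun W P) (hU_meas : Measurable U)
  (hU_indep : IndepFun U (fun ω i => W i ω) P)
  (hw_meas : ∀ a, Measurable (w k a)) (hg_meas : ∀ a, Measurable (gLim k a))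

/-- The error of the cross-fitted score of type `k` on cluster `i` when it lies in fold `ℓ`. -/
def sampleDiff (𝓜 : Model M d) (w gLim : VecFun M d) (C : ℝ) (W : ℕ → Ω → Cluster M d) (U : Ω → 𝒰)
    (N : ℕ) (ℓ : Fin 2) (k : Fin K) (i : Fin N) (ω : Ω) : ℝ :=
  S.foldDiff 𝓜 w gLim C ℓ k i (U ω, sample W N ω) (obs (W i ω))

include hW_meas hU_meas hw_meas hg_meas in
theorem measurable_sampleDiff (N : ℕ) (ℓ : Fin 2) (i : Fin N) :
    Measurable (S.sampleDiff 𝓜 w gLim C W U N ℓ k i) := by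
  have h : Measurable fun ω => ((U ω, sample W N ω), obs (W i ω)) :=
    (hU_meas.prodMk (measurable_sample hW_meas N)).prodMk (measurable_obs.comp (hW_meas i))
  have h2 := (S.measurable_foldDiff (𝓜 := 𝓜) (C := C) (ℓ := ℓ) hw_meas hg_meas i).comp h
  simp only [Function.comp_def] at h2
  exact h2

/-- An arbitrary cluster of type `k`. -/
def _root_.PartialInterference.refCluster (k : Fin K) : ObsCluster M d :=
  ⟨k, (0, fun _ => false, 0)⟩

omit [MeasurableSpace Ω] in
-- Exhibits the error as a function of two independent variables, the sample with position `i`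
-- overwritten and cluster `i`.
theorem sampleDiff_eq (N : ℕ) (ℓ : Fin 2) (i : Fin N) (ω : Ω) :
    S.sampleDiff 𝓜 w gLim C W U N ℓ k i ω = S.foldDiff 𝓜 w gLim C ℓ k i
      (U ω, Function.update (sample W N ω) i (refCluster k)) (obs (W i ω)) :=
  (S.foldDiff_update (U ω, sample W N ω) i (z₀ := refCluster k) rfl).symm

section Moments

variable (hc : 0 < c)
    (hw : ∀ a, ∀ᵐ x ∂(𝓜.covLaw k), ‖w k a x‖ ≤ Cw)
    (he : ∀ a, ∀ᵐ x ∂(𝓜.covLaw k), c < 𝓜.propensity k a x)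
    (hg : ∀ a, ∀ᵐ x ∂(𝓜.covLaw k), ‖gLim k a x‖ ≤ C)

include hW_meas hW_law hW_indep hU_meas hU_indep hw_meas hg_meas hc hw he hg

theorem ae_abs_sampleDiff_le (N : ℕ) (ℓ : Fin 2) (i : Fin N) :
    ∀ᵐ ω ∂P, |S.sampleDiff 𝓜 w gLim C W U N ℓ k i ω| ≤ |scoreDiffBound M k Cw c C| := by
  simp_rw [S.sampleDiff_eq]
  refine indepFun_ae_of_forall_ae
    (indepFun_update_sample hW_meas hW_indep hU_meas hU_indep i (refCluster k))
    (measurable_update_sample hW_meas hU_meas i (refCluster k)) (measurable_obs.comp (hW_meas i))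
    (p := fun q => |S.foldDiff 𝓜 w gLim C ℓ k i q.1 q.2| ≤ |scoreDiffBound M k Cw c C|)
    (measurableSet_le (S.measurable_foldDiff hw_meas hg_meas i).abs measurable_const) fun v => ?_
  have := S.ae_abs_foldDiff_le hw_meas hc hw he hg_meas hg (ℓ := ℓ) v i
  rwa [← map_obs (P := P) hW_meas hW_law i] at this

theorem integrable_sampleDiff_mul (N : ℕ) (ℓ : Fin 2) (i j : Fin N) :
    Integrable (fun ω => S.sampleDiff 𝓜 w gLim C W U N ℓ k i ω *
      S.sampleDiff 𝓜 w gLim C W U N ℓ k j ω) P := by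
  refine (integrable_const (|scoreDiffBound M k Cw c C| * |scoreDiffBound M k Cw c C|)).mono'
    ((S.measurable_sampleDiff hW_meas hU_meas hw_meas hg_meas N ℓ i).mul
    (S.measurable_sampleDiff hW_meas hU_meas hw_meas hg_meas N ℓ j)).aestronglyMeasurable ?_
  filter_upwards [S.ae_abs_sampleDiff_le hW_meas hW_law hW_indep hU_meas hU_indep hw_meas hg_meas
    hc hw he hg N ℓ i, S.ae_abs_sampleDiff_le hW_meas hW_law hW_indep hU_meas hU_indep hw_meas
    hg_meas hc hw he hg N ℓ j] with ω h1 h2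
  rw [Real.norm_eq_abs, abs_mul]
  exact mul_le_mul h1 h2 (abs_nonneg _) (abs_nonneg _)

/-- The errors on two different clusters of a fold are uncorrelated. -/
theorem integral_sampleDiff_mul (hA : 𝓜.CausalAssumptions) (hY : MemLp outcomeOf 2 (𝓜.law k))
    (N : ℕ) (ℓ : Fin 2) {i j : Fin N} (hij : j ≠ i) :
    ∫ ω, S.sampleDiff 𝓜 w gLim C W U N ℓ k i ω * S.sampleDiff 𝓜 w gLim C W U N ℓ k j ω ∂P = 0 := by
  set F : (𝒰 × (Fin N → ObsCluster M d)) × ObsCluster M d → ℝ := fun q =>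
    S.foldDiff 𝓜 w gLim C ℓ k i q.1 q.2 * S.foldDiff 𝓜 w gLim C ℓ k j q.1 (q.1.2 j) with hF
  have hm2 : Measurable fun q : (𝒰 × (Fin N → ObsCluster M d)) × ObsCluster M d =>
      S.foldDiff 𝓜 w gLim C ℓ k j q.1 (q.1.2 j) := by
    have h : Measurable fun q : (𝒰 × (Fin N → ObsCluster M d)) × ObsCluster M d =>
        (q.1, q.1.2 j) :=
      measurable_fst.prodMk ((measurable_pi_apply j).comp measurable_fst.snd)
    have h2 := (S.measurable_foldDiff (𝓜 := 𝓜) (C := C) (ℓ := ℓ) hw_meas hg_meas j).comp h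
    simp only [Function.comp_def] at h2
    exact h2
  have hFm : Measurable F := (S.measurable_foldDiff hw_meas hg_meas i).mul hm2
  have heq : ∀ ω, S.sampleDiff 𝓜 w gLim C W U N ℓ k i ω *
      S.sampleDiff 𝓜 w gLim C W U N ℓ k j ω =
      F ((U ω, Function.update (sample W N ω) i (refCluster k)), obs (W i ω)) := fun ω =>
    (S.foldDiff_mul_update (U ω, sample W N ω) hij (z₀ := refCluster k) rfl).symm
  have hint := S.integrable_sampleDiff_mul hW_meas hW_law hW_indep hU_meas hU_indep hw_meas
    hg_meas hc hw he hg N ℓ i j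
  simp_rw [heq] at hint ⊢
  refine indepFun_integral_eq_zero
    (indepFun_update_sample hW_meas hW_indep hU_meas hU_indep i (refCluster k))
    (measurable_update_sample hW_meas hU_meas i (refCluster k)) (measurable_obs.comp (hW_meas i))
    hFm hint fun v => ?_
  have h3 : P.map (obs ∘ W i) = 𝓜.obsLaw := map_obs hW_meas hW_law i
  have h4 := S.integral_foldDiff hw_meas hc hw he hg_meas hg (ℓ := ℓ) hA hY v i
  -- With `v` frozen the factor of `j` is a constant, and the factor of `i` integrates to zero.
  simp only [hF, integral_mul_const]
  rw [← h3] at h4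
  exact mul_eq_zero_of_left h4 _

theorem lintegral_sampleDiff_sq_le (N : ℕ) (ℓ : Fin 2) (i : Fin N) :
    ∫⁻ ω, ENNReal.ofReal (S.sampleDiff 𝓜 w gLim C W U N ℓ k i ω ^ 2) ∂P ≤
      scoreSqBound M k Cw c * ∫⁻ ω, S.fitError 𝓜 gLim C ℓ k (U ω, sample W N ω) ∂P := by
  have hfe : Measurable fun v : 𝒰 × (Fin N → ObsCluster M d) => S.fitError 𝓜 gLim C ℓ k v :=
    S.measurable_fitError hg_meas
  have h1 := indepFun_lintegral_le_lintegral
    (indepFun_update_sample hW_meas hW_indep hU_meas hU_indep i (refCluster k))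
    (measurable_update_sample hW_meas hU_meas i (refCluster k)) (measurable_obs.comp (hW_meas i))
    (F := fun q => ENNReal.ofReal (S.foldDiff 𝓜 w gLim C ℓ k i q.1 q.2 ^ 2))
    (G := fun q => {v : 𝒰 × (Fin N → ObsCluster M d) | i ∈ S.fold v.1 v.2 ℓ}.indicator
        (fun v => scoreSqBound M k Cw c * S.fitError 𝓜 gLim C ℓ k v) q.1 *
        {o : ObsCluster M d | o.1 = k}.indicator 1 q.2)
    ((S.measurable_foldDiff hw_meas hg_meas i).pow_const 2).ennreal_ofReal
    ((((hfe.const_mul _).indicator (S.measurableSet_mem_fold i)).comp measurable_fst).mul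
      ((measurable_one.indicator (measurableSet_type k)).comp measurable_snd))
    (fun v => by
      have h3 : P.map (obs ∘ W i) = 𝓜.obsLaw := map_obs hW_meas hW_law i
      have h4 := S.lintegral_foldDiff_sq_le hw_meas hc hw he hg_meas hg (ℓ := ℓ) v i
      rw [← h3] at h4
      exact h4)
  simp_rw [S.sampleDiff_eq]
  refine h1.trans ?_
  have hfe' : Measurable fun ω => S.fitError 𝓜 gLim C ℓ k (U ω, sample W N ω) :=
    hfe.comp (hU_meas.prodMk (measurable_sample hW_meas N))
  rw [← lintegral_const_mul _ hfe']
  refine lintegral_mono fun ω => ?_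
  -- If `i` has type `k` and lies in the fold, overwriting it leaves the fit error unchanged;
  -- otherwise an indicator makes the left side zero.
  by_cases ht : (obs (W i ω)).1 = k
  · have ht' : ((U ω, sample W N ω).2 i).1 = (refCluster (M := M) (d := d) k).1 := ht
    by_cases hi : i ∈ S.fold (U ω) (sample W N ω) ℓ
    · rw [← S.fitError_update_of_mem ht' hi]
      have h5 : {o : ObsCluster M d | o.1 = k}.indicator (1 : ObsCluster M d → ENNReal)
          (obs (W i ω)) ≤ 1 := Set.indicator_le_self _ _ _
      refine (mul_le_of_le_one_right' h5).trans ?_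
      exact Set.indicator_le_self _ _ _
    · rw [Set.indicator_of_notMem, zero_mul]
      · exact zero_le
      · show i ∉ S.fold (U ω) (Function.update (sample W N ω) i (refCluster k)) ℓ
        rwa [(S.gTilde_update ht').1]
  · rw [Set.indicator_of_notMem (show obs (W i ω) ∉ {o : ObsCluster M d | o.1 = k} from ht),
      mul_zero]
    exact zero_le

/-- The off-diagonal terms of the expanded square have mean zero, so the bound carries a factor `N`
and not `N²`. After division by `N`, consistency of the fit suffices. -/
theorem lintegral_sum_sampleDiff_sq_le (hA : 𝓜.CausalAssumptions)
    (hY : MemLp outcomeOf 2 (𝓜.law k)) (N : ℕ) (ℓ : Fin 2) :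
    ∫⁻ ω, ENNReal.ofReal ((∑ i, S.sampleDiff 𝓜 w gLim C W U N ℓ k i ω) ^ 2) ∂P ≤
      N * (scoreSqBound M k Cw c * ∫⁻ ω, S.fitError 𝓜 gLim C ℓ k (U ω, sample W N ω) ∂P) := by
  have hint := S.integrable_sampleDiff_mul hW_meas hW_law hW_indep hU_meas hU_indep hw_meas
    hg_meas hc hw he hg N ℓ
  have h1 : ∀ ω, (∑ i, S.sampleDiff 𝓜 w gLim C W U N ℓ k i ω) ^ 2 =
      ∑ i, ∑ j, S.sampleDiff 𝓜 w gLim C W U N ℓ k i ω * S.sampleDiff 𝓜 w gLim C W U N ℓ k j ω :=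
    fun ω => by rw [sq, Finset.sum_mul_sum]
  have hint2 : Integrable (fun ω => (∑ i, S.sampleDiff 𝓜 w gLim C W U N ℓ k i ω) ^ 2) P := by
    simp_rw [h1]
    exact integrable_finsetSum _ fun i _ => integrable_finsetSum _ fun j _ => hint i j
  have h2 : ∫ ω, (∑ i, S.sampleDiff 𝓜 w gLim C W U N ℓ k i ω) ^ 2 ∂P =
      ∑ i, ∫ ω, S.sampleDiff 𝓜 w gLim C W U N ℓ k i ω ^ 2 ∂P := by
    simp_rw [h1]
    rw [integral_finsetSum _ fun i _ => integrable_finsetSum _ fun j _ => hint i j]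
    refine Finset.sum_congr rfl fun i _ => ?_
    rw [integral_finsetSum _ fun j _ => hint i j, Finset.sum_eq_single i]
    · simp_rw [sq]
    · exact fun j _ hj => S.integral_sampleDiff_mul hW_meas hW_law hW_indep hU_meas hU_indep
        hw_meas hg_meas hc hw he hg hA hY N ℓ hj
    · simp
  rw [← ofReal_integral_eq_lintegral_ofReal hint2 (ae_of_all _ fun ω => sq_nonneg _), h2,
    ENNReal.ofReal_sum_of_nonneg fun i _ => integral_nonneg fun ω => sq_nonneg _]
  have h3 : ∀ i ∈ Finset.univ, ENNReal.ofReal (∫ ω, S.sampleDiff 𝓜 w gLim C W U N ℓ k i ω ^ 2 ∂P) ≤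
      scoreSqBound M k Cw c * ∫⁻ ω, S.fitError 𝓜 gLim C ℓ k (U ω, sample W N ω) ∂P := by
    intro i _
    rw [ofReal_integral_eq_lintegral_ofReal (by simpa [sq] using hint i i)
      (ae_of_all _ fun ω => sq_nonneg _)]
    exact S.lintegral_sampleDiff_sq_le hW_meas hW_law hW_indep hU_meas hU_indep hw_meas hg_meas
      hc hw he hg N ℓ i
  refine (Finset.sum_le_card_nsmul _ _ _ h3).trans ?_
  simp

theorem isSmallOP_sum_sampleDiff (hA : 𝓜.CausalAssumptions)
    (hY : MemLp outcomeOf 2 (𝓜.law k)) (ℓ : Fin 2)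
    (hfit : Tendsto (fun N => ∫⁻ ω, S.fitError 𝓜 gLim C ℓ k (U ω, sample W N ω) ∂P) atTop
      (𝓝 0)) :
    IsSmallOP P (fun N ω => (√(N : ℝ))⁻¹ * ∑ i, S.sampleDiff 𝓜 w gLim C W U N ℓ k i ω) := by
  have hm : ∀ N, Measurable fun ω => ∑ i, S.sampleDiff 𝓜 w gLim C W U N ℓ k i ω := fun N =>
    Finset.measurable_sum _ fun i _ =>
      S.measurable_sampleDiff hW_meas hU_meas hw_meas hg_meas N ℓ i
  refine isSmallOP_of_sq (isSmallOP_of_lintegral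
    (Z := fun N ω => ENNReal.ofReal ((N : ℝ)⁻¹) *
      ENNReal.ofReal ((∑ i, S.sampleDiff 𝓜 w gLim C W U N ℓ k i ω) ^ 2))
    (fun N => ((((hm N).pow_const 2).ennreal_ofReal).const_mul _).aemeasurable)
    (Eventually.of_forall fun N => ae_of_all _ fun ω => le_of_eq ?_) ?_)
  · rw [abs_of_nonneg (sq_nonneg _), mul_pow, inv_pow, Real.sq_sqrt (Nat.cast_nonneg N),
      ENNReal.ofReal_mul (by positivity)]
  · have h0 : Tendsto (fun N : ℕ => scoreSqBound M k Cw c *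
        ∫⁻ ω, S.fitError 𝓜 gLim C ℓ k (U ω, sample W N ω) ∂P) atTop (𝓝 0) := by
      simpa using ENNReal.Tendsto.const_mul (a := scoreSqBound M k Cw c) hfit
        (Or.inr ENNReal.ofReal_ne_top)
    refine tendsto_of_tendsto_of_tendsto_of_le_of_le' tendsto_const_nhds h0
      (Eventually.of_forall fun _ => zero_le) ?_
    filter_upwards [eventually_gt_atTop 0] with N hN
    rw [lintegral_const_mul _ ((hm N).pow_const 2).ennreal_ofReal]
    refine (mul_le_mul_right (S.lintegral_sum_sampleDiff_sq_le hW_meas hW_law hW_indep hU_meas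
      hU_indep hw_meas hg_meas hc hw he hg hA hY N ℓ) _).trans (le_of_eq ?_)
    have hN' : (0 : ℝ) < N := Nat.cast_pos.2 hN
    rw [← mul_assoc, ← ENNReal.ofReal_natCast N, ← ENNReal.ofReal_mul (by positivity),
      inv_mul_cancel₀ hN'.ne', ENNReal.ofReal_one, one_mul]

/-- Used for the variance estimator; no cross terms occur, so unbiasedness plays no role here. -/
theorem isSmallOP_mean_sampleDiff_sq (ℓ : Fin 2)
    (hfit : Tendsto (fun N => ∫⁻ ω, S.fitError 𝓜 gLim C ℓ k (U ω, sample W N ω) ∂P) atTop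
      (𝓝 0)) :
    IsSmallOP P (fun N ω => (N : ℝ)⁻¹ * ∑ i, S.sampleDiff 𝓜 w gLim C W U N ℓ k i ω ^ 2) := by
  have hm : ∀ N, ∀ i : Fin N, Measurable fun ω =>
      ENNReal.ofReal (S.sampleDiff 𝓜 w gLim C W U N ℓ k i ω ^ 2) := fun N i =>
    ((S.measurable_sampleDiff hW_meas hU_meas hw_meas hg_meas N ℓ i).pow_const 2).ennreal_ofReal
  refine isSmallOP_of_lintegral
    (Z := fun N ω => ENNReal.ofReal ((N : ℝ)⁻¹) *
      ∑ i, ENNReal.ofReal (S.sampleDiff 𝓜 w gLim C W U N ℓ k i ω ^ 2))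
    (fun N => ((Finset.measurable_sum _ fun i _ => hm N i).const_mul _).aemeasurable)
    (Eventually.of_forall fun N => ae_of_all _ fun ω => le_of_eq ?_) ?_
  · rw [abs_of_nonneg (by positivity), ENNReal.ofReal_mul (by positivity),
      ENNReal.ofReal_sum_of_nonneg fun i _ => sq_nonneg _]
  · have h0 : Tendsto (fun N : ℕ => scoreSqBound M k Cw c *
        ∫⁻ ω, S.fitError 𝓜 gLim C ℓ k (U ω, sample W N ω) ∂P) atTop (𝓝 0) := by
      simpa using ENNReal.Tendsto.const_mul (a := scoreSqBound M k Cw c) hfit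
        (Or.inr ENNReal.ofReal_ne_top)
    refine tendsto_of_tendsto_of_tendsto_of_le_of_le' tendsto_const_nhds h0
      (Eventually.of_forall fun _ => zero_le) ?_
    filter_upwards [eventually_gt_atTop 0] with N hN
    rw [lintegral_const_mul _ (Finset.measurable_sum _ fun i _ => hm N i),
      lintegral_finsetSum _ fun i _ => hm N i]
    refine (mul_le_mul_right (Finset.sum_le_card_nsmul _ _ _ fun i _ =>
      S.lintegral_sampleDiff_sq_le hW_meas hW_law hW_indep hU_meas hU_indep hw_meas hg_meas
        hc hw he hg N ℓ i) _).trans (le_of_eq ?_)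
    have hN' : (0 : ℝ) < N := Nat.cast_pos.2 hN
    rw [Finset.card_univ, Fintype.card_fin, nsmul_eq_mul, ← mul_assoc, ← ENNReal.ofReal_natCast N,
      ← ENNReal.ofReal_mul (by positivity), inv_mul_cancel₀ hN'.ne', ENNReal.ofReal_one, one_mul]

end Moments

/-- The integrated squared distance is `o_P(1)` and almost surely at most `(2C)²` for each
treatment, so bounded convergence upgrades it to convergence in mean, which the moment bounds
require. -/
theorem tendsto_lintegral_fitError (hg_meas : ∀ a, Measurable (gLim k a))
    (hg : ∀ a, ∀ᵐ x ∂(𝓜.covLaw k), ‖gLim k a x‖ ≤ C) (ℓ : Fin 2)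
    (hgTilde_bdd : ∀ (N : ℕ) (a : Treat (M k)), ∀ᵐ ω ∂P, ∀ᵐ x ∂(𝓜.covLaw k),
      ‖S.gTilde (U ω) (sample W N ω) ℓ k a x‖ ≤ C)
    {r : ℕ → ℝ} (hr : Tendsto r atTop (𝓝 0))
    (hconv : ∀ a : Treat (M k), IsBigOP P
        (fun N ω => ∫ x, ‖gLim k a x - S.gTilde (U ω) (sample W N ω) ℓ k a x‖ ^ 2 ∂(𝓜.covLaw k))
        (fun N => r N ^ 2)) :
    Tendsto (fun N => ∫⁻ ω, S.fitError 𝓜 gLim C ℓ k (U ω, sample W N ω) ∂P) atTop (𝓝 0) := by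
  have hsm : IsSmallOP P (fun N ω => ∑ a,
      ∫ x, ‖gLim k a x - S.gTilde (U ω) (sample W N ω) ℓ k a x‖ ^ 2 ∂(𝓜.covLaw k)) :=
    IsSmallOP.sum fun a _ => (hconv a).isSmallOP (by simpa using hr.pow 2)
  have hbd : ∀ N, ∀ᵐ ω ∂P, ∀ a, ∀ᵐ x ∂(𝓜.covLaw k),
      ‖gLim k a x - S.gTilde (U ω) (sample W N ω) ℓ k a x‖ ^ 2 ≤ (2 * C) ^ 2 := by
    intro N
    filter_upwards [ae_all_iff.2 (hgTilde_bdd N)] with ω hω a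
    filter_upwards [hω a, hg a] with x h1 h2
    refine pow_le_pow_left₀ (norm_nonneg _) ?_ 2
    exact (norm_sub_le _ _).trans ((add_le_add h2 h1).trans (two_mul C).ge)
  have hint : ∀ N, ∀ᵐ ω ∂P, ∀ a, Integrable
      (fun x => ‖gLim k a x - S.gTilde (U ω) (sample W N ω) ℓ k a x‖ ^ 2) (𝓜.covLaw k) := by
    intro N
    filter_upwards [hbd N] with ω hω a
    refine (integrable_const ((2 * C) ^ 2)).mono'
      ((((hg_meas a).sub (S.gTilde_measurable (U ω, sample W N ω) a)).norm.pow_const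
        2).aestronglyMeasurable) ?_
    filter_upwards [hω a] with x hx
    rwa [Real.norm_of_nonneg (sq_nonneg _)]
  have h := hsm.tendsto_lintegral (B := Fintype.card (Treat (M k)) * (2 * C) ^ 2) (by
    intro N
    filter_upwards [hbd N, hint N] with ω h1 h2
    rw [abs_of_nonneg (Finset.sum_nonneg fun a _ => integral_nonneg fun x => sq_nonneg _),
      ← nsmul_eq_mul]
    refine Finset.sum_le_card_nsmul _ _ _ fun a _ => ?_
    refine (integral_mono_ae (h2 a) (integrable_const _) (h1 a)).trans ?_
    simp)
  refine tendsto_of_tendsto_of_tendsto_of_le_of_le tendsto_const_nhds h (fun _ => zero_le)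
    fun N => lintegral_mono_ae ?_
  filter_upwards [hint N] with ω hω
  rw [abs_of_nonneg (Finset.sum_nonneg fun a _ => integral_nonneg fun x => sq_nonneg _),
    ENNReal.ofReal_sum_of_nonneg fun a _ => integral_nonneg fun x => sq_nonneg _]
  unfold fitError
  split_ifs with hv
  · refine Finset.sum_le_sum fun a _ => ?_
    rw [ofReal_integral_eq_lintegral_ofReal (hω a) (ae_of_all _ fun x => sq_nonneg _)]
  · exact zero_le

end CrossFit

end Remainder

/-! ### First-order expansion -/

section Linearization

variable {Ω : Type*} [MeasurableSpace Ω] {P : Measure Ω}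

/-- First-order expansion of `v(p̂) θ̃` when `p̂ (θ̃ - θ)` is, up to negligible terms, a centered
mean. -/
theorem isSmallOP_linearization {p θ v' : ℝ} (hp0 : 0 < p) {v : ℝ → ℝ} {ph th s R : ℕ → Ω → ℝ}
    (hth : ∀ᶠ N in atTop, ∀ ω, ph N ω ≠ 0 → ph N ω * (th N ω - θ) = s N ω + R N ω)
    (hp : IsSmallOP P (fun N ω => ph N ω - p))
    (hv : IsSmallOP P (fun N ω => v (ph N ω) - v p))
    (hv2 : IsSmallOP P (fun N ω => √(N : ℝ) * (v (ph N ω) - v p - v' * (ph N ω - p))))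
    (hs : IsBddOP P (fun N ω => √(N : ℝ) * s N ω))
    (hR : IsSmallOP P (fun N ω => √(N : ℝ) * R N ω)) :
    IsSmallOP P (fun N ω => √(N : ℝ) * (v (ph N ω) * th N ω - v p * θ) -
      √(N : ℝ) * (v p / p * s N ω + v' * (ph N ω - p) * θ)) := by
  have ha : IsSmallOP P (fun N ω => v (ph N ω) * (ph N ω)⁻¹ - v p * p⁻¹) :=
    hv.mul_tendsto (hp.comp_continuousAt (continuousAt_inv₀ hp0.ne'))
  -- From `v(p̂) θ̃ - v(p) θ = (v(p̂) / p̂) (s + R) + (v(p̂) - v(p)) θ`, the remainder has three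
  -- parts: the error in `v(p̂) / p̂` times `s`, the term in `R`, and the Taylor remainder times
  -- `θ`.
  have h1 := ((ha.mul_isBddOP hs).add (hR.mul_isBddOP (isBddOP_of_tendsto ha))).add
    (hv2.const_mul θ)
  -- The identity can fail only at `p̂ = 0`, whose probability vanishes because `p > 0`.
  have h0 := hp.eventually_lt hp0
  refine h1.of_ne_tendsto (tendsto_of_tendsto_of_tendsto_of_le_of_le' tendsto_const_nhds h0
    (Eventually.of_forall fun _ => zero_le) ?_)
  filter_upwards [hth] with N hN
  refine measure_mono fun ω hω => ?_
  by_contra hc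
  have hne : ph N ω ≠ 0 := fun h => hc (show ph N ω ≤ 0 from h.le)
  refine hω ?_
  have h2 := hN ω hne
  have h3 : th N ω = θ + (s N ω + R N ω) * (ph N ω)⁻¹ := by
    field_simp
    linarith
  simp only [h3]
  field_simp
  ring

/-- The Taylor remainder is `p̂ - p` times the increment of `dslope v p`, which is continuous at `p`
exactly when `v` is differentiable there. -/
theorem isSmallOP_dslope {p : ℝ} {v : ℝ → ℝ} (hv : DifferentiableAt ℝ v p) {ph : ℕ → Ω → ℝ}
    (hp : IsSmallOP P (fun N ω => ph N ω - p))
    (hb : IsBddOP P (fun N ω => √(N : ℝ) * (ph N ω - p))) :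
    IsSmallOP P (fun N ω => √(N : ℝ) * (v (ph N ω) - v p - deriv v p * (ph N ω - p))) := by
  have h1 := (hp.comp_continuousAt (continuousAt_dslope_same.2 hv)).mul_isBddOP hb
  refine h1.congr (Eventually.of_forall fun N => ae_of_all _ fun ω => ?_)
  have h2 := sub_smul_dslope v p (ph N ω)
  rw [smul_eq_mul] at h2
  rw [dslope_same, ← h2]
  ring

end Linearization

/-! ### Mean squares of triangular arrays -/

section MeanSquare

variable {Ω : Type*} [MeasurableSpace Ω] {P : Measure Ω} {x y : (N : ℕ) → Fin N → Ω → ℝ}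

/-- The mean square of a triangular array. -/
def meanSq (x : (N : ℕ) → Fin N → Ω → ℝ) (N : ℕ) (ω : Ω) : ℝ := (N : ℝ)⁻¹ * ∑ i, x N i ω ^ 2

omit [MeasurableSpace Ω] in
theorem meanSq_nonneg (N : ℕ) (ω : Ω) : 0 ≤ meanSq x N ω := by
  unfold meanSq; positivity

theorem isSmallOP_meanSq_add (hx : IsSmallOP P (meanSq x)) (hy : IsSmallOP P (meanSq y)) :
    IsSmallOP P (meanSq fun N i ω => x N i ω + y N i ω) := by
  refine ((hx.const_mul 2).add (hy.const_mul 2)).of_le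
    (Eventually.of_forall fun N => ae_of_all _ fun ω => ?_)
  rw [abs_of_nonneg (meanSq_nonneg _ _), abs_of_nonneg
    (by have := meanSq_nonneg (x := x) N ω; have := meanSq_nonneg (x := y) N ω; positivity)]
  have h : ∑ i, (x N i ω + y N i ω) ^ 2 ≤ 2 * ∑ i, x N i ω ^ 2 + 2 * ∑ i, y N i ω ^ 2 := by
    rw [Finset.mul_sum, Finset.mul_sum, ← Finset.sum_add_distrib]
    exact Finset.sum_le_sum fun i _ => by nlinarith [sq_nonneg (x N i ω - y N i ω)]
  calc (N : ℝ)⁻¹ * ∑ i, (x N i ω + y N i ω) ^ 2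
      ≤ (N : ℝ)⁻¹ * (2 * ∑ i, x N i ω ^ 2 + 2 * ∑ i, y N i ω ^ 2) :=
        mul_le_mul_of_nonneg_left h (by positivity)
    _ = 2 * meanSq x N ω + 2 * meanSq y N ω := by unfold meanSq; ring

theorem isSmallOP_meanSq_sum {ι : Type*} {s : Finset ι} {z : ι → (N : ℕ) → Fin N → Ω → ℝ}
    (h : ∀ k ∈ s, IsSmallOP P (meanSq (z k))) :
    IsSmallOP P (meanSq fun N i ω => ∑ k ∈ s, z k N i ω) := by
  classical
  induction s using Finset.induction_on with
  | empty =>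
    simp only [Finset.sum_empty]
    refine isSmallOP_zero.congr (Eventually.of_forall fun N => ae_of_all _ fun ω => ?_)
    simp [meanSq]
  | insert a s ha ih =>
    simp only [Finset.sum_insert ha]
    exact isSmallOP_meanSq_add (h a (Finset.mem_insert_self a s))
      (ih fun i hi => h i (Finset.mem_insert_of_mem hi))

omit [MeasurableSpace Ω] in
theorem meanSq_mul (c : ℕ → Ω → ℝ) (N : ℕ) (ω : Ω) :
    meanSq (fun N i ω => c N ω * x N i ω) N ω = c N ω ^ 2 * meanSq x N ω := by
  simp only [meanSq, mul_pow, ← Finset.mul_sum]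
  ring

theorem isSmallOP_meanSq_smul_left {c : ℕ → Ω → ℝ} (hc : IsSmallOP P c)
    (hx : IsBddOP P (meanSq x)) : IsSmallOP P (meanSq fun N i ω => c N ω * x N i ω) := by
  refine ((hc.mul hc).mul_isBddOP hx).congr
    (Eventually.of_forall fun N => ae_of_all _ fun ω => ?_)
  rw [meanSq_mul, sq]

theorem isSmallOP_meanSq_smul_right {c : ℕ → Ω → ℝ} (hc : IsBddOP P c)
    (hx : IsSmallOP P (meanSq x)) : IsSmallOP P (meanSq fun N i ω => c N ω * x N i ω) := by
  refine ((hx.mul_isBddOP hc).mul_isBddOP hc).congr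
    (Eventually.of_forall fun N => ae_of_all _ fun ω => ?_)
  rw [meanSq_mul]
  ring

theorem isBddOP_meanSq_of_abs_le_one (hx : ∀ N i ω, |x N i ω| ≤ 1) : IsBddOP P (meanSq x) := by
  intro ε hε
  refine ⟨1, Eventually.of_forall fun N => ?_⟩
  have : {ω | 1 < |meanSq x N ω|} = ∅ := by
    ext ω
    simp only [Set.mem_ofPred_eq, Set.mem_empty_iff_false, iff_false, not_lt]
    rw [abs_of_nonneg (meanSq_nonneg _ _)]
    have h : ∑ i, x N i ω ^ 2 ≤ N := by
      have := Finset.sum_le_card_nsmul Finset.univ (fun i => x N i ω ^ 2) 1 fun i _ => by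
        rw [← sq_abs]; exact pow_le_one₀ (abs_nonneg _) (hx N i ω)
      simpa using this
    calc meanSq x N ω ≤ (N : ℝ)⁻¹ * N := mul_le_mul_of_nonneg_left h (by positivity)
      _ ≤ 1 := inv_mul_le_one
  rw [this, measure_empty]
  exact zero_le

/-- Expand `y = x + (y - x)`: by Cauchy–Schwarz the squared cross term is at most the product of a
bounded and a vanishing mean square. -/
theorem isSmallOP_meanSq_sub {σ : ℝ} (hx : IsSmallOP P (fun N ω => meanSq x N ω - σ))
    (hxy : IsSmallOP P (meanSq fun N i ω => y N i ω - x N i ω)) :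
    IsSmallOP P (fun N ω => meanSq y N ω - σ) := by
  have hcross : IsSmallOP P
      (fun N ω => (N : ℝ)⁻¹ * ∑ i, x N i ω * (y N i ω - x N i ω)) := by
    refine isSmallOP_of_sq ((hxy.mul_isBddOP (isBddOP_of_tendsto hx)).of_le
      (Eventually.of_forall fun N => ae_of_all _ fun ω => ?_))
    rw [abs_of_nonneg (sq_nonneg _), abs_of_nonneg
      (mul_nonneg (meanSq_nonneg _ _) (meanSq_nonneg _ _)), mul_pow]
    have h := Finset.sum_mul_sq_le_sq_mul_sq Finset.univ (fun i => x N i ω)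
      (fun i => y N i ω - x N i ω)
    calc (N : ℝ)⁻¹ ^ 2 * (∑ i, x N i ω * (y N i ω - x N i ω)) ^ 2
        ≤ (N : ℝ)⁻¹ ^ 2 * ((∑ i, x N i ω ^ 2) * ∑ i, (y N i ω - x N i ω) ^ 2) :=
          mul_le_mul_of_nonneg_left h (by positivity)
      _ = _ := by unfold meanSq; ring
  refine ((hx.add hxy).add (hcross.const_mul 2)).congr
    (Eventually.of_forall fun N => ae_of_all _ fun ω => ?_)
  have h : ∑ i, y N i ω ^ 2 = ∑ i, x N i ω ^ 2 + ∑ i, (y N i ω - x N i ω) ^ 2 +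
      2 * ∑ i, x N i ω * (y N i ω - x N i ω) := by
    rw [Finset.mul_sum, ← Finset.sum_add_distrib, ← Finset.sum_add_distrib]
    exact Finset.sum_congr rfl fun i _ => by ring
  simp only [meanSq, h]
  ring

end MeanSquare

/-! ### Limit theorems for functions of the observed clusters -/

section LimitTheorems

variable {K : ℕ} {M d : Fin K → ℕ} {𝓜 : Model M d} {Ω : Type*} [MeasurableSpace Ω]
  {P : Measure Ω} {W : ℕ → Ω → Cluster M d}
  (hW_meas : ∀ i, Measurable (W i)) (hW_law : ∀ i, P.map (W i) = 𝓜.clusterLaw)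
  (hW_indep : iIndepFun W P) {h : ObsCluster M d → ℝ} (hh : Measurable h)

include hW_meas

theorem measurable_obs_comp (i : ℕ) : Measurable fun ω => obs (W i ω) :=
  measurable_obs.comp (hW_meas i)

include hh

theorem measurable_comp_obs (i : ℕ) : Measurable fun ω => h (obs (W i ω)) :=
  hh.comp (measurable_obs_comp hW_meas i)

include hW_law

theorem integral_comp_obs (i : ℕ) : ∫ ω, h (obs (W i ω)) ∂P = ∫ o, h o ∂𝓜.obsLaw := by
  rw [← map_obs hW_meas hW_law i, integral_map (measurable_obs_comp hW_meas i).aemeasurable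
    hh.aestronglyMeasurable]

theorem memLp_comp_obs {q : ENNReal} (i : ℕ) (hq : MemLp h q 𝓜.obsLaw) :
    MemLp (fun ω => h (obs (W i ω))) q P := by
  rw [← map_obs hW_meas hW_law i] at hq
  exact (memLp_map_measure_iff hh.aestronglyMeasurable
    (measurable_obs_comp hW_meas i).aemeasurable).1 hq

theorem identDistrib_comp_obs (i : ℕ) :
    IdentDistrib (fun ω => h (obs (W i ω))) (fun ω => h (obs (W 0 ω))) P P := by
  have h1 : ∀ j, P.map (fun ω => h (obs (W j ω))) = 𝓜.obsLaw.map h := fun j => by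
    rw [← map_obs hW_meas hW_law j, Measure.map_map hh (measurable_obs_comp hW_meas j)]
    rfl
  exact ⟨(measurable_comp_obs hW_meas hh i).aemeasurable,
    (measurable_comp_obs hW_meas hh 0).aemeasurable, (h1 i).trans (h1 0).symm⟩

theorem variance_comp_obs (i : ℕ) :
    Var[fun ω => h (obs (W i ω)); P] = Var[h; 𝓜.obsLaw] := by
  rw [← map_obs hW_meas hW_law i, variance_map hh.aemeasurable
    (measurable_obs_comp hW_meas i).aemeasurable]
  rfl

include hW_indep

omit hW_meas hW_law in
theorem iIndepFun_comp_obs : iIndepFun (fun i ω => h (obs (W i ω))) P :=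
  hW_indep.comp (fun _ z => h (obs z)) fun _ => hh.comp measurable_obs

variable [IsProbabilityMeasure P]

/-- The central limit theorem for functions of the observed data. -/
theorem tendstoInDistribution_sum_obs (hL2 : MemLp h 2 𝓜.obsLaw) (h0 : ∫ o, h o ∂𝓜.obsLaw = 0) :
    TendstoInDistribution (fun (N : ℕ) ω => (√(N : ℝ))⁻¹ * ∑ i : Fin N, h (obs (W i ω))) atTop
      (id : ℝ → ℝ) (fun _ => P) (gaussianReal 0 (Var[h; 𝓜.obsLaw]).toNNReal) := by
  have hclt := tendstoInDistribution_inv_sqrt_mul_sum_sub (P := P)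
    (P' := gaussianReal 0 (Var[h; 𝓜.obsLaw]).toNNReal) (Y := id)
    (X := fun i ω => h (obs (W i ω)))
    (by rw [variance_comp_obs hW_meas hW_law hh]; exact HasLaw.id)
    (memLp_comp_obs hW_meas hW_law hh 0 hL2) (iIndepFun_comp_obs hW_indep hh)
    (identDistrib_comp_obs hW_meas hW_law hh)
  refine hclt.congr (fun N => ae_of_all _ fun ω => ?_) (ae_eq_refl _)
  simp only [integral_comp_obs hW_meas hW_law hh, h0, mul_zero, sub_zero]
  rw [Finset.sum_range]

/-- The second moment of the normalised sum is at most the variance of one term; Markov's inequality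
concludes. -/
theorem isBddOP_sum_obs (hL2 : MemLp h 2 𝓜.obsLaw) (h0 : ∫ o, h o ∂𝓜.obsLaw = 0) :
    IsBddOP P (fun (N : ℕ) ω => (√(N : ℝ))⁻¹ * ∑ i : Fin N, h (obs (W i ω))) := by
  have hmem : ∀ N : ℕ, MemLp (fun ω => ∑ i : Fin N, h (obs (W i ω))) 2 P := fun N =>
    memLp_finsetSum _ fun i _ => memLp_comp_obs hW_meas hW_law hh i hL2
  refine isBddOP_of_sq (isBddOP_of_integral_le (B := Var[h; 𝓜.obsLaw]) ?_ ?_)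
  · exact Eventually.of_forall fun N => ((hmem N).const_mul _).integrable_sq
  · refine Eventually.of_forall fun N => ?_
    have hsum : ∫ ω, ∑ i : Fin N, h (obs (W i ω)) ∂P = 0 := by
      rw [integral_finsetSum Finset.univ (f := fun (i : Fin N) ω => h (obs (W i ω))) fun i _ =>
        (memLp_comp_obs hW_meas hW_law hh i hL2).integrable one_le_two]
      exact Finset.sum_eq_zero fun i _ => by rw [integral_comp_obs hW_meas hW_law hh, h0]
    have hvar : ∫ ω, (∑ i : Fin N, h (obs (W i ω))) ^ 2 ∂P = N * Var[h; 𝓜.obsLaw] := by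
      rw [← variance_of_integral_eq_zero (hmem N).aestronglyMeasurable.aemeasurable hsum]
      have hv := IndepFun.variance_sum (μ := P) (s := Finset.univ)
        (X := fun (i : Fin N) ω => h (obs (W i ω)))
        (fun i _ => memLp_comp_obs hW_meas hW_law hh i hL2)
        (fun i _ j _ hij => (iIndepFun_comp_obs hW_indep hh).indepFun
          (fun hc => hij (Fin.ext hc)))
      simp only [variance_comp_obs hW_meas hW_law hh, Finset.sum_const, Finset.card_univ,
        Fintype.card_fin, nsmul_eq_mul] at hv
      rw [← hv]
      congr 1
      funext ω
      simp
    have habs : ∀ x : ℝ, |x ^ 2| = x ^ 2 := fun x => abs_of_nonneg (sq_nonneg x)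
    simp only [habs]
    simp only [mul_pow, inv_pow, Real.sq_sqrt (Nat.cast_nonneg N)]
    rw [integral_const_mul, hvar, ← mul_assoc]
    exact mul_le_of_le_one_left (variance_nonneg _ _) inv_mul_le_one

/-- The weak law of large numbers for functions of the observed data. -/
theorem isSmallOP_mean_obs (hint : Integrable h 𝓜.obsLaw) :
    IsSmallOP P (fun (N : ℕ) ω => (N : ℝ)⁻¹ * ∑ i : Fin N, h (obs (W i ω)) -
      ∫ o, h o ∂𝓜.obsLaw) := by
  have hint' := memLp_comp_obs hW_meas hW_law hh 0 (memLp_one_iff_integrable.2 hint)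
  have hlln := strong_law_ae_real (μ := P) (fun i ω => h (obs (W i ω)))
    (memLp_one_iff_integrable.1 hint')
    (fun i j hij => (iIndepFun_comp_obs hW_indep hh).indepFun hij)
    (identDistrib_comp_obs hW_meas hW_law hh)
  rw [integral_comp_obs hW_meas hW_law hh] at hlln
  rw [← tendstoInMeasure_iff_isSmallOP]
  refine tendstoInMeasure_of_tendsto_ae (fun N => ?_) ?_
  · exact ((Finset.measurable_sum Finset.univ fun (i : Fin N) _ =>
      measurable_comp_obs hW_meas hh (i : ℕ)).const_mul (N : ℝ)⁻¹).aestronglyMeasurable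
  · filter_upwards [hlln] with ω hω
    refine hω.congr fun N => ?_
    rw [Finset.sum_range, div_eq_inv_mul]

end LimitTheorems

/-! ### The estimators as sample means -/

section SampleIdentities

variable {K : ℕ} {M d : Fin K → ℕ}

theorem typeCount_eq_sum {N : ℕ} (o : Fin N → ObsCluster M d) (k : Fin K) :
    (typeCount o k : ℝ) = ∑ i, typeInd k (o i) := by
  simp [typeCount, typeInd]

theorem pHat_eq_mean {N : ℕ} (o : Fin N → ObsCluster M d) (k : Fin K) :
    pHat o k = (N : ℝ)⁻¹ * ∑ i, typeInd k (o i) := by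
  rw [pHat, typeCount_eq_sum, div_eq_inv_mul]

theorem typeInd_mul_score (w : VecFun M d) (e : ScalarFun M d) (g : VecFun M d) (k : Fin K)
    (o : ObsCluster M d) : typeInd k o * score w e g k o = score w e g k o := by
  unfold typeInd score
  split_ifs <;> simp

theorem abs_typeInd_le_one (k : Fin K) (o : ObsCluster M d) : |typeInd k o| ≤ 1 := by
  unfold typeInd
  split_ifs <;> simp

/-- Each `v_k` is smooth only on the open unit interval. The endpoint `1` is reached only with a
single type, and then the empirical frequency is exact and nothing has to be expanded. -/
theorem Model.p_lt_one_or (𝓜 : Model M d) (k : Fin K) :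
    𝓜.p k < 1 ∨ 𝓜.p k = 1 ∧
      ∀ (N : ℕ), 0 < N → ∀ o : Fin N → ObsCluster M d, pHat o k = 1 := by
  by_cases h : ∃ j, j ≠ k
  · obtain ⟨j, hj⟩ := h
    left
    have h1 : 𝓜.p k + 𝓜.p j ≤ ∑ k, 𝓜.p k := by
      rw [← Finset.sum_pair hj.symm]
      exact Finset.sum_le_sum_of_subset_of_nonneg (Finset.subset_univ _)
        fun i _ _ => (𝓜.p_pos i).le
    rw [𝓜.p_sum] at h1
    linarith [𝓜.p_pos j]
  · right
    push Not at h
    refine ⟨?_, fun N hN o => ?_⟩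
    · rw [← 𝓜.p_sum]
      exact (Fintype.sum_eq_single k fun j hj => absurd (h j) hj).symm
    · have hN' : (N : ℝ) ≠ 0 := by positivity
      rw [pHat_eq_mean]
      simp [typeInd, h, hN']

namespace CrossFit

variable {𝒰 : Type*} [MeasurableSpace 𝒰] (S : CrossFit M d 𝒰)

/-- The score of cluster `i` with the outcome regression cross-fitted for its fold. -/
def crossScore (w : VecFun M d) (e : ScalarFun M d) {N : ℕ} (u : 𝒰)
    (o : Fin N → ObsCluster M d) (k : Fin K) (i : Fin N) : ℝ :=
  score w e (S.gTilde u o (S.split N u (fun j => (o j).1) i)) k (o i)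

theorem typeInd_mul_crossScore (w : VecFun M d) (e : ScalarFun M d) {N : ℕ} (u : 𝒰)
    (o : Fin N → ObsCluster M d) (k : Fin K) (i : Fin N) :
    typeInd k (o i) * S.crossScore w e u o k i = S.crossScore w e u o k i :=
  typeInd_mul_score _ _ _ _ _

theorem thetaTilde_eq (w : VecFun M d) (e : ScalarFun M d) {N : ℕ} (u : 𝒰)
    (o : Fin N → ObsCluster M d) (k : Fin K) :
    S.thetaTilde w e u o k = (∑ i, S.crossScore w e u o k i) / typeCount o k := by
  rw [thetaTilde, S.sum_fold u o fun ℓ i => score w e (S.gTilde u o ℓ) k (o i)]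
  rfl

theorem thetaTilde_eq_mean (w : VecFun M d) (e : ScalarFun M d) {N : ℕ} (hN : 0 < N) (u : 𝒰)
    (o : Fin N → ObsCluster M d) (k : Fin K) :
    S.thetaTilde w e u o k = ((N : ℝ)⁻¹ * ∑ i, S.crossScore w e u o k i) * (pHat o k)⁻¹ := by
  have hN' : (N : ℝ) ≠ 0 := by positivity
  rw [thetaTilde_eq, pHat, inv_div, div_eq_mul_inv, div_eq_mul_inv]
  field_simp

theorem sigmaSqTilde_eq (w : VecFun M d) (v : Fin K → ℝ → ℝ) (e : ScalarFun M d) {N : ℕ} (u : 𝒰)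
    (o : Fin N → ObsCluster M d) :
    S.sigmaSqTilde w v e u o = (N : ℝ)⁻¹ * ∑ i, (∑ k, (v k (pHat o k) * (pHat o k)⁻¹ *
        (S.crossScore w e u o k i - typeInd k (o i) * S.thetaTilde w e u o k)
      + (typeInd k (o i) - pHat o k) * deriv (v k) (pHat o k) *
        S.thetaTilde w e u o k)) ^ 2 := by
  rw [sigmaSqTilde, S.sum_fold u o fun ℓ i =>
    (∑ k, (typeInd k (o i) * v k (pHat o k) / pHat o k *
        (score w e (S.gTilde u o ℓ) k (o i) - S.thetaTilde w e u o k)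
      + (typeInd k (o i) - pHat o k) * deriv (v k) (pHat o k) * S.thetaTilde w e u o k)) ^ 2,
    one_div]
  congr 1
  refine Finset.sum_congr rfl fun i _ => ?_
  congr 1
  refine Finset.sum_congr rfl fun k _ => ?_
  congr 1
  have h := S.typeInd_mul_crossScore w e u o k i
  unfold crossScore at h ⊢
  linear_combination (v k (pHat o k) * (pHat o k)⁻¹) * h

variable {𝓜 : Model M d} {w gLim : VecFun M d} {C : ℝ} {N : ℕ} {k : Fin K}

/-- Only the fold containing `i` contributes, and the truncation is inactive on bounded fits. Having
a single nonzero term also gives the version for squares. -/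
theorem crossScore_sub_eq_sum {u : 𝒰} {o : Fin N → ObsCluster M d}
    (h : ∀ ℓ, (u, o) ∈ S.boundedFit 𝓜 C N ℓ k) (i : Fin N) :
    S.crossScore w 𝓜.propensity u o k i - score w 𝓜.propensity gLim k (o i) =
      ∑ ℓ, S.foldDiff 𝓜 w gLim C ℓ k i (u, o) (o i) := by
  rw [Finset.sum_eq_single (S.split N u (fun j => (o j).1) i)]
  · rw [foldDiff, if_pos ⟨(S.mem_fold).2 rfl, h _⟩]
    rfl
  · intro ℓ _ hℓ
    exact S.foldDiff_of_notMem fun hc => hℓ ((S.mem_fold).1 hc).symm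
  · simp

theorem crossScore_sub_sq_eq_sum {u : 𝒰} {o : Fin N → ObsCluster M d}
    (h : ∀ ℓ, (u, o) ∈ S.boundedFit 𝓜 C N ℓ k) (i : Fin N) :
    (S.crossScore w 𝓜.propensity u o k i - score w 𝓜.propensity gLim k (o i)) ^ 2 =
      ∑ ℓ, S.foldDiff 𝓜 w gLim C ℓ k i (u, o) (o i) ^ 2 := by
  rw [Finset.sum_eq_single (S.split N u (fun j => (o j).1) i)]
  · rw [foldDiff, if_pos ⟨(S.mem_fold).2 rfl, h _⟩]
    rfl
  · intro ℓ _ hℓ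
    rw [S.foldDiff_of_notMem fun hc => hℓ ((S.mem_fold).1 hc).symm, zero_pow two_ne_zero]
  · simp

theorem measurable_crossScore (hw : ∀ a, Measurable (w k a)) (i : Fin N) :
    Measurable fun v : 𝒰 × (Fin N → ObsCluster M d) =>
      S.crossScore w 𝓜.propensity v.1 v.2 k i := by
  have h1 : Measurable fun r : Fin 2 × (𝒰 × (Fin N → ObsCluster M d)) =>
      score w 𝓜.propensity (S.gTilde r.2.1 r.2.2 r.1) k (r.2.2 i) := by
    refine measurable_from_prod_countable_right fun ℓ => ?_
    have h2 : Measurable fun q : (𝒰 × (Fin N → ObsCluster M d)) × ObsCluster M d =>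
        score w 𝓜.propensity (S.gTilde q.1.1 q.1.2 ℓ) k q.2 :=
      measurable_score (G := fun v : 𝒰 × (Fin N → ObsCluster M d) => S.gTilde v.1 v.2 ℓ) hw
        (measurable_propensity k) (S.measurable_gTilde N ℓ k)
    have h3 : Measurable fun v : 𝒰 × (Fin N → ObsCluster M d) => (v, v.2 i) :=
      measurable_id.prodMk ((measurable_pi_apply i).comp measurable_snd)
    have h4 := h2.comp h3
    simp only [Function.comp_def] at h4
    exact h4
  have h5 : Measurable fun v : 𝒰 × (Fin N → ObsCluster M d) =>
      (S.split N v.1 (fun j => (v.2 j).1) i, v) :=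
    ((measurable_pi_apply i).comp (S.measurable_split_types N)).prodMk measurable_id
  have h6 := h1.comp h5
  simp only [Function.comp_def] at h6
  exact h6

theorem measurable_tauTilde (hw : ∀ k a, Measurable (w k a)) (v : Fin K → ℝ → ℝ) :
    Measurable fun q : 𝒰 × (Fin N → ObsCluster M d) =>
      S.tauTilde w v 𝓜.propensity q.1 q.2 := by
  have hcount : ∀ k, Measurable fun q : 𝒰 × (Fin N → ObsCluster M d) => typeCount q.2 k := by
    intro k
    have h : ∀ o : Fin N → ObsCluster M d, typeCount o k =
        ∑ i, if (o i).1 = k then 1 else 0 := fun o => by simp [typeCount]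
    simp_rw [h]
    refine Finset.measurable_sum _ fun i _ => ?_
    have hi : Measurable fun q : 𝒰 × (Fin N → ObsCluster M d) => q.2 i :=
      (measurable_pi_apply i).comp measurable_snd
    exact Measurable.ite (hi (measurableSet_type k)) measurable_const measurable_const
  unfold tauTilde
  refine Finset.measurable_sum _ fun k _ => ?_
  simp_rw [thetaTilde_eq, pHat]
  refine Measurable.mul ?_ (Measurable.div ?_ ?_)
  -- `v k` is controlled only on the open interval, but here it is a function of an integer count,
  -- hence measurable.
  · exact (measurable_of_countable fun n : ℕ => v k ((n : ℝ) / N)).comp (hcount k)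
  · exact Finset.measurable_sum _ fun i _ => S.measurable_crossScore (hw k) i
  · exact (measurable_of_countable fun n : ℕ => (n : ℝ)).comp (hcount k)

end CrossFit

end SampleIdentities

/-! ### The influence function: moments and relation to `δ'` -/

section Influence

variable {K : ℕ} {M d : Fin K → ℕ} {𝓜 : Model M d} {w gLim : VecFun M d} {k : Fin K}

theorem integral_typeInd (k : Fin K) : ∫ o, typeInd k o ∂𝓜.obsLaw = 𝓜.p k := by
  have hi : ∀ j, Integrable (fun z : FullData (M j) (d j) =>
      typeInd k (⟨j, z.2⟩ : ObsCluster M d)) (𝓜.law j) := fun j => by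
    by_cases hj : j = k <;> simp [typeInd, hj]
  rw [integral_obsLaw 𝓜 (measurable_typeInd k) hi, Finset.sum_eq_single k]
  · simp [typeInd]
  · intro j _ hj
    simp [typeInd, hj]
  · simp

theorem memLp_typeInd (k : Fin K) : MemLp (typeInd k) 2 𝓜.obsLaw :=
  MemLp.of_bound (measurable_typeInd k).aestronglyMeasurable 1
    (ae_of_all _ fun o => abs_typeInd_le_one k o)

theorem memLp_score (hm : Measurable (score w 𝓜.propensity gLim k))
    (h : MemLp (fun z => scoreCore w 𝓜.propensity gLim k z.2) 2 (𝓜.law k)) :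
    MemLp (score w 𝓜.propensity gLim k) 2 𝓜.obsLaw := by
  rw [memLp_two_iff_integrable_sq hm.aestronglyMeasurable]
  refine integrable_obsLaw 𝓜 (hm.pow_const 2) fun j => ?_
  by_cases hj : j = k
  · subst hj
    simpa [score] using h.integrable_sq
  · simp [score, hj]

theorem integral_score (hm : Measurable (score w 𝓜.propensity gLim k))
    (h : MemLp (fun z => scoreCore w 𝓜.propensity gLim k z.2) 2 (𝓜.law k))
    (h' : ∫ z, scoreCore w 𝓜.propensity gLim k z.2 ∂(𝓜.law k) = 𝓜.theta w k) :
    ∫ o, score w 𝓜.propensity gLim k o ∂𝓜.obsLaw = 𝓜.p k * 𝓜.theta w k := by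
  rw [integral_obsLaw 𝓜 hm, Finset.sum_eq_single k]
  · simp [score, h']
  · intro j _ hj
    simp [score, hj]
  · simp
  · intro j
    by_cases hj : j = k
    · subst hj
      simpa [score] using h.integrable one_le_two
    · simp [score, hj]

/-- The contribution of the clusters of type `k` to the influence function of `τ̃`. -/
def influence (𝓜 : Model M d) (w : VecFun M d) (v : Fin K → ℝ → ℝ) (g : VecFun M d) (k : Fin K)
    (o : ObsCluster M d) : ℝ :=
  v k (𝓜.p k) * (𝓜.p k)⁻¹ * (score w 𝓜.propensity g k o - typeInd k o * 𝓜.theta w k) +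
    (typeInd k o - 𝓜.p k) * deriv (v k) (𝓜.p k) * 𝓜.theta w k

theorem delta_eq (v : Fin K → ℝ → ℝ) (o : ObsCluster M d) :
    𝓜.delta w v gLim o = ∑ k, influence 𝓜 w v gLim k o + 𝓜.tau w v := by
  unfold Model.delta
  congr 1
  refine Finset.sum_congr rfl fun k _ => ?_
  unfold influence
  rw [mul_sub, typeInd_mul_score, div_eq_mul_inv]
  ring

theorem measurable_influence (v : Fin K → ℝ → ℝ)
    (hm : Measurable (score w 𝓜.propensity gLim k)) : Measurable (influence 𝓜 w v gLim k) := by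
  have := measurable_typeInd (M := M) (d := d) k
  unfold influence
  fun_prop

theorem memLp_influence (v : Fin K → ℝ → ℝ)
    (h : MemLp (score w 𝓜.propensity gLim k) 2 𝓜.obsLaw) :
    MemLp (influence 𝓜 w v gLim k) 2 𝓜.obsLaw := by
  have ht := memLp_typeInd (𝓜 := 𝓜) k
  refine MemLp.add ((h.sub (ht.mul_const _)).const_mul _) ?_
  exact ((ht.sub (memLp_const _)).mul_const _).mul_const _

theorem integral_influence (v : Fin K → ℝ → ℝ)
    (h : MemLp (score w 𝓜.propensity gLim k) 2 𝓜.obsLaw)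
    (h' : ∫ o, score w 𝓜.propensity gLim k o ∂𝓜.obsLaw = 𝓜.p k * 𝓜.theta w k) :
    ∫ o, influence 𝓜 w v gLim k o ∂𝓜.obsLaw = 0 := by
  have ht := (memLp_typeInd (𝓜 := 𝓜) k).integrable one_le_two
  have hs := h.integrable one_le_two
  have hts : Integrable (fun o => typeInd k o * 𝓜.theta w k) 𝓜.obsLaw := ht.mul_const _
  have htp : Integrable (fun o => typeInd k o - 𝓜.p k) 𝓜.obsLaw := ht.sub (integrable_const _)
  have hst : Integrable (fun o => score w 𝓜.propensity gLim k o - typeInd k o * 𝓜.theta w k)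
      𝓜.obsLaw := hs.sub hts
  unfold influence
  rw [integral_add (hst.const_mul _) ((htp.mul_const _).mul_const _),
    integral_const_mul, integral_sub hs hts, integral_mul_const, integral_mul_const,
    integral_mul_const, integral_sub ht (integrable_const _), h', integral_typeInd]
  simp

end Influence

/-! ### Empirical type frequencies -/

section Asymptotics

variable {K : ℕ} {M d : Fin K → ℕ} {𝓜 : Model M d} {Ω : Type*} [MeasurableSpace Ω]
  {P : Measure Ω} [IsProbabilityMeasure P] {W : ℕ → Ω → Cluster M d}

theorem sqrt_mul_inv_mul (N : ℕ) (x : ℝ) : √(N : ℝ) * ((N : ℝ)⁻¹ * x) = (√(N : ℝ))⁻¹ * x := by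
  rcases Nat.eq_zero_or_pos N with h | h
  · simp [h]
  · have h1 : (0 : ℝ) < N := Nat.cast_pos.2 h
    have h2 : √(N : ℝ) ≠ 0 := (Real.sqrt_pos.2 h1).ne'
    have h3 : (N : ℝ)⁻¹ = (√(N : ℝ))⁻¹ * (√(N : ℝ))⁻¹ := by
      rw [← mul_inv, Real.mul_self_sqrt h1.le]
    rw [h3]
    field_simp

omit [IsProbabilityMeasure P] in
theorem isSmallOP_inv_mul_of_inv_sqrt_mul {X : ℕ → Ω → ℝ}
    (h : IsSmallOP P (fun N ω => (√(N : ℝ))⁻¹ * X N ω)) :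
    IsSmallOP P (fun N ω => (N : ℝ)⁻¹ * X N ω) := by
  refine h.of_le ?_
  filter_upwards [eventually_ge_atTop 1] with N hN
  refine ae_of_all _ fun ω => ?_
  have h1 : (1 : ℝ) ≤ N := by exact_mod_cast hN
  rw [abs_mul, abs_mul, abs_of_nonneg (show 0 ≤ (N : ℝ)⁻¹ by positivity),
    abs_of_nonneg (show 0 ≤ (√(N : ℝ))⁻¹ by positivity)]
  refine mul_le_mul_of_nonneg_right (inv_anti₀ (Real.sqrt_pos.2 (by linarith)) ?_) (abs_nonneg _)
  rw [Real.sqrt_le_left (by linarith)]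
  nlinarith

section Frequencies

variable (hW_meas : ∀ i, Measurable (W i)) (hW_law : ∀ i, P.map (W i) = 𝓜.clusterLaw)
  (hW_indep : iIndepFun W P)

include hW_meas hW_law hW_indep

theorem isSmallOP_pHat (k : Fin K) :
    IsSmallOP P (fun N ω => pHat (sample W N ω) k - 𝓜.p k) := by
  have h := isSmallOP_mean_obs hW_meas hW_law hW_indep (measurable_typeInd k)
    ((memLp_typeInd (𝓜 := 𝓜) k).integrable one_le_two)
  rw [integral_typeInd] at h
  simp_rw [pHat_eq_mean]
  exact h

theorem isBddOP_sqrt_mul_pHat (k : Fin K) :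
    IsBddOP P (fun N ω => √(N : ℝ) * (pHat (sample W N ω) k - 𝓜.p k)) := by
  have ht := memLp_typeInd (𝓜 := 𝓜) k
  have hm : Measurable fun o : ObsCluster M d => typeInd k o - 𝓜.p k :=
    (measurable_typeInd k).sub_const _
  have h := isBddOP_sum_obs hW_meas hW_law hW_indep hm (ht.sub (memLp_const _)) (by
    rw [integral_sub (ht.integrable one_le_two) (integrable_const _), integral_typeInd]
    simp)
  refine h.congr ?_
  filter_upwards [eventually_gt_atTop 0] with N hN
  intro ω
  have hN' : (N : ℝ) ≠ 0 := by positivity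
  rw [pHat_eq_mean, ← sqrt_mul_inv_mul]
  congr 1
  rw [Finset.sum_sub_distrib]
  simp only [Finset.sum_const, Finset.card_univ, Fintype.card_fin, nsmul_eq_mul]
  field_simp

theorem isSmallOP_comp_pHat {v : Fin K → ℝ → ℝ}
    (hv : ∀ k, ContDiffOn ℝ 1 (v k) (Set.Ioo 0 1)) (k : Fin K) :
    IsSmallOP P (fun N ω => v k (pHat (sample W N ω) k) - v k (𝓜.p k)) ∧
    IsSmallOP P (fun N ω => deriv (v k) (pHat (sample W N ω) k) - deriv (v k) (𝓜.p k)) ∧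
    IsSmallOP P (fun N ω => √(N : ℝ) * (v k (pHat (sample W N ω) k) - v k (𝓜.p k) -
      deriv (v k) (𝓜.p k) * (pHat (sample W N ω) k - 𝓜.p k))) := by
  have hp := isSmallOP_pHat hW_meas hW_law hW_indep k
  rcases 𝓜.p_lt_one_or k with h | ⟨h1, h2⟩
  · have hmem : 𝓜.p k ∈ Set.Ioo (0 : ℝ) 1 := ⟨𝓜.p_pos k, h⟩
    have hcd : ContDiffAt ℝ 1 (v k) (𝓜.p k) := (hv k).contDiffAt (isOpen_Ioo.mem_nhds hmem)
    have hdc : ContinuousAt (deriv (v k)) (𝓜.p k) :=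
      (((hv k).continuousOn_deriv_of_isOpen isOpen_Ioo le_rfl).continuousAt
        (isOpen_Ioo.mem_nhds hmem))
    exact ⟨hp.comp_continuousAt hcd.continuousAt, hp.comp_continuousAt hdc,
      isSmallOP_dslope (hcd.differentiableAt one_ne_zero) hp
        (isBddOP_sqrt_mul_pHat hW_meas hW_law hW_indep k)⟩
  · refine ⟨isSmallOP_zero.congr ?_, isSmallOP_zero.congr ?_, isSmallOP_zero.congr ?_⟩ <;>
    · filter_upwards [eventually_gt_atTop 0] with N hN
      refine ae_of_all _ fun ω => ?_
      rw [h2 N hN, h1]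
      simp

end Frequencies

end Asymptotics

/-! ### Asymptotic linearity for one type -/

section CrossFitAsymptotics

variable {K : ℕ} {M d : Fin K → ℕ} {𝓜 : Model M d} {Ω : Type*} [MeasurableSpace Ω]
  {P : Measure Ω} [IsProbabilityMeasure P] {W : ℕ → Ω → Cluster M d}
  {𝒰 : Type*} [MeasurableSpace 𝒰] {U : Ω → 𝒰} (S : CrossFit M d 𝒰) {w gLim : VecFun M d}
  {k : Fin K}

namespace CrossFit

/-- The error of the cross-fitted score of cluster `i`. -/
def crossDiff (𝓜 : Model M d) (w gLim : VecFun M d) (W : ℕ → Ω → Cluster M d) (U : Ω → 𝒰)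
    (k : Fin K) (N : ℕ) (i : Fin N) (ω : Ω) : ℝ :=
  S.crossScore w 𝓜.propensity (U ω) (sample W N ω) k i -
    score w 𝓜.propensity gLim k (obs (W i ω))

variable (hW_meas : ∀ i, Measurable (W i)) (hW_law : ∀ i, P.map (W i) = 𝓜.clusterLaw)
  (hW_indep : iIndepFun W P)
  (hm : Measurable (score w 𝓜.propensity gLim k))
  (hL2 : MemLp (score w 𝓜.propensity gLim k) 2 𝓜.obsLaw)
  (hmean : ∫ o, score w 𝓜.propensity gLim k o ∂𝓜.obsLaw = 𝓜.p k * 𝓜.theta w k)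
  (hD1 : IsSmallOP P fun N ω => (√(N : ℝ))⁻¹ * ∑ i, S.crossDiff 𝓜 w gLim W U k N i ω)
  (hD2 : IsSmallOP P (meanSq (S.crossDiff 𝓜 w gLim W U k)))
  {v : Fin K → ℝ → ℝ} (hv : ∀ k, ContDiffOn ℝ 1 (v k) (Set.Ioo 0 1))

include hW_meas hW_law hW_indep hm hL2 hmean hD1

theorem isSmallOP_thetaTilde :
    IsSmallOP P (fun N ω => S.thetaTilde w 𝓜.propensity (U ω) (sample W N ω) k - 𝓜.theta w k) := by
  have hp := isSmallOP_pHat hW_meas hW_law hW_indep k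
  have h1 := isSmallOP_mean_obs hW_meas hW_law hW_indep hm (hL2.integrable one_le_two)
  rw [hmean] at h1
  have h2 := h1.add (isSmallOP_inv_mul_of_inv_sqrt_mul hD1)
  have h3 : IsSmallOP P (fun N ω => (N : ℝ)⁻¹ *
      ∑ i, S.crossScore w 𝓜.propensity (U ω) (sample W N ω) k i - 𝓜.p k * 𝓜.theta w k) := by
    refine h2.congr (Eventually.of_forall fun N => ae_of_all _ fun ω => ?_)
    simp only [crossDiff, Finset.sum_sub_distrib]
    ring
  have h4 := h3.mul_tendsto (hp.comp_continuousAt (continuousAt_inv₀ (𝓜.p_pos k).ne'))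
  refine h4.congr ?_
  filter_upwards [eventually_gt_atTop 0] with N hN
  refine ae_of_all _ fun ω => ?_
  have hpk := (𝓜.p_pos k).ne'
  have h5 : 𝓜.p k * 𝓜.theta w k * (𝓜.p k)⁻¹ = 𝓜.theta w k := by field_simp
  rw [S.thetaTilde_eq_mean w 𝓜.propensity hN, h5]

include hv

/-- The linearization applies with `s` the mean of `φ_k - 1(L = k) θ_k*` at `g'` and `R` the mean
cross-fitting error. -/
theorem isSmallOP_tauTilde_summand :
    IsSmallOP P (fun N ω => √(N : ℝ) * (v k (pHat (sample W N ω) k) *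
        S.thetaTilde w 𝓜.propensity (U ω) (sample W N ω) k - v k (𝓜.p k) * 𝓜.theta w k) -
      (√(N : ℝ))⁻¹ * ∑ i : Fin N, influence 𝓜 w v gLim k (obs (W i ω))) := by
  obtain ⟨hv1, -, hv3⟩ := isSmallOP_comp_pHat hW_meas hW_law hW_indep hv k
  have ht := memLp_typeInd (𝓜 := 𝓜) k
  have htθ : MemLp (fun o : ObsCluster M d => typeInd k o * 𝓜.theta w k) 2 𝓜.obsLaw :=
    ht.mul_const _
  have hs := isBddOP_sum_obs hW_meas hW_law hW_indep
    (h := fun o => score w 𝓜.propensity gLim k o - typeInd k o * 𝓜.theta w k)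
    (hm.sub ((measurable_typeInd k).mul_const _)) (hL2.sub htθ) (by
      rw [integral_sub (hL2.integrable one_le_two) (htθ.integrable one_le_two),
        integral_mul_const, hmean, integral_typeInd, sub_self])
  have h := isSmallOP_linearization (P := P) (θ := 𝓜.theta w k) (v' := deriv (v k) (𝓜.p k))
    (𝓜.p_pos k) (v := v k)
    (ph := fun N ω => pHat (sample W N ω) k)
    (th := fun N ω => S.thetaTilde w 𝓜.propensity (U ω) (sample W N ω) k)
    (s := fun N ω => (N : ℝ)⁻¹ * ∑ i : Fin N, (score w 𝓜.propensity gLim k (obs (W i ω)) -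
      typeInd k (obs (W i ω)) * 𝓜.theta w k))
    (R := fun N ω => (N : ℝ)⁻¹ * ∑ i, S.crossDiff 𝓜 w gLim W U k N i ω)
    (by
      filter_upwards [eventually_gt_atTop 0] with N hN ω hne
      rw [S.thetaTilde_eq_mean w 𝓜.propensity hN, mul_sub, mul_left_comm, mul_inv_cancel₀ hne,
        mul_one, pHat_eq_mean]
      simp only [crossDiff, Finset.sum_sub_distrib, ← Finset.sum_mul]
      ring)
    (isSmallOP_pHat hW_meas hW_law hW_indep k) hv1 hv3
    (by simpa only [sqrt_mul_inv_mul] using hs) (by simpa only [sqrt_mul_inv_mul] using hD1)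
  refine h.congr ?_
  filter_upwards [eventually_gt_atTop 0] with N hN
  refine ae_of_all _ fun ω => ?_
  congr 1
  rw [← sqrt_mul_inv_mul]
  congr 1
  have hN' : (N : ℝ) ≠ 0 := by positivity
  rw [pHat_eq_mean]
  simp only [influence, Finset.sum_add_distrib, ← Finset.mul_sum, ← Finset.sum_mul,
    Finset.sum_sub_distrib, Finset.sum_const, Finset.card_univ, Fintype.card_fin, nsmul_eq_mul]
  field_simp

include hD2

theorem isSmallOP_meanSq_influence_sub :
    IsSmallOP P (meanSq fun N (i : Fin N) ω =>
      (v k (pHat (sample W N ω) k) * (pHat (sample W N ω) k)⁻¹ *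
        (S.crossScore w 𝓜.propensity (U ω) (sample W N ω) k i - typeInd k (obs (W i ω)) *
          S.thetaTilde w 𝓜.propensity (U ω) (sample W N ω) k)
      + (typeInd k (obs (W i ω)) - pHat (sample W N ω) k) *
        deriv (v k) (pHat (sample W N ω) k) *
        S.thetaTilde w 𝓜.propensity (U ω) (sample W N ω) k) -
      influence 𝓜 w v gLim k (obs (W i ω))) := by
  obtain ⟨hv1, hv2, -⟩ := isSmallOP_comp_pHat hW_meas hW_law hW_indep hv k
  have hp := isSmallOP_pHat hW_meas hW_law hW_indep k
  have hth := S.isSmallOP_thetaTilde hW_meas hW_law hW_indep hm hL2 hmean hD1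
  have ha := hv1.mul_tendsto (hp.comp_continuousAt (continuousAt_inv₀ (𝓜.p_pos k).ne'))
  have haθ := ha.mul_tendsto hth
  have hb := hv2.mul_tendsto hth
  have hpb := hp.mul_tendsto hb
  -- The difference of estimated and true influence splits into four arrays: a bounded coefficient
  -- times the cross-fitting error, and three vanishing coefficients times the score, the type
  -- indicator and the constant `1`.
  have h1 := isSmallOP_meanSq_smul_right (x := S.crossDiff 𝓜 w gLim W U k)
    (c := fun N ω => v k (pHat (sample W N ω) k) * (pHat (sample W N ω) k)⁻¹)
    (isBddOP_of_tendsto ha) hD2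
  have hf2 : IsBddOP P (meanSq fun N (i : Fin N) ω =>
      score w 𝓜.propensity gLim k (obs (W i ω))) := by
    have h := isBddOP_of_tendsto (isSmallOP_mean_obs hW_meas hW_law hW_indep
      (h := fun o => score w 𝓜.propensity gLim k o ^ 2) (hm.pow_const 2) hL2.integrable_sq)
    unfold meanSq
    exact h
  have h2 := isSmallOP_meanSq_smul_left
    (x := fun N (i : Fin N) ω => score w 𝓜.propensity gLim k (obs (W i ω)))
    (c := fun N ω => v k (pHat (sample W N ω) k) * (pHat (sample W N ω) k)⁻¹ -
      v k (𝓜.p k) * (𝓜.p k)⁻¹) ha hf2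
  have h3 := isSmallOP_meanSq_smul_left
    (x := fun N (i : Fin N) ω => typeInd k (obs (W i ω))) (hb.sub haθ)
    (isBddOP_meanSq_of_abs_le_one (P := P) (x := fun N (i : Fin N) ω => typeInd k (obs (W i ω)))
      fun N i ω => abs_typeInd_le_one k _)
  have h4 := isSmallOP_meanSq_smul_left (x := fun N (_ : Fin N) _ => 1) (hpb.const_mul (-1))
    (isBddOP_meanSq_of_abs_le_one (P := P) (x := fun N (_ : Fin N) _ => 1) (by simp))
  have h5 := isSmallOP_meanSq_add (isSmallOP_meanSq_add h1 h2) (isSmallOP_meanSq_add h3 h4)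
  refine h5.congr (Eventually.of_forall fun N => ae_of_all _ fun ω => ?_)
  unfold meanSq
  refine congrArg ((N : ℝ)⁻¹ * ·) (Finset.sum_congr rfl fun i _ => congrArg (· ^ 2) ?_)
  simp only [crossDiff, influence]
  ring

end CrossFit

end CrossFitAsymptotics

/-! ### Summation over types: asymptotic normality and variance consistency -/

section MainResult

variable {K : ℕ} {M d : Fin K → ℕ} {𝓜 : Model M d} {Ω : Type*} [MeasurableSpace Ω]
  {P : Measure Ω} {W : ℕ → Ω → Cluster M d} {𝒰 : Type*} [MeasurableSpace 𝒰] {U : Ω → 𝒰}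
  (S : CrossFit M d 𝒰) {w gLim : VecFun M d}

namespace CrossFit

variable {C : ℝ} {k : Fin K}
  (hgTilde_bdd : ∀ (N : ℕ) (ℓ : Fin 2) (a : Treat (M k)), ∀ᵐ ω ∂P, ∀ᵐ x ∂(𝓜.covLaw k),
    ‖S.gTilde (U ω) (sample W N ω) ℓ k a x‖ ≤ C)

include hgTilde_bdd

theorem ae_mem_boundedFit (N : ℕ) :
    ∀ᵐ ω ∂P, ∀ ℓ, (U ω, sample W N ω) ∈ S.boundedFit 𝓜 C N ℓ k :=
  ae_all_iff.2 fun ℓ => ae_all_iff.2 fun a => hgTilde_bdd N ℓ a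

theorem isSmallOP_sum_crossDiff
    (h : ∀ ℓ, IsSmallOP P
      (fun N ω => (√(N : ℝ))⁻¹ * ∑ i, S.sampleDiff 𝓜 w gLim C W U N ℓ k i ω)) :
    IsSmallOP P (fun N ω => (√(N : ℝ))⁻¹ * ∑ i, S.crossDiff 𝓜 w gLim W U k N i ω) := by
  refine (IsSmallOP.sum (s := Finset.univ) fun ℓ _ => h ℓ).congr
    (Eventually.of_forall fun N => ?_)
  filter_upwards [S.ae_mem_boundedFit hgTilde_bdd N] with ω hω
  rw [← Finset.mul_sum, Finset.sum_comm]
  exact congrArg _ (Finset.sum_congr rfl fun i _ => S.crossScore_sub_eq_sum hω i)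

theorem isSmallOP_meanSq_crossDiff
    (h : ∀ ℓ, IsSmallOP P
      (fun N ω => (N : ℝ)⁻¹ * ∑ i, S.sampleDiff 𝓜 w gLim C W U N ℓ k i ω ^ 2)) :
    IsSmallOP P (meanSq (S.crossDiff 𝓜 w gLim W U k)) := by
  refine (IsSmallOP.sum (s := Finset.univ) fun ℓ _ => h ℓ).congr
    (Eventually.of_forall fun N => ?_)
  filter_upwards [S.ae_mem_boundedFit hgTilde_bdd N] with ω hω
  rw [← Finset.mul_sum, Finset.sum_comm]
  exact congrArg _ (Finset.sum_congr rfl fun i _ => S.crossScore_sub_sq_eq_sum hω i)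

end CrossFit

variable (hm : ∀ k, Measurable (score w 𝓜.propensity gLim k))
  (hL2 : ∀ k, MemLp (score w 𝓜.propensity gLim k) 2 𝓜.obsLaw)
  (v : Fin K → ℝ → ℝ)

include hm in
theorem measurable_sum_influence : Measurable fun o => ∑ k, influence 𝓜 w v gLim k o :=
  Finset.measurable_sum _ fun k _ => measurable_influence v (hm k)

include hL2 in
theorem memLp_sum_influence : MemLp (fun o => ∑ k, influence 𝓜 w v gLim k o) 2 𝓜.obsLaw :=
  memLp_finsetSum _ fun k _ => memLp_influence v (hL2 k)

include hL2 in
theorem integral_sum_influence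
    (hmean : ∀ k, ∫ o, score w 𝓜.propensity gLim k o ∂𝓜.obsLaw = 𝓜.p k * 𝓜.theta w k) :
    ∫ o, ∑ k, influence 𝓜 w v gLim k o ∂𝓜.obsLaw = 0 := by
  rw [integral_finsetSum Finset.univ fun k _ => (memLp_influence v (hL2 k)).integrable one_le_two]
  exact Finset.sum_eq_zero fun k _ => integral_influence v (hL2 k) (hmean k)

include hm hL2

omit hm in
theorem memLp_delta : MemLp (fun z => 𝓜.delta w v gLim (obs z)) 2 𝓜.clusterLaw := by
  have h : MemLp (fun o => 𝓜.delta w v gLim o) 2 𝓜.obsLaw := by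
    simp_rw [delta_eq]
    exact (memLp_sum_influence hL2 v).add (memLp_const _)
  exact (memLp_map_measure_iff h.aestronglyMeasurable measurable_obs.aemeasurable).1 h

omit hL2 in
theorem variance_delta : Var[fun z => 𝓜.delta w v gLim (obs z); 𝓜.clusterLaw] =
    Var[fun o => ∑ k, influence 𝓜 w v gLim k o; 𝓜.obsLaw] := by
  have hs := measurable_sum_influence hm v
  rw [← variance_add_const hs.aestronglyMeasurable (𝓜.tau w v), Model.obsLaw,
    variance_map (hs.add_const _).aemeasurable measurable_obs.aemeasurable]
  simp_rw [delta_eq]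
  rfl

variable [IsProbabilityMeasure P] (hW_meas : ∀ i, Measurable (W i))
  (hW_law : ∀ i, P.map (W i) = 𝓜.clusterLaw) (hW_indep : iIndepFun W P)
  (hmean : ∀ k, ∫ o, score w 𝓜.propensity gLim k o ∂𝓜.obsLaw = 𝓜.p k * 𝓜.theta w k)
  (hD1 : ∀ k, IsSmallOP P fun N ω => (√(N : ℝ))⁻¹ * ∑ i, S.crossDiff 𝓜 w gLim W U k N i ω)
  (hD2 : ∀ k, IsSmallOP P (meanSq (S.crossDiff 𝓜 w gLim W U k)))
  {v : Fin K → ℝ → ℝ} (hv : ∀ k, ContDiffOn ℝ 1 (v k) (Set.Ioo 0 1))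

namespace CrossFit

include hW_meas hW_law hW_indep hmean hD1 hv

/-- Asymptotic normality of the cross-fitting estimator. -/
theorem tendstoInDistribution_tauTilde (hU_meas : Measurable U)
    (hw_meas : ∀ k a, Measurable (w k a)) :
    TendstoInDistribution (fun (N : ℕ) ω => √(N : ℝ) *
        (S.tauTilde w v 𝓜.propensity (U ω) (sample W N ω) - 𝓜.tau w v))
      atTop (id : ℝ → ℝ) (fun _ => P)
      (gaussianReal 0 (Var[fun o => ∑ k, influence 𝓜 w v gLim k o; 𝓜.obsLaw]).toNNReal) := by
  refine tendstoInDistribution_of_tendstoInMeasure_sub _ _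
    (tendstoInDistribution_sum_obs hW_meas hW_law hW_indep (measurable_sum_influence hm v)
      (memLp_sum_influence hL2 v) (integral_sum_influence hL2 v hmean)) ?_ fun N => ?_
  · rw [tendstoInMeasure_zero_iff_isSmallOP]
    refine (IsSmallOP.sum (s := Finset.univ) fun k _ => S.isSmallOP_tauTilde_summand hW_meas
      hW_law hW_indep (hm k) (hL2 k) (hmean k) (hD1 k) hv).congr
      (Eventually.of_forall fun N => ae_of_all _ fun ω => ?_)
    simp only [Pi.sub_apply, Finset.sum_sub_distrib, ← Finset.mul_sum, tauTilde, Model.tau]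
    rw [Finset.sum_comm]
  · have h := (S.measurable_tauTilde (𝓜 := 𝓜) (N := N) hw_meas v).comp
      (hU_meas.prodMk (measurable_sample hW_meas N))
    exact ((h.sub_const _).const_mul _).aemeasurable

include hD2

/-- Consistency of the variance estimator. -/
theorem isSmallOP_sigmaSqTilde :
    IsSmallOP P (fun N ω => S.sigmaSqTilde w v 𝓜.propensity (U ω) (sample W N ω) -
      Var[fun o => ∑ k, influence 𝓜 w v gLim k o; 𝓜.obsLaw]) := by
  have hs := measurable_sum_influence hm v
  have hs2 := memLp_sum_influence hL2 v
  have h1 := isSmallOP_mean_obs hW_meas hW_law hW_indep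
    (h := fun o => (∑ k, influence 𝓜 w v gLim k o) ^ 2) (hs.pow_const 2) hs2.integrable_sq
  rw [← variance_of_integral_eq_zero hs.aemeasurable (integral_sum_influence hL2 v hmean)] at h1
  simp_rw [S.sigmaSqTilde_eq]
  refine isSmallOP_meanSq_sub
    (x := fun N (i : Fin N) ω => ∑ k, influence 𝓜 w v gLim k (obs (W i ω)))
    (y := fun N (i : Fin N) ω => ∑ k, (v k (pHat (sample W N ω) k) * (pHat (sample W N ω) k)⁻¹ *
        (S.crossScore w 𝓜.propensity (U ω) (sample W N ω) k i - typeInd k (obs (W i ω)) *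
          S.thetaTilde w 𝓜.propensity (U ω) (sample W N ω) k)
      + (typeInd k (obs (W i ω)) - pHat (sample W N ω) k) *
        deriv (v k) (pHat (sample W N ω) k) *
        S.thetaTilde w 𝓜.propensity (U ω) (sample W N ω) k)) h1 ?_
  simp_rw [← Finset.sum_sub_distrib]
  exact isSmallOP_meanSq_sum fun k _ => S.isSmallOP_meanSq_influence_sub hW_meas
      hW_law hW_indep (hm k) (hL2 k) (hmean k) (hD1 k) (hD2 k) hv

end CrossFit

end MainResult

end PartialInterference

end

/-- Finiteness of `σ²` is expressed by square integrability of `δ'`, because the real-valued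
variance would take a default value if it were infinite. -/
theorem corollary4 {K : ℕ} (M d : Fin K → ℕ) (𝓜 : PartialInterference.Model M d)
    (hA : 𝓜.CausalAssumptions)
    -- the estimand: weights `w_k(a, x)` and smooth functions `v_k` of the type probabilities
    (w : PartialInterference.VecFun M d) (hw_meas : ∀ k a, Measurable (w k a))
    (hw_bdd : ∃ Cw : ℝ, ∀ k a, ∀ᵐ x ∂(𝓜.covLaw k), ‖w k a x‖ ≤ Cw)
    (v : Fin K → ℝ → ℝ) (hv : ∀ k, ContDiffOn ℝ 1 (v k) (Set.Ioo 0 1))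
    -- the sample of independent clusters
    {Ω : Type*} [MeasurableSpace Ω] (P : Measure Ω) [IsProbabilityMeasure P]
    (W : ℕ → Ω → PartialInterference.Cluster M d) (hW_meas : ∀ i, Measurable (W i))
    (hW_law : ∀ i, P.map (W i) = 𝓜.clusterLaw) (hW_indep : iIndepFun W P)
    -- the cross-fitting procedure and its auxiliary randomness
    {𝒰 : Type*} [MeasurableSpace 𝒰] (U : Ω → 𝒰) (hU_meas : Measurable U)
    (hU_indep : IndepFun U (fun ω i => W i ω) P)
    (S : PartialInterference.CrossFit M d 𝒰)
    -- boundedness of the nuisance functions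
    (gLim : PartialInterference.VecFun M d) (hgLim_meas : ∀ k a, Measurable (gLim k a))
    (C : ℝ) (hC : 0 < C)
    (hg_bdd : ∀ k a, ∀ᵐ x ∂(𝓜.covLaw k), ‖𝓜.outcomeReg k a x‖ ≤ C)
    (hcov_bdd : ∀ k a, ∀ᵐ x ∂(𝓜.covLaw k),
      ‖Matrix.toEuclideanCLM (𝕜 := ℝ) (𝓜.outcomeCov k a x)‖ ≤ C)
    (hgTilde_bdd : ∀ (N : ℕ) (ℓ : Fin 2) (k : Fin K) (a : PartialInterference.Treat (M k)),
      ∀ᵐ ω ∂P, ∀ᵐ x ∂(𝓜.covLaw k),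
        ‖S.gTilde (U ω) (fun i : Fin N => PartialInterference.obs (W i ω)) ℓ k a x‖ ≤ C)
    (hgLim_bdd : ∀ k a, ∀ᵐ x ∂(𝓜.covLaw k), ‖gLim k a x‖ ≤ C)
    -- convergence of the fitted outcome regressions to `gLim`
    (r : ℕ → ℝ) (hr : Tendsto r atTop (𝓝 0))
    (hconv : ∀ (ℓ : Fin 2) (k : Fin K) (a : PartialInterference.Treat (M k)),
      PartialInterference.IsBigOP P
        (fun N ω => ∫ x, ‖gLim k a x -
            S.gTilde (U ω) (fun i : Fin N => PartialInterference.obs (W i ω)) ℓ k a x‖ ^ 2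
          ∂(𝓜.covLaw k))
        (fun N => r N ^ 2)) :
    MemLp (fun z => 𝓜.delta w v gLim (PartialInterference.obs z)) 2 𝓜.clusterLaw ∧
    TendstoInDistribution
      (fun (N : ℕ) ω => √(N : ℝ) *
        (S.tauTilde w v 𝓜.propensity (U ω)
          (fun i : Fin N => PartialInterference.obs (W i ω)) - 𝓜.tau w v))
      atTop (id : ℝ → ℝ) (fun _ => P)
      (gaussianReal 0
        (Var[fun z => 𝓜.delta w v gLim (PartialInterference.obs z); 𝓜.clusterLaw]).toNNReal) ∧
    TendstoInMeasure P
      (fun (N : ℕ) ω => S.sigmaSqTilde w v 𝓜.propensity (U ω)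
        (fun i : Fin N => PartialInterference.obs (W i ω)))
      atTop
      (fun _ => Var[fun z => 𝓜.delta w v gLim (PartialInterference.obs z); 𝓜.clusterLaw]) := by
  obtain ⟨c, hc, hpos⟩ := hA.positivity
  obtain ⟨Cw, hw⟩ := hw_bdd
  have he : ∀ k a, ∀ᵐ x ∂(𝓜.covLaw k), c < 𝓜.propensity k a x :=
    fun k a => (hpos k a).mono fun _ h => h.1
  have hY := fun k => PartialInterference.memLp_outcomeOf hA k (hg_bdd k) (hcov_bdd k)
  have hm := fun k => PartialInterference.measurable_score_const (hw_meas k)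
    (PartialInterference.measurable_propensity (𝓜 := 𝓜) k) (hgLim_meas k)
  have hcore := fun k => PartialInterference.memLp_scoreCore (hw_meas k) hc (hw k) (he k) (hY k)
    (hgLim_meas k) (hgLim_bdd k)
  have hL2 := fun k => PartialInterference.memLp_score (hm k) (hcore k)
  have hmean := fun k => PartialInterference.integral_score (hm k) (hcore k)
    (PartialInterference.integral_scoreCore hA (hw_meas k) hc (hw k) (he k) (hY k)
      (hgLim_meas k) (hgLim_bdd k))
  have hfit := fun k ℓ => S.tendsto_lintegral_fitError (hgLim_meas k) (hgLim_bdd k) ℓ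
    (fun N a => hgTilde_bdd N ℓ k a) hr (hconv ℓ k)
  have hD1 := fun k => S.isSmallOP_sum_crossDiff (fun N ℓ a => hgTilde_bdd N ℓ k a) fun ℓ =>
    S.isSmallOP_sum_sampleDiff hW_meas hW_law hW_indep hU_meas hU_indep (hw_meas k)
      (hgLim_meas k) hc (hw k) (he k) (hgLim_bdd k) hA (hY k) ℓ (hfit k ℓ)
  have hD2 := fun k => S.isSmallOP_meanSq_crossDiff (fun N ℓ a => hgTilde_bdd N ℓ k a) fun ℓ =>
    S.isSmallOP_mean_sampleDiff_sq hW_meas hW_law hW_indep hU_meas hU_indep (hw_meas k)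
      (hgLim_meas k) hc (hw k) (he k) (hgLim_bdd k) ℓ (hfit k ℓ)
  rw [PartialInterference.variance_delta hm v, PartialInterference.tendstoInMeasure_iff_isSmallOP]
  exact ⟨PartialInterference.memLp_delta hL2 v,
    S.tendstoInDistribution_tauTilde hm hL2 hW_meas hW_law hW_indep hmean hD1 hv hU_meas hw_meas,
    S.isSmallOP_sigmaSqTilde hm hL2 hW_meas hW_law hW_indep hmean hD1 hD2 hv⟩
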